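/- Let $n\ge 1$ and $k\ge 0$ be integers and $R=\mathbb Z[x_1,\dots,x_n]=\mathbb Z[U_1,\dots,U_n]$ with $x_i=U_i$ in degree $2$. **Ozsváth–Szabó algebras.** Let $V(n,k)$ be the set of $k$-element subsets $\mathsf x\subset\{0,\dots,n\}$ and put $v_i^{\mathsf x}=|\mathsf x\cap\{i,\dots,n\}|$ for $1\le i\le n$. Let $\mathcal B_0(n,k)$ be the ring which is free over $R$ on elements $f_{\mathsf x,\mathsf y}$ ($\mathsf x,\mathsf y\in V(n,k)$), with $f_{\mathsf x,\mathsf y}f_{\mathsf y,\mathsf z}=\prod_i U_i^{g_i}f_{\mathsf x,\mathsf z}$, $g_i=\tfrac12\big(|v_i^{\mathsf x}-v_i^{\mathsf y}|+|v_i^{\mathsf y}-v_i^{\mathsf z}|-|v_i^{\mathsf x}-v_i^{\mathsf z}|\big)$, other products of these generators being zero. Let $I_{\mathsf x}=f_{\mathsf x,\mathsf x}$, let $R_i=\sum f_{\mathsf x,(\mathsf x\setminus\{i-1\})\cup\{i\}}$ over $\mathsf x$ with $\mathsf x\cap\{i-1,i\}=\{i-1\}$, and $L_i=\sum f_{\mathsf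 x,(\mathsf x\setminus\{i\})\cup\{i-1\}}$ over $\mathsf x$ with $\mathsf x\cap\{i-1,i\}=\{i\}$. Then $\mathcal B(n,k)$ is the quotient of $\mathcal B_0(n,k)$ by the two-sided ideal generated by all $R_{i-1}R_i$, all $L_iL_{i-1}$, and all $U_iI_{\mathsf x}$ with $\mathsf x\cap\{i-1,i\}=\varnothing$. It is graded by $\deg f_{\mathsf x,\mathsf y}=\sum_i|v_i^{\mathsf x}-v_i^{\mathsf y}|$, and $\mathcal B_l(n,k)=\bigoplus I_{\mathsf x}\mathcal B(n,k)I_{\mathsf y}$ over $\mathsf x,\mathsf y\not\ni n$. **Sartori's algebra over $\mathbb Z$.** Let $D_{n,k}$ be the set of sequences of $n$ symbols $\vee,\wedge$ with exactly $k$ symbols $\wedge$. For $\mu\in D_{n,k}$ let $b_i^\mu-1$ be the number of $\wedge$'s strictly to the right of position $i$, let $\vee_j^\mu$ be the position of the $j$-th $\vee$ ($\vee^\mu_{n-k+1}=n+1$), and put $R_{b^\mu}=R/(h_{b_i^\mu}(x_1,\dots,x_i):1\le i\le n)$, with $h_d$ the complete homogeneous symmetric polynomials. Let $$\mathcal A^{\mathbb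 Z}_{n,k}=\bigoplus_{\lambda,\mu\in D_{n,k}}\operatorname{Hom}_R(R_{b^\lambda},R_{b^\mu})/W_{\lambda,\mu},$$ with multiplication the composition of maps. Here $W_{\lambda,\mu}$ is everything if $\vee_j^\mu\ge\vee_{j+1}^\lambda$ or $\vee_j^\lambda\ge\vee_{j+1}^\mu$ for some $1\le j\le n-k-1$; otherwise it is the $R$-submodule generated by the maps $1\mapsto x_{\alpha}x_{\alpha+1}\cdots x_{\beta}\prod_i x_i^{\max(b_i^\mu-b_i^\lambda,0)}$ for $1\le j\le n-k$, $\alpha=\max(\vee_j^\lambda,\vee_j^\mu)$, $\beta=\min(\vee_{j+1}^\lambda,\vee_{j+1}^\mu)-1$. A map $1\mapsto p$ with $p$ homogeneous has degree $\deg p+\sum_i b_i^\lambda-\sum_i b_i^\mu$. **Maps and bimodules.** For $\mathsf x\not\ni n$ let $\mu^{\mathsf x}\in D_{n,k}$ have a $\wedge$ in position $i$ exactly when $i-1\in\mathsf x$. Let $\Xi\colon\mathcal B_l(n,k)\to\mathcal A^{\mathbb Z}_{n,k}$ be the $R$-linear ring homomorphism sending $f_{\mathsf x,\mathsf y}$ to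 the class of $R_{b^\lambda}\to R_{b^\mu}$, $1\mapsto\prod_ix_i^{\max(b_i^\mu-b_i^\lambda,0)}$, where $\mu=\mu^{\mathsf x}$, $\lambda=\mu^{\mathsf y}$. In $\mathcal A^{\mathbb Z}_{n,k}$ let $e_k^\vee$ (resp. $e_k^\wedge$) be the sum of the identity maps of the $R_{b^\lambda}$ for which $\lambda$ begins with $\vee$ (resp. $\wedge$); in $\mathcal B_l(n,k)$ let $e_k^\vee$ (resp. $e_k^\wedge$) be the sum of the $I_{\mathsf x}$ with $0\notin\mathsf x$ (resp. $0\in\mathsf x$). Replacing a leading $\wedge$ by $\vee$ does not change the modules $R_b$, and induces a ring homomorphism $\Psi\colon e^\wedge_{k+1}\mathcal A^{\mathbb Z}_{n,k+1}e^\wedge_{k+1}\to e^\vee_k\mathcal A^{\mathbb Z}_{n,k}e^\vee_k$; similarly $f_{\mathsf x,\mathsf y}\mapsto f_{\mathsf x\setminus\{0\},\mathsf y\setminus\{0\}}$ ($0\in\mathsf x\cap\mathsf y$) induces an $R$-linear ring homomorphism $\Psi'\colon e^\wedge_{k+1}\mathcal B_l(n,k+1)e^\wedge_{k+1}\to e^\vee_k\mathcal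 B_l(n,k)e^\vee_k$. Let $\mathbf F^S_k=\mathcal A^{\mathbb Z}_{n,k}e_k^\vee$, an $(\mathcal A^{\mathbb Z}_{n,k},\mathcal A^{\mathbb Z}_{n,k+1})$-bimodule with right action $p\cdot a=p\,\Psi(e^\wedge_{k+1}ae^\wedge_{k+1})$, and $\mathbf F^{OSz}_k=\mathcal B_l(n,k)e_k^\vee$, a $(\mathcal B_l(n,k),\mathcal B_l(n,k+1))$-bimodule with right action $p\cdot b=p\,\Psi'(e^\wedge_{k+1}be^\wedge_{k+1})$. Let $\mathcal F^S_k=\mathbf F^S_k\otimes_{\mathcal A^{\mathbb Z}_{n,k+1}}-$, $\mathcal F^{OSz}_k=\mathbf F^{OSz}_k\otimes_{\mathcal B_l(n,k+1)}-$, and $\mathrm{pr}_k=\mathcal A^{\mathbb Z}_{n,k}\otimes_{\mathcal B_l(n,k)}-$, where $\mathcal A^{\mathbb Z}_{n,k}$ is a right $\mathcal B_l(n,k)$-module through $\Xi$. **Theorem.** (1) The $(\mathcal A^{\mathbb Z}_{n,k},\mathcal B_l(n,k+1))$-bimodules ${}_{\mathrm{pr}}(\mathbf F^{OSz}_k)=\mathcal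 A^{\mathbb Z}_{n,k}\otimes_{\mathcal B_l(n,k)}\mathbf F^{OSz}_k$ and $(\mathbf F^S_k)_{\mathrm{infl}}$, which is $\mathbf F^S_k$ with the right action of $\mathcal B_l(n,k+1)$ through $\Xi\colon\mathcal B_l(n,k+1)\to\mathcal A^{\mathbb Z}_{n,k+1}$, are isomorphic, by an isomorphism that preserves the gradings. (2) The functors $\mathcal F^S_k\circ\mathrm{pr}_{k+1}$ and $\mathrm{pr}_k\circ\mathcal F^{OSz}_k$ from left $\mathcal B_l(n,k+1)$-modules to left $\mathcal A^{\mathbb Z}_{n,k}$-modules are naturally isomorphic, by an isomorphism that preserves the gradings on every graded module; in particular this holds on finitely generated projective graded modules. -/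

import Mathlib

namespace OSzSartori

section definitions
open MvPolynomial Finset CategoryTheory

/-! ### The rings `R_b` -/

/-- The polynomial ring `ℤ[x₁, …, xₙ]`; the variable `x_{t+1}` (or `U_{t+1}`) is `X t`. -/
abbrev R (n : ℕ) : Type := MvPolynomial (Fin n) ℤ

/-- The complete homogeneous symmetric polynomial `h_d(x₁, …, xᵢ)` in the first `i` variables. -/
noncomputable def hPoly (n i d : ℕ) : R n :=
  ∑ m ∈ (univ.filter (fun t : Fin n => t.val < i)).finsuppAntidiag d, monomial m 1

/-- The ideal `I_b = ⟨h_{b₁}(x₁), h_{b₂}(x₁,x₂), …, h_{bₙ}(x₁,…,xₙ)⟩`. -/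
noncomputable def bIdeal {n : ℕ} (b : Fin n → ℕ) : Ideal (R n) :=
  Ideal.span (Set.range fun t : Fin n => hPoly n (t.val + 1) (b t))

lemma hPoly_deg_zero (n i : ℕ) : hPoly n i 0 = 1 := by
  simp [hPoly]

lemma hPoly_zero (n d : ℕ) (hd : d ≠ 0) : hPoly n 0 d = 0 := by
  simp [hPoly, finsuppAntidiag_empty_of_ne_zero hd]

lemma sum_single_lt (n i : ℕ) (hi : i < n) :
    ∑ t ∈ univ.filter (fun t : Fin n => t.val < i + 1),
      (Finsupp.single (⟨i, hi⟩ : Fin n) 1) t = 1 := by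
  rw [sum_eq_single_of_mem (⟨i, hi⟩ : Fin n) (by simp) (fun t _ h => Finsupp.single_eq_of_ne h)]
  exact Finsupp.single_eq_same

lemma hPoly_succ (n i d : ℕ) (hi : i < n) :
    hPoly n (i + 1) (d + 1) = hPoly n i (d + 1) + X ⟨i, hi⟩ * hPoly n (i + 1) d := by
  classical
  unfold hPoly
  rw [← sum_filter_add_sum_filter_not _ (fun m : Fin n →₀ ℕ => m ⟨i, hi⟩ = 0)]
  congr 1
  · apply sum_congr _ (fun _ _ => rfl)
    ext m
    simp only [mem_filter, mem_finsuppAntidiag]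
    constructor
    · rintro ⟨⟨h1, h2⟩, h3⟩
      refine ⟨?_, ?_⟩
      · rw [← h1]
        apply sum_subset
        · intro t; simp only [mem_filter, mem_univ, true_and]; omega
        · intro t; simp only [mem_filter, mem_univ, true_and]
          intro h4 h5
          have : t = ⟨i, hi⟩ := Fin.ext (by show t.val = i; omega)
          rw [this]; exact h3
      · intro t ht
        have := h2 ht
        simp only [mem_filter, mem_univ, true_and] at this ⊢
        rcases Nat.lt_or_ge t.val i with h | h
        · exact h
        · have : t = ⟨i, hi⟩ := Fin.ext (by show t.val = i; omega)
          rw [this] at ht; simp [h3] at ht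
    · rintro ⟨h1, h2⟩
      have h3 : m ⟨i, hi⟩ = 0 := by
        by_contra h
        have := h2 (Finsupp.mem_support_iff.2 h)
        simp at this
      refine ⟨⟨?_, ?_⟩, h3⟩
      · rw [← h1]
        symm
        apply sum_subset
        · intro t; simp only [mem_filter, mem_univ, true_and]; omega
        · intro t; simp only [mem_filter, mem_univ, true_and]
          intro h4 h5
          have : t = ⟨i, hi⟩ := Fin.ext (by show t.val = i; omega)
          rw [this]; exact h3
      · intro t ht
        have := h2 ht
        simp only [mem_filter, mem_univ, true_and] at this ⊢
        omega
  · rw [mul_sum]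
    symm
    refine sum_bij' (fun m _ => m + Finsupp.single ⟨i, hi⟩ 1)
      (fun m _ => m - Finsupp.single ⟨i, hi⟩ 1) ?_ ?_ ?_ ?_ ?_
    · intro m hm
      simp only [mem_filter, mem_finsuppAntidiag] at hm ⊢
      refine ⟨⟨?_, ?_⟩, by simp⟩
      · simp only [Finsupp.coe_add, Pi.add_apply, sum_add_distrib, hm.1]
        rw [sum_single_lt]
      · intro t ht
        rcases Finset.mem_union.1 (Finsupp.support_add ht) with h | h
        · exact hm.2 h
        · have := Finsupp.support_single_subset h
          simp at this; simp [this]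
    · intro m hm
      simp only [mem_filter, mem_finsuppAntidiag] at hm ⊢
      have hle : Finsupp.single ⟨i, hi⟩ 1 ≤ m := by
        rw [Finsupp.single_le_iff]; omega
      refine ⟨?_, ?_⟩
      · have h1 := hm.1.1
        rw [← tsub_add_cancel_of_le hle] at h1
        simp only [Finsupp.coe_add, Pi.add_apply, sum_add_distrib] at h1
        have h2 := sum_single_lt n i hi
        have h3 : (univ.filter (fun t : Fin n => t.val < i + 1)).sum
            ⇑(m - Finsupp.single (⟨i, hi⟩ : Fin n) (1 : ℕ)) =
          ∑ x ∈ univ.filter (fun t : Fin n => t.val < i + 1),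
            (m - Finsupp.single (⟨i, hi⟩ : Fin n) (1 : ℕ) : Fin n →₀ ℕ) x := rfl
        omega
      · intro t ht
        apply hm.1.2
        simp only [Finsupp.mem_support_iff, Finsupp.tsub_apply] at ht ⊢
        omega
    · intro m _; simp
    · intro m hm
      simp only [mem_filter, mem_finsuppAntidiag] at hm
      apply tsub_add_cancel_of_le
      rw [Finsupp.single_le_iff]; omega
    · intro m _
      rw [X, monomial_mul, add_comm]; simp

lemma bIdeal_gen {n : ℕ} (b : Fin n → ℕ) (t : Fin n) : hPoly n (t.val + 1) (b t) ∈ bIdeal b :=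
  Ideal.subset_span ⟨t, rfl⟩

/-- `b` decreases by at most one at each step and is positive. -/
def Adm {n : ℕ} (b : Fin n → ℕ) : Prop :=
  (∀ t, 1 ≤ b t) ∧ ∀ s t : Fin n, s.val + 1 = t.val → b s ≤ b t + 1

lemma hPoly_mem {n : ℕ} {b : Fin n → ℕ} (hb : Adm b) :
    ∀ (i : ℕ) (hi : i < n) (a : ℕ), b ⟨i, hi⟩ ≤ a → hPoly n (i + 1) a ∈ bIdeal b := by
  intro i
  induction i with
  | zero =>
    intro hi a ha
    induction a, ha using Nat.le_induction with
    | base => exact bIdeal_gen b ⟨0, hi⟩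
    | succ a _ ih =>
      rw [hPoly_succ n 0 a hi, hPoly_zero _ _ (by omega), zero_add]
      exact Ideal.mul_mem_left _ _ ih
  | succ i ih0 =>
    intro hi a ha
    induction a, ha using Nat.le_induction with
    | base => exact bIdeal_gen b ⟨i + 1, hi⟩
    | succ a ha ih =>
      rw [hPoly_succ n (i + 1) a hi]
      refine Ideal.add_mem _ (ih0 (by omega) _ ?_) (Ideal.mul_mem_left _ _ ih)
      have := hb.2 ⟨i, by omega⟩ ⟨i + 1, hi⟩ rfl
      omega

/-- partial product of powers of variables -/
noncomputable def pp {n : ℕ} (c : Fin n → ℕ) (i : ℕ) : R n :=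
  ∏ t ∈ univ.filter (fun t : Fin n => t.val < i), X t ^ c t

lemma pp_succ {n : ℕ} (c : Fin n → ℕ) (i : ℕ) (hi : i < n) :
    pp c (i + 1) = pp c i * X ⟨i, hi⟩ ^ c ⟨i, hi⟩ := by
  unfold pp
  rw [show univ.filter (fun t : Fin n => t.val < i + 1)
    = insert ⟨i, hi⟩ (univ.filter (fun t : Fin n => t.val < i)) by
      ext t; simp [Fin.ext_iff]; omega]
  rw [prod_insert (by simp), mul_comm]

lemma pow_mul_hPoly {n : ℕ} (I : Ideal (R n)) (w : R n) (i : ℕ) (hi : i < n) (B : ℕ)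
    (hprev : ∀ a, B ≤ a → w * hPoly n i (a + 1) ∈ I) (m : ℕ) :
    ∀ a, B ≤ a → w * X ⟨i, hi⟩ ^ m * hPoly n (i + 1) a - w * hPoly n (i + 1) (a + m) ∈ I := by
  induction m with
  | zero => intro a _; simp
  | succ m ih =>
    intro a ha
    have h1 := ih (a + 1) (by omega)
    rw [hPoly_succ n i a hi] at h1
    have h2 := Ideal.mul_mem_left I (X ⟨i, hi⟩ ^ m) (hprev a ha)
    rw [show a + (m + 1) = a + 1 + m by omega]
    convert Ideal.sub_mem _ h1 h2 using 1
    ring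

lemma pp_mul_mem {n : ℕ} {b b' : Fin n → ℕ} (hb : Adm b) (hb' : Adm b') :
    ∀ (i : ℕ) (hi : i < n) (a : ℕ), b ⟨i, hi⟩ ≤ a →
      pp (fun t => b' t - b t) (i + 1) * hPoly n (i + 1) a ∈ bIdeal b' := by
  intro i
  induction i with
  | zero =>
    intro hi a ha
    rw [pp_succ _ _ hi]
    have := pow_mul_hPoly (bIdeal b') (pp (fun t => b' t - b t) 0) 0 hi 0
      (by intro a _; rw [hPoly_zero _ _ (by omega)]; simp) (b' ⟨0, hi⟩ - b ⟨0, hi⟩) a (by omega)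
    rw [← Submodule.sub_mem_iff_left _ (y := pp (fun t => b' t - b t) 0 *
      hPoly n (0 + 1) (a + (b' ⟨0, hi⟩ - b ⟨0, hi⟩)))]
    · exact this
    · exact Ideal.mul_mem_left _ _ (hPoly_mem hb' 0 hi _ (by omega))
  | succ i ih0 =>
    intro hi a ha
    rw [pp_succ _ _ hi]
    have := pow_mul_hPoly (bIdeal b') (pp (fun t => b' t - b t) (i + 1)) (i + 1) hi (b ⟨i + 1, hi⟩)
      (by
        intro a ha
        apply ih0
        have := hb.2 ⟨i, by omega⟩ ⟨i + 1, hi⟩ rfl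
        omega) (b' ⟨i + 1, hi⟩ - b ⟨i + 1, hi⟩) a ha
    rw [← Submodule.sub_mem_iff_left _ (y := pp (fun t => b' t - b t) (i + 1) *
      hPoly n (i + 1 + 1) (a + (b' ⟨i + 1, hi⟩ - b ⟨i + 1, hi⟩)))]
    · exact this
    · exact Ideal.mul_mem_left _ _ (hPoly_mem hb' (i + 1) hi _ (by omega))

/-- The monomial `x^c`. -/
noncomputable def xpow {n : ℕ} (c : Fin n → ℕ) : R n := ∏ t, X t ^ c t

lemma xpow_add {n : ℕ} (c d : Fin n → ℕ) : xpow (fun t => c t + d t) = xpow c * xpow d := by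
  simp [xpow, pow_add, prod_mul_distrib]

lemma xpow_mul_mem {n : ℕ} {b b' : Fin n → ℕ} (hb : Adm b) (hb' : Adm b') {p : R n}
    (hp : p ∈ bIdeal b) : xpow (fun t => b' t - b t) * p ∈ bIdeal b' := by
  have key : bIdeal b ≤
      Submodule.comap (LinearMap.mulLeft (R n) (xpow fun t => b' t - b t)) (bIdeal b') := by
    conv_lhs => unfold bIdeal
    rw [Ideal.span_le]
    rintro _ ⟨t, rfl⟩
    have h := pp_mul_mem hb hb' t.val t.isLt (b t) le_rfl
    have hx : xpow (fun t => b' t - b t) = pp (fun t => b' t - b t) (t.val + 1) *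
        ∏ s ∈ univ.filter (fun s : Fin n => ¬ s.val < t.val + 1), X s ^ (b' s - b s) := by
      rw [xpow, pp, prod_filter_mul_prod_filter_not]
    show xpow (fun t => b' t - b t) * hPoly n (t.val + 1) (b t) ∈ bIdeal b'
    rw [hx, mul_right_comm]
    exact Ideal.mul_mem_right _ _ h
  exact key hp

section colon
open Polynomial

lemma colon_step {S : Type} [CommRing S] (f g : S[X]) (hg : g.Monic) (hf : f.Monic) (m : ℕ)
    (K : Ideal S) (u : S) (hN : ∀ s, (∀ h ∈ K, s * h = 0) → u ∣ s)
    (hm : m = 0 ∨ g - Polynomial.X ^ m * f ∈ K.map Polynomial.C) (p : S[X])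
    (hp : ∀ h ∈ K, g ∣ p * Polynomial.C h) (hpf : g ∣ p * f) :
    ∃ v q : S[X], p = Polynomial.C u * Polynomial.X ^ m * v + g * q := by
  cases subsingleton_or_nontrivial S with
  | inl h => exact ⟨0, 0, Subsingleton.elim _ _⟩
  | inr h =>
  set r := p %ₘ g with hr
  have hpr : p = r + g * (p /ₘ g) := (Polynomial.modByMonic_add_div p g).symm
  have hann : ∀ h ∈ K, r * Polynomial.C h = 0 := by
    intro h hh
    by_contra hne
    refine hg.not_dvd_of_degree_lt hne ?_ ?_
    · refine lt_of_le_of_lt ?_ (Polynomial.degree_modByMonic_lt p hg)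
      rw [mul_comm, ← Polynomial.smul_eq_C_mul]; exact Polynomial.degree_smul_le _ _
    · have : r * Polynomial.C h = p * Polynomial.C h - g * ((p /ₘ g) * Polynomial.C h) := by
        linear_combination (-Polynomial.C h) * hpr
      rw [this]
      exact dvd_sub (hp h hh) (dvd_mul_right _ _)
  have hdvd : ∀ s : S[X], (∀ h ∈ K, s * Polynomial.C h = 0) → Polynomial.C u ∣ s := by
    intro s hs
    rw [Polynomial.C_dvd_iff_dvd_coeff]
    intro i
    apply hN
    intro h hh
    have := congrArg (fun q => q.coeff i) (hs h hh)
    simpa using this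
  rcases hm with hm | hm
  · obtain ⟨v, hv⟩ := hdvd r hann
    exact ⟨v, p /ₘ g, by subst hm; rw [pow_zero, mul_one, ← hv]; exact hpr⟩
  · have hrf : g ∣ r * f := by
      have : r * f = p * f - g * ((p /ₘ g) * f) := by
        linear_combination (-f) * hpr
      rw [this]
      exact dvd_sub hpf (dvd_mul_right _ _)
    obtain ⟨q, hq⟩ := hrf
    have hqann : ∀ h ∈ K, q * Polynomial.C h = 0 := by
      intro h hh
      apply hg.isRegular.left
      show g * (q * Polynomial.C h) = g * 0
      rw [← mul_assoc, ← hq, mul_zero, mul_right_comm, hann h hh, zero_mul]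
    have hqK : ∀ δ ∈ K.map Polynomial.C, q * δ = 0 := by
      intro δ hδ
      refine Submodule.span_induction ?_ ?_ ?_ ?_ hδ
      · rintro _ ⟨h, hh, rfl⟩; exact hqann h hh
      · simp
      · intro a b _ _ ha hb; rw [mul_add, ha, hb, add_zero]
      · intro a b _ hb; rw [smul_eq_mul, mul_left_comm, hb, mul_zero]
    have h1 := hqK _ hm
    have h2 : r = Polynomial.X ^ m * q := by
      apply hf.isRegular.left
      show f * r = f * (Polynomial.X ^ m * q)
      have : f * r = g * q := by rw [mul_comm, hq]
      rw [this]
      linear_combination h1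
    obtain ⟨v, hv⟩ := hdvd q hqann
    refine ⟨v, p /ₘ g, ?_⟩
    conv_lhs => rw [hpr, h2, hv]
    ring


noncomputable def eLast (n : ℕ) : R (n + 1) ≃ₐ[ℤ] (R n)[X] :=
  (MvPolynomial.renameEquiv ℤ finSuccEquivLast).trans (MvPolynomial.optionEquivLeft ℤ (Fin n))

lemma eLast_castSucc (n : ℕ) (j : Fin n) :
    eLast n (MvPolynomial.X j.castSucc) = Polynomial.C (MvPolynomial.X j) := by
  simp [eLast, MvPolynomial.optionEquivLeft_X_some]

lemma eLast_last (n : ℕ) : eLast n (MvPolynomial.X (Fin.last n)) = Polynomial.X := by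
  simp [eLast, MvPolynomial.optionEquivLeft_X_none]

attribute [irreducible] eLast

lemma eLast_hPoly (n : ℕ) : ∀ (i : ℕ), i ≤ n → ∀ d,
    eLast n (hPoly (n + 1) i d) = Polynomial.C (hPoly n i d) := by
  intro i
  induction i with
  | zero =>
    intro _ d
    cases d with
    | zero => simp [hPoly_deg_zero]
    | succ d => simp [hPoly_zero]
  | succ i ihi =>
    intro hi d
    induction d with
    | zero => simp [hPoly_deg_zero]
    | succ d ihd =>
      rw [hPoly_succ _ _ _ (show i < n + 1 by omega), hPoly_succ _ _ _ (show i < n by omega),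
        map_add, map_mul, ihi (by omega), ihd, map_add, map_mul]
      have hX : eLast n (MvPolynomial.X ⟨i, by omega⟩) =
        Polynomial.C (MvPolynomial.X ⟨i, by omega⟩) := eLast_castSucc n ⟨i, by omega⟩
      rw [hX]

lemma eLast_hPoly_monic (n : ℕ) : ∀ d, (eLast n (hPoly (n + 1) (n + 1) d)).Monic ∧
    (eLast n (hPoly (n + 1) (n + 1) d)).degree = d := by
  intro d
  induction d with
  | zero => simp [hPoly_deg_zero]
  | succ d ih =>
    rw [hPoly_succ _ _ _ (show n < n + 1 by omega), map_add, map_mul, eLast_hPoly n n le_rfl]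
    rw [show eLast n (MvPolynomial.X ⟨n, by omega⟩) = Polynomial.X from eLast_last n]
    have hX : (Polynomial.X * eLast n (hPoly (n + 1) (n + 1) d)).Monic :=
      Polynomial.monic_X.mul ih.1
    have hdeg : (Polynomial.X * eLast n (hPoly (n + 1) (n + 1) d)).degree = ((d + 1 : ℕ) : WithBot ℕ) := by
      rw [Polynomial.degree_mul, ih.2, Polynomial.degree_X]; push_cast; ring
    have hlt : (Polynomial.C (hPoly n n (d + 1))).degree <
        (Polynomial.X * eLast n (hPoly (n + 1) (n + 1) d)).degree := by
      rw [hdeg]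
      refine lt_of_le_of_lt Polynomial.degree_C_le ?_
      exact_mod_cast Nat.succ_pos d
    exact ⟨hX.add_of_right hlt, by rw [Polynomial.degree_add_eq_right_of_degree_lt hlt, hdeg]⟩

lemma colon {n : ℕ} : ∀ {b b' : Fin n → ℕ}, Adm b → Adm b' → ∀ p : R n,
    (∀ t : Fin n, p * hPoly n (t.val + 1) (b t) ∈ bIdeal b') →
    ∃ v, p - xpow (fun t => b' t - b t) * v ∈ bIdeal b' := by
  induction n with
  | zero =>
    intro b b' _ _ p _
    exact ⟨p, by simp [xpow]⟩
  | succ n ih =>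
    intro b b' hb hb' p hp
    set b₀ : Fin n → ℕ := fun t => b t.castSucc with hb₀
    set b₀' : Fin n → ℕ := fun t => b' t.castSucc with hb₀'
    have hA : Adm b₀ := ⟨fun t => hb.1 _, fun s t h => hb.2 _ _ (by simpa using h)⟩
    have hA' : Adm b₀' := ⟨fun t => hb'.1 _, fun s t h => hb'.2 _ _ (by simpa using h)⟩
    obtain ⟨S, _, mk, hmks, hmkk⟩ : ∃ (S : Type) (_ : CommRing S) (mk : R n →+* S),
        Function.Surjective mk ∧ ∀ q, mk q = 0 ↔ q ∈ bIdeal b₀' :=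
      ⟨R n ⧸ bIdeal b₀', inferInstance, Ideal.Quotient.mk _, Ideal.Quotient.mk_surjective,
        fun _ => Ideal.Quotient.eq_zero_iff_mem⟩
    have hmkk' : RingHom.ker mk = bIdeal b₀' := by ext q; exact hmkk q
    let φ : R (n + 1) →+* S[X] :=
      (Polynomial.mapRingHom mk).comp (eLast n : R (n + 1) →+* (R n)[X])
    have hφ : ∀ q, φ q = (eLast n q).map mk := fun q => rfl
    have hsurj : Function.Surjective φ :=
      (Polynomial.map_surjective mk hmks).comp (eLast n).surjective
    have hφh : ∀ i ≤ n, ∀ d, φ (hPoly (n + 1) i d) = Polynomial.C (mk (hPoly n i d)) := by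
      intro i hi d
      rw [hφ, eLast_hPoly n i hi, Polynomial.map_C]
    set g := φ (hPoly (n + 1) (n + 1) (b' (Fin.last n))) with hg
    set f := φ (hPoly (n + 1) (n + 1) (b (Fin.last n))) with hf
    have hgen : hPoly (n + 1) (n + 1) (b' (Fin.last n)) ∈ bIdeal b' := bIdeal_gen b' (Fin.last n)
    have hker : ∀ q, φ q = 0 → q ∈ bIdeal b' := by
      intro q hq
      have h1 : eLast n q ∈ RingHom.ker (Polynomial.mapRingHom mk) := hq
      rw [Polynomial.ker_mapRingHom, hmkk'] at h1
      have h2 : (bIdeal b₀').map Polynomial.C ≤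
          (bIdeal b').comap ((eLast n).symm : (R n)[X] →+* R (n + 1)) := by
        rw [Ideal.map_le_iff_le_comap]
        conv_lhs => unfold bIdeal
        rw [Ideal.span_le]
        rintro _ ⟨t, rfl⟩
        show (eLast n).symm (Polynomial.C (hPoly n (t.val + 1) (b₀' t))) ∈ bIdeal b'
        rw [← eLast_hPoly n _ (by omega), AlgEquiv.symm_apply_apply]
        exact bIdeal_gen b' t.castSucc
      have h3 := h2 h1
      have h4 : (eLast n).symm (eLast n q) ∈ bIdeal b' := h3
      rwa [AlgEquiv.symm_apply_apply] at h4
    have hmem : ∀ q, g ∣ φ q → q ∈ bIdeal b' := by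
      rintro q ⟨s, hs⟩
      obtain ⟨s', rfl⟩ := hsurj s
      have := hker (q - hPoly (n + 1) (n + 1) (b' (Fin.last n)) * s')
        (by rw [map_sub, map_mul, hs, sub_self])
      have h2 := Ideal.add_mem _ this (Ideal.mul_mem_right s' _ hgen)
      simpa using h2
    have hmem' : ∀ q ∈ bIdeal b', g ∣ φ q := by
      intro q hq
      have : bIdeal b' ≤ (Ideal.span {g}).comap φ := by
        conv_lhs => unfold bIdeal
        rw [Ideal.span_le]
        rintro _ ⟨t, rfl⟩
        show φ _ ∈ Ideal.span {g}
        rw [Ideal.mem_span_singleton]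
        refine Fin.lastCases ?_ (fun t => ?_) t
        · exact dvd_rfl
        · show g ∣ φ (hPoly (n + 1) (t.val + 1) (b₀' t))
          rw [hφh _ (by omega),
            show mk (hPoly n (t.val + 1) (b₀' t)) = 0 from
              (hmkk _).2 (bIdeal_gen b₀' t)]
          simp
      exact Ideal.mem_span_singleton.1 (this hq)
    obtain ⟨v, q, hvq⟩ := colon_step f g ((eLast_hPoly_monic n _).1.map mk)
      ((eLast_hPoly_monic n _).1.map mk) (b' (Fin.last n) - b (Fin.last n))
      ((bIdeal b₀).map mk) (mk (xpow fun t => b₀' t - b₀ t))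
      (by
        intro s hs
        obtain ⟨s', rfl⟩ := hmks s
        obtain ⟨v, hv⟩ := ih hA hA' s' (by
          intro t
          have := hs _ (Ideal.mem_map_of_mem mk (bIdeal_gen b₀ t))
          rw [← map_mul] at this
          exact (hmkk _).1 this)
        refine ⟨mk v, ?_⟩
        rw [← map_mul, ← sub_eq_zero, ← map_sub]
        exact (hmkk _).2 hv)
      (by
        rcases Nat.le_total (b' (Fin.last n)) (b (Fin.last n)) with h | h
        · left; omega
        · right
          have := pow_mul_hPoly (((((bIdeal b₀).map mk).map Polynomial.C)).comap φ) 1 n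
            (by omega) (b (Fin.last n)) (by
              intro a ha
              rw [one_mul, Ideal.mem_comap, hφh n le_rfl]
              apply Ideal.mem_map_of_mem
              apply Ideal.mem_map_of_mem
              cases n with
              | zero => rw [hPoly_zero _ _ (by omega)]; exact zero_mem _
              | succ n' =>
                apply hPoly_mem hA n' (by omega)
                have := hb.2 (Fin.castSucc (⟨n', by omega⟩ : Fin (n' + 1))) (Fin.last (n' + 1)) rfl
                exact this.trans (by omega)) (b' (Fin.last n) - b (Fin.last n))
            (b (Fin.last n)) le_rfl
          rw [Ideal.mem_comap, map_sub, one_mul, one_mul, map_mul, map_pow,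
            show b (Fin.last n) + (b' (Fin.last n) - b (Fin.last n)) = b' (Fin.last n) by omega] at this
          have hX : φ (MvPolynomial.X ⟨n, by omega⟩) = Polynomial.X := by
            rw [hφ, show eLast n (MvPolynomial.X ⟨n, by omega⟩) = Polynomial.X from eLast_last n,
              Polynomial.map_X]
          rw [hX] at this
          have h2 := Ideal.neg_mem_iff _ |>.2 this
          rwa [neg_sub] at h2)
      (φ p)
      (by
        intro h hh
        obtain ⟨h', hh', rfl⟩ := (Ideal.mem_map_iff_of_surjective mk hmks).1 hh
        refine Submodule.span_induction (p := fun h' _ => g ∣ φ p * Polynomial.C (mk h'))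
          ?_ ?_ ?_ ?_ hh'
        · rintro _ ⟨t, rfl⟩
          have := hmem' _ (hp t.castSucc)
          rw [map_mul] at this
          rw [← hφh _ (by omega)]
          exact this
        · simp
        · intro x y _ _ hx hy
          rw [map_add, map_add, mul_add]
          exact dvd_add hx hy
        · intro a x _ hx
          have : φ p * Polynomial.C (mk (a • x)) =
              Polynomial.C (mk a) * (φ p * Polynomial.C (mk x)) := by
            rw [smul_eq_mul, map_mul, map_mul, mul_left_comm]
          rw [this]
          exact Dvd.dvd.mul_left hx _)
      (by
        rw [← map_mul]
        exact hmem' _ (hp (Fin.last n)))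
    obtain ⟨v', rfl⟩ := hsurj v
    refine ⟨v', hmem _ ?_⟩
    have hx : φ (xpow fun t => b' t - b t) =
        Polynomial.C (mk (xpow fun t => b₀' t - b₀ t)) *
          Polynomial.X ^ (b' (Fin.last n) - b (Fin.last n)) := by
      rw [hφ, xpow, Fin.prod_univ_castSucc, map_mul, map_prod, Polynomial.map_mul, map_pow,
        eLast_last, Polynomial.map_pow, Polynomial.map_X]
      congr 1
      simp only [map_pow, eLast_castSucc, xpow, map_prod]
      rw [Polynomial.map_prod]
      simp [hb₀, hb₀']
    rw [map_sub, map_mul, hx, hvq]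
    exact ⟨q, by ring⟩

end colon

/-! ### Exponents and the monomials of intervals -/

lemma xpow_dvd {n : ℕ} {c d : Fin n → ℕ} (h : ∀ t, c t ≤ d t) : (xpow c : R n) ∣ xpow d :=
  Finset.prod_dvd_prod_of_dvd _ _ fun t _ => pow_dvd_pow _ (h t)

lemma xpow_zero {n : ℕ} {c : Fin n → ℕ} (h : ∀ t, c t = 0) : (xpow c : R n) = 1 := by
  simp [xpow, h]

/-- The exponent `(|a - a'| + |a' - a''| - |a - a''|) / 2`, coordinate by coordinate. -/
def gExp {n : ℕ} (a a' a'' : Fin n → ℕ) (t : Fin n) : ℕ :=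
  (Nat.dist (a t) (a' t) + Nat.dist (a' t) (a'' t) - Nat.dist (a t) (a'' t)) / 2

/-- indicator of the positions where both height functions have level `m` -/
def lev {n : ℕ} (a a' : Fin n → ℕ) (m : ℕ) (t : Fin n) : ℕ :=
  if a t + t.val = m ∧ a' t + t.val = m then 1 else 0

/-- the monomial ideal spanned by the level monomials -/
noncomputable def levIdeal {n : ℕ} (k : ℕ) (a a' : Fin n → ℕ) : Ideal (R n) :=
  Ideal.span {p | ∃ j, j < n - k ∧ p = xpow (lev a a' (k + j))}

lemma levIdeal_mem {n k : ℕ} (a a' : Fin n → ℕ) {j : ℕ} (hj : j < n - k) {p : R n}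
    (hp : xpow (lev a a' (k + j)) ∣ p) : p ∈ levIdeal k a a' :=
  Ideal.mem_of_dvd _ hp (Ideal.subset_span ⟨j, hj, rfl⟩)

lemma lev_symm {n : ℕ} (a a' : Fin n → ℕ) (m : ℕ) : lev a a' m = lev a' a m := by
  funext t; simp [lev, and_comm]

lemma levIdeal_symm {n : ℕ} (k : ℕ) (a a' : Fin n → ℕ) : levIdeal k a a' = levIdeal k a' a := by
  unfold levIdeal; simp_rw [lev_symm a a']

lemma gExp_symm {n : ℕ} (a a' a'' : Fin n → ℕ) : gExp a a' a'' = gExp a'' a' a := by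
  funext t; simp only [gExp, Nat.dist]; omega

lemma lev_le {n : ℕ} (a a' a'' : Fin n → ℕ) (m : ℕ) (t : Fin n) :
    lev a a'' m t ≤ gExp a a' a'' t + lev a a' m t := by
  simp only [lev, gExp, Nat.dist]
  split_ifs <;> omega

lemma levIdeal_right {n k : ℕ} (a a' a'' : Fin n → ℕ) {q : R n} (hq : q ∈ levIdeal k a a') :
    xpow (gExp a a' a'') * q ∈ levIdeal k a a'' := by
  refine Submodule.span_induction (p := fun q _ => xpow (gExp a a' a'') * q ∈ levIdeal k a a'')
    ?_ ?_ ?_ ?_ hq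
  · rintro _ ⟨j, hj, rfl⟩
    refine levIdeal_mem _ _ hj ?_
    rw [← xpow_add]
    exact xpow_dvd fun t => lev_le a a' a'' _ t
  · simp
  · intro x y _ _ hx hy; rw [mul_add]; exact Ideal.add_mem _ hx hy
  · intro r x _ hx; rw [smul_eq_mul, mul_left_comm]; exact Ideal.mul_mem_left _ _ hx

lemma levIdeal_left {n k : ℕ} (a a' a'' : Fin n → ℕ) {q : R n} (hq : q ∈ levIdeal k a' a'') :
    xpow (gExp a a' a'') * q ∈ levIdeal k a a'' := by
  rw [levIdeal_symm] at hq ⊢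
  rw [gExp_symm]
  exact levIdeal_right _ _ _ hq

lemma gExp_cocycle {n : ℕ} (a b c d : Fin n → ℕ)
    (t : Fin n) : gExp a b c t + gExp a c d t = gExp a b d t + gExp b c d t := by
  simp only [gExp, Nat.dist]; omega

lemma sub_add_sub {n : ℕ} (a b c : Fin n → ℕ) (t : Fin n) :
    (b t - a t) + (c t - b t) = gExp a b c t + (c t - a t) := by
  simp only [gExp, Nat.dist]; omega

/-! ### Sartori's algebra -/

/-- `∧∨`-sequences of length `n` with `k` symbols `∧`, encoded by the set of the positions of the
`∧`s; position `i ∈ {1, …, n}` is `⟨i - 1, _⟩ : Fin n`. -/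
abbrev D (n k : ℕ) : Type := {μ : Finset (Fin n) // μ.card = k}

/-- The number of `∧`s strictly to the right of a position. -/
def vD {n k : ℕ} (μ : D n k) (t : Fin n) : ℕ := (μ.1.filter (fun s => t < s)).card

/-- The `b`-sequence of `μ`: `b_i - 1` is the number of `∧`s strictly to the right of `i`. -/
def bSeq {n k : ℕ} (μ : D n k) (t : Fin n) : ℕ := vD μ t + 1

/-- Position `p` (counted from `0`) carries a `∨`; the sequence is continued by `∨`s to the right
of its last symbol. -/
def IsVee {n k : ℕ} (μ : D n k) (p : ℕ) : Prop := ∀ h : p < n, (⟨p, h⟩ : Fin n) ∉ μ.1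

/-- The position of the `(j+1)`-st `∨`, counted from `0`: in the usual numbering
`vee μ j = ∨_{j+1} - 1`. For `j = n - k`, the first index past the actual `∨`s, the value is `n`. -/
noncomputable def vee {n k : ℕ} (μ : D n k) (j : ℕ) : ℕ := Nat.nth (IsVee μ) j

/-- `κ` and `μ` are too far: `∨_j^μ ≥ ∨_{j+1}^κ` or `∨_j^κ ≥ ∨_{j+1}^μ`
for some `1 ≤ j ≤ n - k - 1`. -/
def TooFar {n k : ℕ} (κ μ : D n k) : Prop :=
  ∃ j, j + 1 < n - k ∧ (vee κ (j + 1) ≤ vee μ j ∨ vee μ (j + 1) ≤ vee κ j)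

/-- The cyclic module `R_b = R / I_b` for the `b`-sequence of `μ`. -/
abbrev RMod {n k : ℕ} (μ : D n k) : Type := R n ⧸ bIdeal (bSeq μ)

lemma adm_bSeq {n k : ℕ} (μ : D n k) : Adm (bSeq μ) := by
  refine ⟨fun t => by simp [bSeq], fun s t h => ?_⟩
  have : (μ.1.filter (fun r => s < r)) ⊆ insert t (μ.1.filter (fun r => t < r)) := by
    intro r hr
    simp only [mem_filter, mem_insert, Fin.lt_def, Fin.ext_iff] at hr ⊢
    by_cases h1 : r.val = t.val
    · exact Or.inl h1
    · exact Or.inr ⟨hr.1, by omega⟩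
  have := (card_le_card this).trans (card_insert_le _ _)
  simp only [bSeq, vD]; omega

/-- The module map `R_{b^κ} → R_{b^μ}`, `1 ↦ x^c` with `c_i = max(b_i^μ - b_i^κ, 0)`. -/
noncomputable def mon {n k : ℕ} (κ μ : D n k) : RMod κ →ₗ[R n] RMod μ :=
  Submodule.mapQ _ _ (LinearMap.mulLeft (R n) (xpow fun t => bSeq μ t - bSeq κ t))
    fun _ hp => xpow_mul_mem (adm_bSeq κ) (adm_bSeq μ) hp

/-- The monomial `x_{α(j)} x_{α(j)+1} ⋯ x_{β(j)}` where `α(j) = max(∨_j^κ, ∨_j^μ)` and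
`β(j) = min(∨_{j+1}^κ, ∨_{j+1}^μ) - 1` (for the last index `j = n - k` this is `β(j) = n`). -/
noncomputable def pInt {n k : ℕ} (κ μ : D n k) (j : ℕ) : R n :=
  ∏ t ∈ univ.filter (fun t : Fin n => max (vee κ j) (vee μ j) ≤ t.val ∧
    t.val < min (vee κ (j + 1)) (vee μ (j + 1))), X t

open Classical in
/-- The submodule `W^α_{κ,μ}` of `Hom_R(R_{b^κ}, R_{b^μ})`. -/
noncomputable def W {n k : ℕ} (κ μ : D n k) : Submodule (R n) (RMod κ →ₗ[R n] RMod μ) :=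
  if TooFar κ μ then ⊤
  else Submodule.span (R n) {φ | ∃ j, j < n - k ∧ φ = pInt κ μ j • mon κ μ}

lemma isVee_infinite {n k : ℕ} (μ : D n k) : (Set.ofPred (IsVee μ)).Infinite :=
  (Set.Ici_infinite n).mono fun p (hp : n ≤ p) h => absurd h (by omega)

lemma vee_level {n k : ℕ} (μ : D n k) (t : Fin n) (j : ℕ) :
    (vee μ j ≤ t.val ∧ t.val < vee μ (j + 1)) ↔ vD μ t + t.val = k + j := by
  classical
  have h1 : vee μ j ≤ t.val ↔ j < Nat.count (IsVee μ) (t.val + 1) := by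
    rw [Nat.lt_nth_iff_count_lt (isVee_infinite μ)]; exact Nat.lt_succ_iff.symm
  have h2 : t.val < vee μ (j + 1) ↔ Nat.count (IsVee μ) (t.val + 1) ≤ j + 1 := by
    rw [Nat.count_le_iff_le_nth (isVee_infinite μ)]; rfl
  have h3 : Nat.count (IsVee μ) (t.val + 1) + (μ.1.filter (fun s => ¬ t < s)).card = t.val + 1 := by
    rw [Nat.count_eq_card_filter_range]
    have : (μ.1.filter (fun s => ¬ t < s)).card =
        ((range (t.val + 1)).filter (fun p => ¬ IsVee μ p)).card := by
      refine card_bij (fun s _ => s.val) ?_ ?_ ?_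
      · intro s hs
        simp only [mem_filter, mem_range, IsVee, not_forall, not_not, Fin.lt_def] at hs ⊢
        exact ⟨by omega, s.isLt, hs.1⟩
      · intro a _ b _ h; exact Fin.ext h
      · intro p hp
        simp only [mem_filter, mem_range, IsVee, not_forall, not_not] at hp
        obtain ⟨h, h', h''⟩ := hp
        exact ⟨⟨p, h'⟩, by simp only [mem_filter, Fin.lt_def]; exact ⟨h'', by omega⟩, rfl⟩
    rw [this, card_filter_add_card_filter_not, card_range]
  have h4 := card_filter_add_card_filter_not (s := μ.1) (fun s => t < s)
  rw [μ.2] at h4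
  rw [h1, h2]
  simp only [vD]
  omega

lemma pInt_eq {n k : ℕ} (κ μ : D n k) (j : ℕ) : pInt κ μ j = xpow (lev (vD κ) (vD μ) (k + j)) := by
  unfold pInt xpow
  rw [prod_filter]
  refine prod_congr rfl fun t _ => ?_
  have h1 := vee_level κ t j
  have h2 := vee_level μ t j
  simp only [lev]
  by_cases h : vD κ t + t.val = k + j ∧ vD μ t + t.val = k + j
  · rw [if_pos h, if_pos, pow_one]
    have h3 := h1.2 h.1
    have h4 := h2.2 h.2
    omega
  · rw [if_neg h, if_neg, pow_zero]
    intro h3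
    exact h ⟨h1.1 (by omega), h2.1 (by omega)⟩

lemma mon_mk {n k : ℕ} (κ μ : D n k) (p : R n) :
    mon κ μ (Submodule.Quotient.mk p) =
      Submodule.Quotient.mk ((xpow fun t => bSeq μ t - bSeq κ t) * p) := rfl

lemma hom_ext {n k k' : ℕ} {κ : D n k} {μ : D n k'} {φ ψ : RMod κ →ₗ[R n] RMod μ}
    (h : φ (Submodule.Quotient.mk 1) = ψ (Submodule.Quotient.mk 1)) : φ = ψ := by
  apply LinearMap.ext
  intro v
  obtain ⟨p, rfl⟩ := Submodule.Quotient.mk_surjective _ v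
  have : (Submodule.Quotient.mk p : RMod κ) = p • Submodule.Quotient.mk 1 := by
    rw [← Submodule.Quotient.mk_smul, smul_eq_mul, mul_one]
  rw [this, map_smul, map_smul, h]

lemma hom_gen {n k : ℕ} {κ μ : D n k} (φ : RMod κ →ₗ[R n] RMod μ) : ∃ r : R n, φ = r • mon κ μ := by
  obtain ⟨p, hp⟩ := Submodule.Quotient.mk_surjective _ (φ (Submodule.Quotient.mk 1))
  obtain ⟨v, hv⟩ := colon (adm_bSeq κ) (adm_bSeq μ) p (by
    intro t
    have h1 : (Submodule.Quotient.mk (hPoly n (t.val + 1) (bSeq κ t)) : RMod κ) = 0 :=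
      (Submodule.Quotient.mk_eq_zero _).2 (bIdeal_gen _ t)
    have h2 : (Submodule.Quotient.mk (hPoly n (t.val + 1) (bSeq κ t)) : RMod κ) =
        hPoly n (t.val + 1) (bSeq κ t) • Submodule.Quotient.mk 1 := by
      rw [← Submodule.Quotient.mk_smul, smul_eq_mul, mul_one]
    have h3 := congrArg φ (h2.symm.trans h1)
    rw [map_smul, map_zero, ← hp, ← Submodule.Quotient.mk_smul,
      Submodule.Quotient.mk_eq_zero, smul_eq_mul, mul_comm] at h3
    exact h3)
  refine ⟨v, hom_ext ?_⟩
  rw [LinearMap.smul_apply, mon_mk, ← hp, ← Submodule.Quotient.mk_smul, mul_one, smul_eq_mul,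
    mul_comm]
  exact (Submodule.Quotient.eq _).2 hv

lemma mem_W {n k : ℕ} {κ μ : D n k} (φ : RMod κ →ₗ[R n] RMod μ) :
    φ ∈ W κ μ ↔ ∃ q ∈ levIdeal k (vD κ) (vD μ), φ = q • mon κ μ := by
  constructor
  · intro h
    unfold W at h
    split_ifs at h with hf
    · obtain ⟨r, rfl⟩ := hom_gen φ
      refine ⟨r, ?_, rfl⟩
      obtain ⟨j, hj, hj'⟩ := hf
      have h1 : pInt κ μ j = 1 := by
        unfold pInt
        rw [filter_eq_empty_iff.2, prod_empty]
        intro t _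
        omega
      refine levIdeal_mem _ _ (show j < n - k by omega) ?_
      rw [← pInt_eq, h1]
      exact one_dvd _
    · refine Submodule.span_induction
        (p := fun φ _ => ∃ q ∈ levIdeal k (vD κ) (vD μ), φ = q • mon κ μ) ?_ ?_ ?_ ?_ h
      · rintro _ ⟨j, hj, rfl⟩
        exact ⟨_, Ideal.subset_span ⟨j, hj, pInt_eq κ μ j⟩, rfl⟩
      · exact ⟨0, zero_mem _, by simp⟩
      · rintro _ _ _ _ ⟨q, hq, rfl⟩ ⟨q', hq', rfl⟩
        exact ⟨q + q', add_mem hq hq', by rw [add_smul]⟩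
      · rintro r _ _ ⟨q, hq, rfl⟩
        exact ⟨r * q, Ideal.mul_mem_left _ _ hq, by rw [mul_smul]⟩
  · rintro ⟨q, hq, rfl⟩
    unfold W
    split_ifs with hf
    · trivial
    · refine Submodule.span_induction
        (p := fun q _ => q • mon κ μ ∈ Submodule.span (R n)
          {φ | ∃ j, j < n - k ∧ φ = pInt κ μ j • mon κ μ}) ?_ ?_ ?_ ?_ hq
      · rintro _ ⟨j, hj, rfl⟩
        exact Submodule.subset_span ⟨j, hj, by rw [pInt_eq]⟩
      · simp
      · intro x y _ _ hx hy; rw [add_smul]; exact add_mem hx hy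
      · intro r x _ hx; rw [smul_eq_mul, mul_smul]; exact Submodule.smul_mem _ _ hx

lemma mon_comp {n k : ℕ} (κ ν μ : D n k) :
    mon ν μ ∘ₗ mon κ ν = xpow (gExp (vD κ) (vD ν) (vD μ)) • mon κ μ := by
  apply hom_ext
  rw [LinearMap.comp_apply, LinearMap.smul_apply, mon_mk, mon_mk, mon_mk,
    ← Submodule.Quotient.mk_smul, mul_one, mul_one, smul_eq_mul, ← xpow_add, ← xpow_add]
  congr 2
  funext t
  have := sub_add_sub (vD κ) (vD ν) (vD μ) t
  simp only [bSeq]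
  omega

lemma mon_self {n k : ℕ} (κ : D n k) : mon κ κ = LinearMap.id := by
  apply hom_ext
  rw [mon_mk, xpow_zero (by simp)]
  simp

lemma W_comp_left {n k : ℕ} {κ ν μ : D n k} (φ : RMod ν →ₗ[R n] RMod μ)
    {ψ : RMod κ →ₗ[R n] RMod ν} (hψ : ψ ∈ W κ ν) : φ ∘ₗ ψ ∈ W κ μ := by
  obtain ⟨r, rfl⟩ := hom_gen φ
  obtain ⟨q, hq, rfl⟩ := (mem_W ψ).1 hψ
  refine (mem_W _).2 ⟨r * (xpow (gExp (vD κ) (vD ν) (vD μ)) * q),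
    Ideal.mul_mem_left _ _ (levIdeal_right _ _ _ hq), ?_⟩
  rw [LinearMap.smul_comp, LinearMap.comp_smul, mon_comp, smul_smul, smul_smul]
  congr 1; ring

lemma W_comp_right {n k : ℕ} {κ ν μ : D n k} {φ : RMod ν →ₗ[R n] RMod μ}
    (ψ : RMod κ →ₗ[R n] RMod ν) (hφ : φ ∈ W ν μ) : φ ∘ₗ ψ ∈ W κ μ := by
  obtain ⟨r, rfl⟩ := hom_gen ψ
  obtain ⟨q, hq, rfl⟩ := (mem_W φ).1 hφ
  refine (mem_W _).2 ⟨r * (xpow (gExp (vD κ) (vD ν) (vD μ)) * q),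
    Ideal.mul_mem_left _ _ (levIdeal_left _ _ _ hq), ?_⟩
  rw [LinearMap.smul_comp, LinearMap.comp_smul, mon_comp, smul_smul, smul_smul]
  congr 1; ring

/-- The ring `⨁_{κ,μ} Hom_R(R_{b^κ}, R_{b^μ}) = End_R(⨁_κ R_{b^κ})`. -/
abbrev T (n k : ℕ) : Type := Module.End (R n) (∀ κ : D n k, RMod κ)

noncomputable instance (n k : ℕ) : Ring (T n k) := Module.End.instRing

/-- The component `R_{b^κ} → R_{b^μ}` of an endomorphism of `⨁_κ R_{b^κ}`. -/
noncomputable def comp {n k : ℕ} (φ : T n k) (κ μ : D n k) : RMod κ →ₗ[R n] RMod μ :=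
  LinearMap.proj μ ∘ₗ φ ∘ₗ LinearMap.single (R n) (fun κ : D n k => RMod κ) κ

lemma comp_add {n k : ℕ} (φ ψ : T n k) (κ μ : D n k) :
    comp (φ + ψ) κ μ = comp φ κ μ + comp ψ κ μ := by
  ext; simp [comp]

lemma comp_neg {n k : ℕ} (φ : T n k) (κ μ : D n k) : comp (-φ) κ μ = -comp φ κ μ := by
  ext; simp [comp]

lemma comp_zero {n k : ℕ} (κ μ : D n k) : comp (0 : T n k) κ μ = 0 := by
  ext; simp [comp]

lemma comp_mul {n k : ℕ} (φ ψ : T n k) (κ μ : D n k) :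
    comp (φ * ψ) κ μ = ∑ ν, comp φ ν μ ∘ₗ comp ψ κ ν := by
  apply LinearMap.ext
  intro v
  simp only [comp, LinearMap.comp_apply, LinearMap.sum_apply, Module.End.mul_apply,
    LinearMap.proj_apply]
  conv_lhs => rw [← LinearMap.sum_single_apply (fun κ : D n k => RMod κ)
    (ψ (LinearMap.single (R n) (fun κ : D n k => RMod κ) κ v))]
  rw [map_sum, Finset.sum_apply]
  rfl

/-- The two-sided ideal `⨁_{κ,μ} W^α_{κ,μ}`. -/
noncomputable def wIdeal (n k : ℕ) : Ideal (T n k) where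
  carrier := {φ | ∀ κ μ, comp φ κ μ ∈ W κ μ}
  add_mem' := by
    intro a b ha hb κ μ
    rw [comp_add]; exact add_mem (ha κ μ) (hb κ μ)
  zero_mem' := by
    intro κ μ; rw [comp_zero]; exact zero_mem _
  smul_mem' := by
    intro c φ hφ κ μ
    rw [smul_eq_mul, comp_mul]
    exact sum_mem fun ν _ => W_comp_left _ (hφ κ ν)

instance wIdeal_twoSided (n k : ℕ) : (wIdeal n k).IsTwoSided where
  mul_mem_of_left := by
    intro a b ha κ μ
    rw [comp_mul]
    exact sum_mem fun ν _ => W_comp_right _ (ha ν μ)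

/-- Sartori's algebra over `ℤ`: the ring `⨁_{κ,μ} Hom_R(R_{b^κ}, R_{b^μ}) / W^α_{κ,μ}`, with
composition of maps as multiplication. -/
def A (n k : ℕ) : Type := T n k ⧸ wIdeal n k

noncomputable instance (n k : ℕ) : Ring (A n k) := inferInstanceAs (Ring (T n k ⧸ wIdeal n k))

/-- The class in `A n k` of an endomorphism. -/
noncomputable def mkA (n k : ℕ) : T n k →+* A n k := Ideal.Quotient.mk (wIdeal n k)

lemma mkA_eq_zero {n k : ℕ} (φ : T n k) : mkA n k φ = 0 ↔ ∀ κ μ, comp φ κ μ ∈ W κ μ :=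
  Ideal.Quotient.eq_zero_iff_mem

lemma mkA_surjective (n k : ℕ) : Function.Surjective (mkA n k) := Ideal.Quotient.mk_surjective

/-! ### The Ozsváth–Szabó algebras -/

/-- I-states: subsets of `{0, …, n}` with `k` elements. -/
abbrev V (n k : ℕ) : Type := {x : Finset (Fin (n + 1)) // x.card = k}

/-- `v_i^x = |x ∩ {i, i+1, …, n}|`, for the line `i = t + 1`, `t : Fin n`. -/
def vV {n k : ℕ} (x : V n k) (t : Fin n) : ℕ := (x.1.filter (fun s => t.val < s.val)).card

/-- The underlying module of `B₀(n,k)`: it is free over `ℤ[U₁, …, Uₙ]` on the arrows `f_{x,y}`, and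
an element is given by its coefficients. -/
def B0 (n k : ℕ) : Type := V n k → V n k → R n

noncomputable instance (n k : ℕ) : AddCommGroup (B0 n k) :=
  inferInstanceAs (AddCommGroup (V n k → V n k → R n))

lemma B0.ext {n k : ℕ} {a b : B0 n k} (h : ∀ x y, a x y = b x y) : a = b :=
  funext fun x => funext fun y => h x y

/-- The product of `B₀(n,k)`, determined by `f_{x,y} f_{y,z} = ∏ᵢ Uᵢ^{gᵢ} f_{x,z}`, where
`gᵢ = w_i^{y,z} - w_i^{x,z} + w_i^{x,y}` and `w_i^{x,y} = |v_i^x - v_i^y| / 2`. -/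
noncomputable instance (n k : ℕ) : Mul (B0 n k) :=
  ⟨fun a b x z => ∑ y, xpow (gExp (vV x) (vV y) (vV z)) * a x y * b y z⟩

noncomputable instance (n k : ℕ) : One (B0 n k) := ⟨fun x y => if x = y then 1 else 0⟩

lemma B0.mul_apply {n k : ℕ} (a b : B0 n k) (x z : V n k) :
    (a * b) x z = ∑ y, xpow (gExp (vV x) (vV y) (vV z)) * a x y * b y z := rfl

lemma B0.one_apply {n k : ℕ} (x y : V n k) : (1 : B0 n k) x y = if x = y then 1 else 0 := rfl

lemma B0.add_apply {n k : ℕ} (a b : B0 n k) (x y : V n k) : (a + b) x y = a x y + b x y := rfl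

lemma B0.neg_apply {n k : ℕ} (a : B0 n k) (x y : V n k) : (-a) x y = -a x y := rfl

lemma B0.zero_apply {n k : ℕ} (x y : V n k) : (0 : B0 n k) x y = 0 := rfl

lemma gExp_left {n : ℕ} (a b : Fin n → ℕ) (t : Fin n) : gExp a a b t = 0 := by
  simp only [gExp, Nat.dist]; omega

lemma gExp_right {n : ℕ} (a b : Fin n → ℕ) (t : Fin n) : gExp a b b t = 0 := by
  simp only [gExp, Nat.dist]; omega

noncomputable instance (n k : ℕ) : Ring (B0 n k) where
  __ := (inferInstance : AddCommGroup (B0 n k))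
  left_distrib a b c := B0.ext fun x y => by
    simp only [B0.mul_apply, B0.add_apply, mul_add, sum_add_distrib]
  right_distrib a b c := B0.ext fun x y => by
    simp only [B0.mul_apply, B0.add_apply, mul_add, add_mul, sum_add_distrib]
  zero_mul a := B0.ext fun x y => by simp [B0.mul_apply, B0.zero_apply]
  mul_zero a := B0.ext fun x y => by simp [B0.mul_apply, B0.zero_apply]
  mul_assoc a b c := B0.ext fun x w => by
    simp only [B0.mul_apply, mul_sum, sum_mul]
    rw [sum_comm]
    refine sum_congr rfl fun y _ => sum_congr rfl fun z _ => ?_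
    have h : (xpow (gExp (vV x) (vV y) (vV z)) : R n) * xpow (gExp (vV x) (vV z) (vV w)) =
        xpow (gExp (vV x) (vV y) (vV w)) * xpow (gExp (vV y) (vV z) (vV w)) := by
      rw [← xpow_add, ← xpow_add]
      congr 1
      funext t; exact gExp_cocycle _ _ _ _ t
    linear_combination (a x y * b y z * c z w) * h
  one_mul a := B0.ext fun x y => by
    rw [B0.mul_apply, sum_eq_single x]
    · rw [xpow_zero (gExp_left _ _), B0.one_apply, if_pos rfl, one_mul, one_mul]
    · intro z _ h; rw [B0.one_apply, if_neg (Ne.symm h)]; simp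
    · simp
  mul_one a := B0.ext fun x y => by
    rw [B0.mul_apply, sum_eq_single y]
    · rw [xpow_zero (gExp_right _ _), B0.one_apply, if_pos rfl, one_mul, mul_one]
    · intro z _ h; rw [B0.one_apply, if_neg h]; simp
    · simp

/-- The element `p · f_{x,y}` of `B₀(n,k)`. -/
noncomputable def sc {n k : ℕ} (p : R n) (x y : V n k) : B0 n k :=
  fun x' y' => if x' = x ∧ y' = y then p else 0

/-- `R_i = ∑ f_{x, x ∖ {i-1} ∪ {i}}` over the `x` with `x ∩ {i-1,i} = {i-1}`, for `i = t + 1`. -/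
noncomputable def elR {n : ℕ} (k : ℕ) (t : Fin n) : B0 n k := fun x y =>
  if t.castSucc ∈ x.1 ∧ t.succ ∉ x.1 ∧ y.1 = insert t.succ (x.1.erase t.castSucc) then 1 else 0

/-- `L_i = ∑ f_{x, x ∖ {i} ∪ {i-1}}` over the `x` with `x ∩ {i-1,i} = {i}`, for `i = t + 1`. -/
noncomputable def elL {n : ℕ} (k : ℕ) (t : Fin n) : B0 n k := fun x y =>
  if t.succ ∈ x.1 ∧ t.castSucc ∉ x.1 ∧ y.1 = insert t.castSucc (x.1.erase t.succ) then 1 else 0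

/-- The relations of `B(n,k)`: `R_{i-1} R_i`, `L_i L_{i-1}`, and `U_i I_x` if
`x ∩ {i-1,i} = ∅`. -/
def relB (n k : ℕ) : Set (B0 n k) :=
  {a | (∃ s t : Fin n, s.val + 1 = t.val ∧ (a = elR k s * elR k t ∨ a = elL k t * elL k s)) ∨
    ∃ (t : Fin n) (x : V n k), t.castSucc ∉ x.1 ∧ t.succ ∉ x.1 ∧ a = sc (X t) x x}

/-- The two-sided ideal of relations of `B(n,k)`. -/
noncomputable def relIdeal (n k : ℕ) : Ideal (B0 n k) := (TwoSidedIdeal.span (relB n k)).asIdeal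

instance (n k : ℕ) : (relIdeal n k).IsTwoSided :=
  inferInstanceAs ((TwoSidedIdeal.span (relB n k)).asIdeal).IsTwoSided

/-- The algebra `B(n,k)`. -/
def B (n k : ℕ) : Type := B0 n k ⧸ relIdeal n k

noncomputable instance (n k : ℕ) : Ring (B n k) := inferInstanceAs (Ring (B0 n k ⧸ relIdeal n k))

/-- The class in `B(n,k)` of an element of `B₀(n,k)`. -/
noncomputable def mkB (n k : ℕ) : B0 n k →+* B n k := Ideal.Quotient.mk (relIdeal n k)

lemma mkB_surjective (n k : ℕ) : Function.Surjective (mkB n k) := Ideal.Quotient.mk_surjective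

lemma mkB_eq_zero {n k : ℕ} (a : B0 n k) : mkB n k a = 0 ↔ a ∈ relIdeal n k :=
  Ideal.Quotient.eq_zero_iff_mem

lemma sc_mul {n k : ℕ} (p q : R n) (x y z : V n k) :
    sc p x y * sc q y z = sc (xpow (gExp (vV x) (vV y) (vV z)) * p * q) x z := by
  apply B0.ext
  intro x' z'
  rw [B0.mul_apply, sum_eq_single y]
  · simp only [sc]
    by_cases h1 : x' = x <;> by_cases h2 : z' = z <;> simp [h1, h2]
  · intro w _ hw; simp [sc, hw]
  · simp

/-- `∑ p f_{x,x}` over the I-states `x` with a property: the idempotents used below. -/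
noncomputable def idem {n k : ℕ} (P : V n k → Prop) [DecidablePred P] : B0 n k :=
  fun x y => if x = y ∧ P x then 1 else 0

lemma idem_mul {n k : ℕ} (P : V n k → Prop) [DecidablePred P] (a : B0 n k) (x y : V n k) :
    (idem P * a) x y = if P x then a x y else 0 := by
  rw [B0.mul_apply, sum_eq_single x]
  · rw [xpow_zero (gExp_left _ _)]; simp [idem]
  · intro z _ h; simp [idem, Ne.symm h]
  · simp

lemma mul_idem {n k : ℕ} (P : V n k → Prop) [DecidablePred P] (a : B0 n k) (x y : V n k) :
    (a * idem P) x y = if P y then a x y else 0 := by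
  rw [B0.mul_apply, sum_eq_single y]
  · rw [xpow_zero (gExp_right _ _)]; simp [idem]
  · intro z _ h; simp [idem, h]
  · simp

/-! ### Description of the ideal of relations -/

/-- number of holes to the left of line `j` -/
def hh {n k : ℕ} (x : V n k) (j : ℕ) : ℕ := (univ.filter (fun r : Fin (n + 1) => r ∉ x.1 ∧ r.val < j)).card

lemma hh_zero {n k : ℕ} (x : V n k) : hh x 0 = 0 := by simp [hh]

lemma hh_succ {n k : ℕ} (x : V n k) (r : Fin (n + 1)) :
    hh x (r.val + 1) = hh x r.val + if r ∈ x.1 then 0 else 1 := by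
  unfold hh
  split_ifs with h
  · rw [add_zero]
    refine congrArg card ?_
    ext s
    simp only [mem_filter, mem_univ, true_and, and_congr_right_iff]
    intro hs
    constructor
    · intro h1
      have : s ≠ r := fun h2 => hs (h2 ▸ h)
      have : s.val ≠ r.val := fun h3 => this (Fin.ext h3)
      omega
    · omega
  · rw [← card_insert_of_notMem (a := r) (by simp)]
    congr 1
    ext s
    simp only [mem_filter, mem_univ, true_and, mem_insert]
    constructor
    · rintro ⟨h1, h2⟩
      by_cases h3 : s = r
      · exact Or.inl h3
      · exact Or.inr ⟨h1, by have : s.val ≠ r.val := fun h4 => h3 (Fin.ext h4)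
                             omega⟩
    · rintro (rfl | ⟨h1, h2⟩)
      · exact ⟨h, by omega⟩
      · exact ⟨h1, by omega⟩

lemma mem_iff_hh {n k : ℕ} (x : V n k) (r : Fin (n + 1)) :
    r ∈ x.1 ↔ hh x (r.val + 1) = hh x r.val := by
  rw [hh_succ]; split_ifs with h <;> simp [h]

lemma hh_step {n k : ℕ} (x : V n k) (j : ℕ) (hj : j ≤ n) :
    hh x (j + 1) = hh x j ∨ hh x (j + 1) = hh x j + 1 := by
  have := hh_succ x ⟨j, by omega⟩
  simp only at this
  split_ifs at this <;> omega

lemma hh_last {n k : ℕ} (x : V n k) : hh x (n + 1) + k = n + 1 := by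
  have h1 : hh x (n + 1) = (univ \ x.1).card := by
    unfold hh; refine congrArg card ?_; ext r; have := r.isLt; simp; omega
  have h2 := card_sdiff_add_card_eq_card (subset_univ x.1)
  rw [card_univ, Fintype.card_fin, x.2] at h2
  omega

lemma vV_hh {n k : ℕ} (x : V n k) (t : Fin n) : vV x t + t.val + 1 = hh x (t.val + 1) + k := by
  have h1 := card_filter_add_card_filter_not (s := x.1) (fun s => t.val < s.val)
  have h2 := card_filter_add_card_filter_not
    (s := univ.filter (fun r : Fin (n + 1) => r.val < t.val + 1)) (fun r => r ∈ x.1)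
  rw [filter_filter, filter_filter] at h2
  have h3 : (univ.filter (fun r : Fin (n + 1) => r.val < t.val + 1)).card = t.val + 1 := by
    have : univ.filter (fun r : Fin (n + 1) => r.val < t.val + 1) = Finset.Iic t.castSucc := by
      ext r; simp [Fin.le_def]
    rw [this, Fin.card_Iic]; simp
  have h4 : (univ.filter (fun r : Fin (n + 1) => r.val < t.val + 1 ∧ r ∈ x.1)) =
      x.1.filter (fun s => ¬ t.val < s.val) := by
    ext r; simp only [mem_filter, mem_univ, true_and]
    constructor
    · rintro ⟨a, b⟩; exact ⟨b, by omega⟩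
    · rintro ⟨a, b⟩; exact ⟨by omega, a⟩
  have h5 : hh x (t.val + 1) =
      (univ.filter (fun r : Fin (n + 1) => r.val < t.val + 1 ∧ r ∉ x.1)).card := by
    unfold hh; congr 1; ext r; simp [and_comm]
  rw [h4, h3] at h2
  rw [x.2] at h1
  simp only [vV]; omega

lemma exists_of_hh {n k : ℕ} (H : ℕ → ℕ) (h0 : H 0 = 0)
    (hs : ∀ j ≤ n, H (j + 1) = H j ∨ H (j + 1) = H j + 1) (hl : H (n + 1) + k = n + 1) :
    ∃ x : V n k, ∀ j ≤ n + 1, hh x j = H j := by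
  set s : Finset (Fin (n + 1)) := univ.filter fun r => H (r.val + 1) = H r.val with hsdef
  let x' : V n s.card := ⟨s, rfl⟩
  have key : ∀ j ≤ n + 1, hh x' j = H j := by
    intro j
    induction j with
    | zero => intro _; rw [hh_zero, h0]
    | succ j ih =>
      intro hj
      have h1 := hh_succ x' ⟨j, by omega⟩
      simp only at h1
      rw [h1, ih (by omega)]
      have h2 : ((⟨j, by omega⟩ : Fin (n + 1)) ∈ x'.1) ↔ H (j + 1) = H j := by
        simp [x', hsdef]
      rcases hs j (by omega) with h3 | h3
      · rw [if_pos (h2.2 h3), h3, add_zero]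
      · rw [if_neg (fun h4 => by have := h2.1 h4; omega), h3]
  have hcard : s.card = k := by
    have h1 := hh_last x'
    rw [key (n + 1) le_rfl] at h1
    omega
  exact ⟨⟨s, hcard⟩, fun j hj => key j hj⟩

lemma hh_mono {n k : ℕ} (x : V n k) {i j : ℕ} (h : i ≤ j) : hh x i ≤ hh x j := by
  unfold hh
  apply card_le_card
  intro r; simp only [mem_filter, mem_univ, true_and]
  rintro ⟨a, b⟩; exact ⟨a, by omega⟩

lemma gExp_between {n : ℕ} {a b c : Fin n → ℕ} {t : Fin n} (h : min (a t) (c t) ≤ b t)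
    (h' : b t ≤ max (a t) (c t)) : gExp a b c t = 0 := by
  simp only [gExp, Nat.dist]; omega

/-- existence of a state with two adjacent holes between two states sharing the level `i` -/
lemma exists_near {n k : ℕ} (x y : V n k) {i : ℕ} (hi1 : 1 ≤ i) (hin : i + k ≤ n)
    (hex : ∃ q ≤ n + 1, hh x q = i ∧ hh y q = i) :
    ∃ (z : V n k) (t : Fin n), t.castSucc ∉ z.1 ∧ t.succ ∉ z.1 ∧
      ∀ s, gExp (vV x) (vV z) (vV y) s + (if s = t then 1 else 0) ≤
        lev (vV x) (vV y) (k + (i - 1)) s := by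
  classical
  have hx0 := hh_zero x
  have hy0 := hh_zero y
  have hxl := hh_last x
  have hyl := hh_last y
  have hex' : ∃ q, q ≤ n + 1 ∧ hh x q = i ∧ hh y q = i := hex
  obtain ⟨hq1, hq2, hq3⟩ := Nat.find_spec hex'
  have hmin : ∀ q, q < Nat.find hex' → ¬ (hh x q = i ∧ hh y q = i) := fun q hq h =>
    Nat.find_min hex' hq ⟨by omega, h⟩
  generalize Nat.find hex' = q0 at *
  obtain ⟨a, rfl⟩ : ∃ a, q0 = a + 1 := by
    cases q0 with
    | zero => omega
    | succ a => exact ⟨a, rfl⟩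
  have han : a < n := by
    by_contra h
    have : a = n := by omega
    subst this
    omega
  have hxa := hh_step x a (by omega)
  have hya := hh_step y a (by omega)
  have hna := hmin a (by omega)
  have hxa1 := hh_step x (a + 1) (by omega)
  have hya1 := hh_step y (a + 1) (by omega)
  have hle : ∀ q ≤ a, hh x q ≤ i ∧ hh y q ≤ i ∧ (hh x q ≤ i - 1 ∨ hh y q ≤ i - 1) := by
    intro q hq
    have h1 := hh_mono x (show q ≤ a + 1 by omega)
    have h2 := hh_mono y (show q ≤ a + 1 by omega)
    have h3 := hmin q (by omega)
    omega
  have hge : ∀ q, a + 1 ≤ q → i ≤ hh x q ∧ i ≤ hh y q := by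
    intro q hq
    have h1 := hh_mono x hq
    have h2 := hh_mono y hq
    omega
  obtain ⟨z, hz⟩ := exists_of_hh (n := n) (k := k)
    (fun q => if q ≤ a then min (i - 1) (max (hh x q) (hh y q)) else
      if q = a + 1 then i else max (i + 1) (min (hh x q) (hh y q)))
    (by simp [hx0, hy0])
    (by
      intro j hj
      have h1 := hh_step x j hj
      have h2 := hh_step y j hj
      rcases Nat.lt_trichotomy j a with h | h | h
      · have h3 := hle j (by omega)
        have h4 := hle (j + 1) (by omega)
        simp only [if_pos (show j ≤ a by omega), if_pos (show j + 1 ≤ a by omega)]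
        omega
      · subst h
        have h3 := hle j (by omega)
        simp only [if_pos (show j ≤ j by omega), if_neg (show ¬ j + 1 ≤ j by omega), if_true]
        omega
      · have h3 := hge j (by omega)
        have h4 := hge (j + 1) (by omega)
        simp only [if_neg (show ¬ j ≤ a by omega), if_neg (show ¬ j + 1 ≤ a by omega),
          if_neg (show ¬ j + 1 = a + 1 by omega)]
        split_ifs with h5
        · subst h5; omega
        · omega)
    (by
      simp only [if_neg (show ¬ n + 1 ≤ a by omega), if_neg (show ¬ n + 1 = a + 1 by omega)]
      omega)
  have hza := hz a (by omega)
  have hza1 := hz (a + 1) (by omega)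
  have hza2 := hz (a + 1 + 1) (by omega)
  simp only [if_pos (show a ≤ a by omega)] at hza
  simp only [if_neg (show ¬ a + 1 ≤ a by omega), if_true] at hza1
  simp only [if_neg (show ¬ a + 1 + 1 ≤ a by omega), if_neg (show ¬ a + 1 + 1 = a + 1 by omega)]
    at hza2
  refine ⟨z, ⟨a, han⟩, ?_, ?_, ?_⟩
  · rw [mem_iff_hh]
    show ¬ hh z (a + 1) = hh z a
    have := hle a le_rfl
    omega
  · rw [mem_iff_hh]
    show ¬ hh z (a + 1 + 1) = hh z (a + 1)
    omega
  · intro s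
    have h1 := vV_hh x s
    have h2 := vV_hh y s
    have h3 := vV_hh z s
    have h4 := hz (s.val + 1) (by omega)
    have hst : (s = (⟨a, han⟩ : Fin n)) ↔ s.val = a := Fin.ext_iff
    clear hz hza hza1 hza2 hxa hya hna hxa1 hya1 hx0 hy0 hxl hyl hex hex'
    rcases Nat.lt_trichotomy s.val a with h | h | h
    · have h5 := hle (s.val + 1) (by omega)
      rw [if_pos (by omega)] at h4
      rw [if_neg (fun h6 => by have := hst.1 h6; omega), gExp_between (by omega) (by omega)]
      exact Nat.zero_le _
    · rw [h] at h1 h2 h3 h4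
      rw [if_neg (by omega), if_pos rfl] at h4
      rw [if_pos (hst.2 h), gExp_between (by omega) (by omega), lev, if_pos (by omega)]
    · have h5 := hge (s.val + 1) (by omega)
      rw [if_neg (by omega), if_neg (by omega)] at h4
      rw [if_neg (fun h6 => by have := hst.1 h6; omega)]
      by_cases h6 : hh x (s.val + 1) = i ∧ hh y (s.val + 1) = i
      · rw [lev, if_pos (by omega)]
        simp only [gExp, Nat.dist]
        omega
      · rw [gExp_between (by omega) (by omega)]
        exact Nat.zero_le _

/-- existence of the two-line crossing between two states that do not share the level `i` -/
lemma exists_far {n k : ℕ} (x y : V n k) {i b : ℕ} (hi1 : 1 ≤ i) (hin : i + k ≤ n) (hb : b ≤ n)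
    (hyb : hh y b = i) (hyb1 : hh y (b + 1) = i + 1) (hxb : hh x b ≤ i - 1)
    (hxb1 : hh x (b + 1) ≤ i) :
    ∃ (z z' : V n k) (s t : Fin n), s.val + 1 = t.val ∧
      (s.castSucc ∈ z.1 ∧ s.succ ∉ z.1 ∧ t.succ ∉ z.1 ∧
        z'.1 = insert t.succ (z.1.erase s.castSucc)) ∧
      (∀ r, (vV x r ≤ vV z r ∧ vV z r ≤ vV z' r ∧ vV z' r ≤ vV y r) ∨
        (vV z r = vV z' r ∧ gExp (vV x) (vV z) (vV y) r = 0)) := by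
  have hx0 := hh_zero x
  have hy0 := hh_zero y
  have hxl := hh_last x
  have hyl := hh_last y
  obtain ⟨c, rfl⟩ : ∃ c, b = c + 1 := by
    cases b with
    | zero => omega
    | succ a => exact ⟨a, rfl⟩
  rw [show c + 1 + 1 = c + 2 from rfl] at hyb1 hxb1
  have hcn : c + 1 < n := by
    by_contra h
    have h1 : n + 1 = c + 2 := by omega
    rw [h1] at hxl hyl
    omega
  have hle : ∀ q ≤ c + 1, hh x q ≤ i - 1 ∧ hh y q ≤ i := by
    intro q hq
    have h1 := hh_mono x hq
    have h2 := hh_mono y hq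
    omega
  have hge : ∀ q, c + 2 ≤ q → i + 1 ≤ hh y q := by
    intro q hq
    have h2 := hh_mono y hq
    omega
  have hsx := hh_step x
  have hsy := hh_step y
  have hxc := hsx (c + 2) (by omega)
  have hyc := hsy (c + 2) (by omega)
  rw [show c + 2 + 1 = c + 3 from rfl] at hxc hyc
  have hxc' := hsx c (by omega)
  have hyc' := hsy c (by omega)
  have hlec := hle c (by omega)
  have main : ∀ e : ℕ, e ≤ 1 → ∃ z : V n k, ∀ j ≤ n + 1, hh z j =
      if j ≤ c then min (i - 1) (max (hh x j) (hh y j)) else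
      if j = c + 1 then i - e else if j = c + 2 then i + 1 - e else
        max (i + 1) (min (hh x j) (hh y j)) := by
    intro e he
    apply exists_of_hh
    · simp [hx0, hy0]
    · intro j hj
      have h1 := hsx j hj
      have h2 := hsy j hj
      have h3 := hle j
      have h4 := hle (j + 1)
      have h5 := hge j
      have h6 := hge (j + 1)
      rcases Nat.lt_trichotomy j c with h | h | h
      · simp only [if_pos (show j ≤ c by omega), if_pos (show j + 1 ≤ c by omega)]
        omega
      · subst h
        simp only [if_pos (show j ≤ j by omega), if_neg (show ¬ j + 1 ≤ j by omega), if_true]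
        omega
      · simp only [if_neg (show ¬ j ≤ c by omega), if_neg (show ¬ j + 1 ≤ c by omega)]
        rcases Nat.lt_trichotomy j (c + 2) with h' | h' | h'
        · have : j = c + 1 := by omega
          subst this
          simp only [if_true, if_neg (show ¬ c + 1 + 1 = c + 1 by omega)]
          omega
        · subst h'
          simp only [if_neg (show ¬ c + 2 = c + 1 by omega), if_true,
            if_neg (show ¬ c + 2 + 1 = c + 1 by omega), if_neg (show ¬ c + 2 + 1 = c + 2 by omega)]
          omega
        · simp only [if_neg (show ¬ j = c + 1 by omega), if_neg (show ¬ j + 1 = c + 1 by omega),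
            if_neg (show ¬ j = c + 2 by omega), if_neg (show ¬ j + 1 = c + 2 by omega)]
          omega
    · simp only [if_neg (show ¬ n + 1 ≤ c by omega), if_neg (show ¬ n + 1 = c + 1 by omega)]
      split_ifs with h
      · omega
      · omega
  obtain ⟨z, hz⟩ := main 1 le_rfl
  obtain ⟨z', hz'⟩ := main 0 (by omega)
  have e0 : hh z c = i - 1 := by
    rw [hz c (by omega), if_pos le_rfl]; omega
  have e1 : hh z (c + 1) = i - 1 := by
    rw [hz (c + 1) (by omega), if_neg (by omega), if_pos rfl]
  have e2 : hh z (c + 2) = i + 1 - 1 := by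
    rw [hz (c + 2) (by omega), if_neg (by omega), if_neg (by omega), if_pos rfl]
  have e3 : hh z (c + 3) = i + 1 := by
    rw [hz (c + 3) (by omega), if_neg (by omega), if_neg (by omega), if_neg (by omega)]; omega
  have e0' : hh z' c = i - 1 := by
    rw [hz' c (by omega), if_pos le_rfl]; omega
  have e1' : hh z' (c + 1) = i - 0 := by
    rw [hz' (c + 1) (by omega), if_neg (by omega), if_pos rfl]
  have e2' : hh z' (c + 2) = i + 1 - 0 := by
    rw [hz' (c + 2) (by omega), if_neg (by omega), if_neg (by omega), if_pos rfl]
  have e3' : hh z' (c + 3) = i + 1 := by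
    rw [hz' (c + 3) (by omega), if_neg (by omega), if_neg (by omega), if_neg (by omega)]; omega
  clear main
  refine ⟨z, z', ⟨c, by omega⟩, ⟨c + 1, hcn⟩, rfl, ⟨?_, ?_, ?_, ?_⟩, ?_⟩
  · rw [mem_iff_hh]
    show hh z (c + 1) = hh z c
    omega
  · rw [mem_iff_hh]
    show ¬ hh z (c + 2) = hh z (c + 1)
    omega
  · rw [mem_iff_hh]
    show ¬ hh z (c + 3) = hh z (c + 2)
    omega
  · ext r
    rw [mem_iff_hh]
    simp only [mem_insert, mem_erase, Fin.ext_iff, ne_eq, Fin.val_succ, Fin.val_castSucc]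
    rw [mem_iff_hh]
    have f1 := hz r.val (by omega)
    have f2 := hz (r.val + 1) (by omega)
    have f1' := hz' r.val (by omega)
    have f2' := hz' (r.val + 1) (by omega)
    by_cases g1 : r.val = c
    · rw [g1]; clear f1 f2 f1' f2'; omega
    · by_cases g2 : r.val = c + 1
      · rw [g2]
        show hh z' (c + 2) = hh z' (c + 1) ↔ c + 1 = c + 1 + 1 ∨ ¬ c + 1 = c ∧ hh z (c + 2) = hh z (c + 1)
        clear f1 f2 f1' f2'; omega
      · by_cases g3 : r.val = c + 2
        · rw [g3]
          show hh z' (c + 3) = hh z' (c + 2) ↔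
            c + 2 = c + 1 + 1 ∨ ¬ c + 2 = c ∧ hh z (c + 3) = hh z (c + 2)
          clear f1 f2 f1' f2'; omega
        · have : hh z r.val = hh z' r.val := by
            rw [f1, f1']; simp only [if_neg g2, if_neg g3]
          have : hh z (r.val + 1) = hh z' (r.val + 1) := by
            rw [f2, f2']
            simp only [if_neg (show ¬ r.val + 1 = c + 1 by omega),
              if_neg (show ¬ r.val + 1 = c + 2 by omega)]
          clear f1 f2 f1' f2'; omega
  · intro r
    have h1 := vV_hh x r
    have h2 := vV_hh y r
    have h3 := vV_hh z r
    have h3' := vV_hh z' r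
    have h4 := hz (r.val + 1) (by omega)
    have h4' := hz' (r.val + 1) (by omega)
    have h5 := hle (r.val + 1)
    have h6 := hge (r.val + 1)
    by_cases g2 : r.val + 1 = c + 1
    · left
      rw [g2] at h1 h2 h3 h3'
      clear h4 h4' h6 hz hz' hge e0 e3 e0' e3' hxc hyc hx0 hy0 hxl hyl
      have h5 := hle (c + 1) le_rfl
      omega
    · by_cases g3 : r.val + 1 = c + 2
      · left
        rw [g3] at h1 h2 h3 h3'
        clear h4 h4' h5 h6 hz hz' hge hle e0 e3 e0' e3' hxc hyc hx0 hy0 hxl hyl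
        omega
      · right
        simp only [if_neg g2, if_neg g3] at h4 h4'
        refine ⟨by rw [← h4'] at h4; clear h4' h5 h6; omega, ?_⟩
        clear h4' h3' hz hz' e0 e1 e2 e3 e0' e1' e2' e3' hx0 hy0 hxl hyl hxc hyc hxc' hyc' hlec
        clear hsx hsy hyb1 hxb1 hxb hyb
        have key : min (hh x (r.val + 1)) (hh y (r.val + 1)) ≤ hh z (r.val + 1) ∧
            hh z (r.val + 1) ≤ max (hh x (r.val + 1)) (hh y (r.val + 1)) := by
          clear h1 h2 h3
          by_cases h7 : r.val + 1 ≤ c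
          · rw [if_pos h7] at h4
            have h5 := h5 (by omega)
            clear h6
            rw [h4]
            omega
          · rw [if_neg h7] at h4
            have h6 := h6 (by omega)
            clear h5
            rw [h4]
            omega
        clear h4 h5 h6
        obtain ⟨k1, k2⟩ := key
        exact gExp_between (by omega) (by omega)

lemma hh_far_move {n k : ℕ} (x y : V n k) (s t : Fin n) (hst : s.val + 1 = t.val)
    (h1 : s.castSucc ∈ x.1) (h2 : s.succ ∉ x.1) (h3 : t.succ ∉ x.1)
    (h4 : y.1 = insert t.succ (x.1.erase s.castSucc)) :
    levIdeal (n := n) k (vV x) (vV y) = ⊤ := by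
  have e1 := hh_succ x s.castSucc
  have e2 := hh_succ x s.succ
  have e3 := hh_succ x t.succ
  rw [if_pos h1] at e1
  rw [if_neg h2] at e2
  rw [if_neg h3] at e3
  have y1 : s.castSucc ∉ y.1 := by
    rw [h4]; simp only [mem_insert, mem_erase, Fin.ext_iff, Fin.val_castSucc, Fin.val_succ]; omega
  have y2 : s.succ ∉ y.1 := by
    rw [h4]; simp only [mem_insert, mem_erase, not_or, not_and]
    exact ⟨by simp only [Fin.ext_iff, Fin.val_succ]; omega, fun _ => h2⟩
  have f1 := hh_succ y s.castSucc
  have f2 := hh_succ y s.succ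
  rw [if_neg y1] at f1
  rw [if_neg y2] at f2
  have f0 : hh y s.val = hh x s.val := by
    unfold hh
    refine congrArg card ?_
    ext r
    simp only [mem_filter, mem_univ, true_and, and_congr_left_iff, h4, mem_insert, mem_erase]
    intro hr
    simp only [Fin.ext_iff, Fin.val_succ, Fin.val_castSucc, ne_eq]
    have a1 : ¬ r.val = t.val + 1 := by omega
    have a2 : ¬ r.val = s.val := by omega
    simp only [a1, a2, false_or, not_false_iff, true_and]
  simp only [Fin.val_succ, Fin.val_castSucc] at e1 e2 e3 f1 f2
  rw [← hst] at e3
  rw [Ideal.eq_top_iff_one]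
  have hl := hh_last x
  have hm := hh_mono x (show s.val + 1 + 1 + 1 ≤ n + 1 by omega)
  refine levIdeal_mem _ _ (j := hh x s.val) (by omega) ?_
  rw [xpow_zero]
  intro r
  rw [lev, if_neg]
  rintro ⟨g1, g2⟩
  have k1 := vV_hh x r
  have k2 := vV_hh y r
  rcases Nat.lt_or_ge r.val (s.val + 1) with h | h
  · have := hh_mono x (show r.val + 1 ≤ s.val + 1 by omega)
    omega
  · have := hh_mono y (show s.val + 1 + 1 ≤ r.val + 1 by omega)
    omega

/-- The two-sided ideal of the elements whose coefficients lie in the level ideals. -/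
noncomputable def levTwoSided (n k : ℕ) : TwoSidedIdeal (B0 n k) :=
  TwoSidedIdeal.mk' {a | ∀ x y, a x y ∈ levIdeal k (vV x) (vV y)}
    (fun _ _ => zero_mem _)
    (fun ha hb x y => add_mem (ha x y) (hb x y))
    (fun ha x y => neg_mem (ha x y))
    (fun {a b} hb x z => by
      rw [B0.mul_apply]
      refine sum_mem fun y _ => ?_
      rw [mul_right_comm]
      exact Ideal.mul_mem_right _ _ (levIdeal_left _ _ _ (hb y z)))
    (fun {a b} ha x z => by
      rw [B0.mul_apply]
      exact sum_mem fun y _ => Ideal.mul_mem_right _ _ (levIdeal_right _ _ _ (ha x y)))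

lemma mem_levTwoSided {n k : ℕ} (a : B0 n k) :
    a ∈ levTwoSided n k ↔ ∀ x y, a x y ∈ levIdeal k (vV x) (vV y) := by
  unfold levTwoSided
  exact TwoSidedIdeal.mem_mk' _ _ _ _ _ _ a

lemma relB_subset (n k : ℕ) : relB n k ⊆ levTwoSided n k := by
  rintro a (⟨s, t, hst, h | h⟩ | ⟨t, z, h1, h2, rfl⟩) <;> refine (mem_levTwoSided _).2 ?_
  · intro x y
    rw [h, B0.mul_apply]
    refine sum_mem fun w _ => ?_
    simp only [elR]
    split_ifs with a1 a2
    · rw [hh_far_move x y s t hst a1.1 a1.2.1]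
      · trivial
      · intro h'
        apply a2.2.1
        rw [a1.2.2]
        refine mem_insert_of_mem (mem_erase.2 ⟨?_, h'⟩)
        simp only [ne_eq, Fin.ext_iff, Fin.val_castSucc, Fin.val_succ]; omega
      · rw [a2.2.2, a1.2.2]
        have : t.castSucc = s.succ := by ext; simp [hst]
        rw [this, erase_insert]
        intro h'; exact a1.2.1 (mem_of_mem_erase h')
    all_goals simp
  · intro x y
    rw [h, B0.mul_apply]
    refine sum_mem fun w _ => ?_
    simp only [elL]
    have hts : t.castSucc = s.succ := by ext; simp [hst]
    split_ifs with a1 a2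
    · rw [levIdeal_symm, hh_far_move y x s t hst]
      · trivial
      · rw [a2.2.2]; exact mem_insert_self _ _
      · rw [a2.2.2]
        simp only [mem_insert, mem_erase, Fin.ext_iff, Fin.val_castSucc, Fin.val_succ]
        omega
      · rw [a2.2.2, a1.2.2]
        simp only [mem_insert, mem_erase, Fin.ext_iff, Fin.val_castSucc, Fin.val_succ]
        omega
      · have b1 : s.castSucc ∉ w.1.erase s.succ := fun h' => a2.2.1 (mem_of_mem_erase h')
        have b2 : s.succ ∉ x.1.erase t.succ := fun h' => a1.2.1 (hts ▸ mem_of_mem_erase h')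
        rw [a2.2.2, erase_insert b1, a1.2.2, hts, erase_insert b2, insert_erase a1.1]
    all_goals simp
  · intro x y
    simp only [sc]
    split_ifs with h
    · obtain ⟨rfl, rfl⟩ := h
      have e1 := hh_succ y t.castSucc
      have e2 := hh_succ y t.succ
      rw [if_neg h1] at e1
      rw [if_neg h2] at e2
      simp only [Fin.val_succ, Fin.val_castSucc] at e1 e2
      have hl := hh_last y
      have hm := hh_mono y (show t.val + 1 + 1 ≤ n + 1 by omega)
      refine levIdeal_mem _ _ (j := hh y t.val) (by omega) ?_
      have : (X t : R n) = xpow (fun s => if s = t then 1 else 0) := by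
        unfold xpow
        rw [prod_eq_single t (fun s _ h => by simp [h]) (by simp)]
        simp
      rw [this]
      refine xpow_dvd fun r => ?_
      rw [lev]
      split_ifs with g1 g2 <;> try omega
      exfalso
      have k1 := vV_hh y r
      have : r.val ≠ t.val := fun h => g2 (Fin.ext h)
      rcases Nat.lt_or_ge r.val t.val with h | h
      · have := hh_mono y (show r.val + 1 ≤ t.val by omega)
        omega
      · have := hh_mono y (show t.val + 1 + 1 ≤ r.val + 1 by omega)
        omega
    · exact zero_mem _

lemma sc_add {n k : ℕ} (p q : R n) (x y : V n k) : sc (p + q) x y = sc p x y + sc q x y := by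
  apply B0.ext; intro x' y'
  rw [B0.add_apply]
  simp only [sc]; split_ifs <;> simp

lemma sc_zero {n k : ℕ} (x y : V n k) : sc (0 : R n) x y = 0 := by
  apply B0.ext; intro x' y'
  rw [B0.zero_apply]
  simp only [sc]; split_ifs <;> simp

lemma sc_smul {n k : ℕ} (p q : R n) (x y : V n k) : sc (p * q) x y = sc p x x * sc q x y := by
  rw [sc_mul, xpow_zero (gExp_left _ _), one_mul]

lemma sc_mul_mul {n k : ℕ} (a : B0 n k) (x z z' y : V n k) :
    sc 1 x z * a * sc 1 z' y =
      sc (xpow (gExp (vV x) (vV z) (vV z')) * xpow (gExp (vV x) (vV z') (vV y)) * a z z') x y := by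
  apply B0.ext
  intro x' y'
  rw [B0.mul_apply, sum_eq_single z']
  · rw [B0.mul_apply, sum_eq_single z]
    · simp only [sc]
      by_cases h1 : x' = x
      · by_cases h2 : y' = y
        · subst h1 h2; simp; ring
        · simp [h2]
      · simp [h1]
    · intro w _ hw; simp [sc, hw]
    · simp
  · intro w _ hw; simp [sc, hw]
  · simp

lemma vV_move {n k : ℕ} (z w : V n k) (a b : Fin (n + 1)) (hab : a.val < b.val) (hb : b ∉ z.1)
    (hw : w.1 = insert b (z.1.erase a)) (r : Fin n) : vV z r ≤ vV w r := by
  unfold vV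
  refine card_le_card_of_injOn (fun c => if c = a then b else c) ?_ ?_
  · intro c hc
    simp only [coe_filter, Set.mem_ofPred_eq, hw, mem_insert, mem_erase] at hc ⊢
    split_ifs with h
    · subst h; exact ⟨Or.inl rfl, by omega⟩
    · exact ⟨Or.inr ⟨h, hc.1⟩, hc.2⟩
  · intro c hc d hd h
    simp only [coe_filter, Set.mem_ofPred_eq] at hc hd
    dsimp only at h
    split_ifs at h with h1 h2 h2
    · rw [h1, h2]
    · exact absurd (h ▸ hd.1) hb
    · exact absurd (h ▸ hc.1) hb
    · exact h

lemma sc_far_mem {n k : ℕ} (z z' : V n k) (s t : Fin n) (hst : s.val + 1 = t.val)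
    (h1 : s.castSucc ∈ z.1) (h2 : s.succ ∉ z.1) (h3 : t.succ ∉ z.1)
    (h4 : z'.1 = insert t.succ (z.1.erase s.castSucc)) :
    (∃ a ∈ relIdeal n k, a z z' = 1) ∧ ∃ a ∈ relIdeal n k, a z' z = 1 := by
  have hts : t.castSucc = s.succ := by ext; simp [hst]
  have hne : t.succ ≠ s.succ := by simp only [ne_eq, Fin.ext_iff, Fin.val_succ]; omega
  have hne2 : s.castSucc ≠ s.succ := by simp only [ne_eq, Fin.ext_iff, Fin.val_succ, Fin.val_castSucc]; omega
  have hne3 : t.succ ≠ s.castSucc := by simp only [ne_eq, Fin.ext_iff, Fin.val_succ, Fin.val_castSucc]; omega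
  have b2 : s.succ ∉ z.1.erase s.castSucc := fun h => h2 (mem_of_mem_erase h)
  have b3 : t.succ ∉ z.1.erase s.castSucc := fun h => h3 (mem_of_mem_erase h)
  let w : V n k := ⟨insert s.succ (z.1.erase s.castSucc), by
    rw [card_insert_of_notMem b2, card_erase_of_mem h1, z.2]
    have := card_pos.2 ⟨_, h1⟩
    rw [z.2] at this; omega⟩
  have hw : w.1 = insert s.succ (z.1.erase s.castSucc) := rfl
  have w1 : t.castSucc ∈ w.1 := by rw [hts]; exact mem_insert_self _ _
  have w2 : t.succ ∉ w.1 := by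
    rw [hw, mem_insert, not_or]; exact ⟨hne, b3⟩
  have w3 : z'.1 = insert t.succ (w.1.erase t.castSucc) := by
    rw [h4, hw, hts, erase_insert b2]
  have m1 := vV_move z w s.castSucc s.succ (by simp) h2 hw
  have m2 := vV_move w z' t.castSucc t.succ (by simp) w2 w3
  have g : ∀ r, gExp (vV z) (vV w) (vV z') r = 0 := fun r => by
    have := m1 r; have := m2 r
    exact gExp_between (by omega) (by omega)
  have x1 : t.succ ∈ z'.1 := by rw [h4]; exact mem_insert_self _ _
  have x2 : t.castSucc ∉ z'.1 := by
    rw [h4, hts, mem_insert, not_or]; exact ⟨hne.symm, b2⟩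
  have x3 : w.1 = insert t.castSucc (z'.1.erase t.succ) := by
    rw [h4, erase_insert b3, hts]
  have y2 : s.castSucc ∉ w.1 := by
    rw [hw, mem_insert, not_or]; exact ⟨hne2, fun h => (mem_erase.1 h).1 rfl⟩
  have y3 : z.1 = insert s.castSucc (w.1.erase s.succ) := by
    rw [hw, erase_insert b2, insert_erase h1]
  refine ⟨⟨elR k s * elR k t, ?_, ?_⟩, ⟨elL k t * elL k s, ?_, ?_⟩⟩
  · exact TwoSidedIdeal.mem_asIdeal.2
      (TwoSidedIdeal.subset_span (Or.inl ⟨s, t, hst, Or.inl rfl⟩))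
  · rw [B0.mul_apply, sum_eq_single w]
    · rw [xpow_zero g]
      simp only [elR]
      rw [if_pos ⟨h1, h2, hw⟩, if_pos ⟨w1, w2, w3⟩]; simp
    · intro u _ hu
      simp only [elR]
      rw [if_neg (fun h => hu (Subtype.ext (h.2.2.trans hw.symm)))]; simp
    · simp
  · exact TwoSidedIdeal.mem_asIdeal.2
      (TwoSidedIdeal.subset_span (Or.inl ⟨s, t, hst, Or.inr rfl⟩))
  · rw [B0.mul_apply, sum_eq_single w]
    · rw [gExp_symm, xpow_zero g]
      simp only [elL]
      rw [if_pos ⟨x1, x2, x3⟩, if_pos ⟨hts ▸ w1, y2, y3⟩]; simp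
    · intro u _ hu
      simp only [elL]
      rw [if_neg (fun h => hu (Subtype.ext (h.2.2.trans x3.symm)))]; simp
    · simp

lemma sc_one_mem {n k : ℕ} {a : B0 n k} (ha : a ∈ relIdeal n k) {x z z' y : V n k}
    (h1 : a z z' = 1)
    (hg : ∀ r, gExp (vV x) (vV z) (vV z') r = 0 ∧ gExp (vV x) (vV z') (vV y) r = 0) :
    sc 1 x y ∈ relIdeal n k := by
  have h := (relIdeal n k).mul_mem_right (sc 1 z' y) ((relIdeal n k).mul_mem_left (sc 1 x z) ha)
  rw [sc_mul_mul, h1, xpow_zero (fun r => (hg r).1), xpow_zero (fun r => (hg r).2)] at h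
  simpa using h

lemma far_zero {n : ℕ} (a b c d : Fin n → ℕ) (r : Fin n)
    (h : (a r ≤ b r ∧ b r ≤ c r ∧ c r ≤ d r) ∨ (b r = c r ∧ gExp a b d r = 0)) :
    gExp a b c r = 0 ∧ gExp a c d r = 0 := by
  rcases h with h | ⟨h, h'⟩
  · exact ⟨gExp_between (by omega) (by omega), gExp_between (by omega) (by omega)⟩
  · refine ⟨?_, ?_⟩
    · exact gExp_between (by omega) (by omega)
    · rw [← h']; simp only [gExp, h]

lemma last_level {n k : ℕ} (y : V n k) {i : ℕ} (hin : i + k ≤ n) :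
    ∃ b ≤ n, hh y b = i ∧ hh y (b + 1) = i + 1 := by
  classical
  have hl := hh_last y
  have hex : ∃ q, i + 1 ≤ hh y q := ⟨n + 1, by omega⟩
  have h1 := Nat.find_spec hex
  have h2 : Nat.find hex ≤ n + 1 := Nat.find_min' hex (by omega)
  have h3 := fun q (hq : q < Nat.find hex) => Nat.find_min hex hq
  generalize Nat.find hex = q at *
  cases q with
  | zero => rw [hh_zero] at h1; omega
  | succ b =>
    have := h3 b (by omega)
    have := hh_step y b (by omega)
    exact ⟨b, by omega, by omega, by omega⟩

lemma sc_lev_mem {n k : ℕ} (x y : V n k) {j : ℕ} (hj : j < n - k) :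
    sc (xpow (lev (vV x) (vV y) (k + j))) x y ∈ relIdeal n k := by
  by_cases hex : ∃ q ≤ n + 1, hh x q = j + 1 ∧ hh y q = j + 1
  · obtain ⟨z, t, h1, h2, h3⟩ := exists_near x y (i := j + 1) (by omega) (by omega) hex
    have hm : sc (X t) z z ∈ relIdeal n k := TwoSidedIdeal.mem_asIdeal.2
      (TwoSidedIdeal.subset_span (Or.inr ⟨t, z, h1, h2, rfl⟩))
    have h := (relIdeal n k).mul_mem_right (sc 1 z y)
      ((relIdeal n k).mul_mem_left (sc 1 x z) hm)
    rw [sc_mul_mul, xpow_zero (gExp_right _ _)] at h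
    have hX : (X t : R n) = xpow (fun s => if s = t then 1 else 0) := by
      unfold xpow
      rw [prod_eq_single t (fun s _ h => by simp [h]) (by simp)]
      simp
    obtain ⟨c, hc⟩ : (1 * xpow (gExp (vV x) (vV z) (vV y)) * sc (X t) z z z z : R n) ∣
        xpow (lev (vV x) (vV y) (k + j)) := by
      simp only [sc, and_self, if_true, one_mul]
      rw [hX, ← xpow_add]
      exact xpow_dvd h3
    rw [hc, mul_comm, sc_smul]
    exact (relIdeal n k).mul_mem_left _ h
  · obtain ⟨b, hb, hb1, hb2⟩ := last_level y (i := j + 1) (by omega)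
    obtain ⟨c, hc, hc1, hc2⟩ := last_level x (i := j + 1) (by omega)
    have hone : sc 1 x y ∈ relIdeal n k := by
      have hne1 : hh x b ≠ j + 1 := fun h => hex ⟨b, by omega, h, hb1⟩
      have hne2 : hh y c ≠ j + 1 := fun h => hex ⟨c, by omega, hc1, h⟩
      rcases Nat.lt_or_ge (hh x b) (j + 1) with h | h
      · have := hh_step x b (by omega)
        obtain ⟨z, z', s, t, hst, ⟨h1, h2, h3, h4⟩, h5⟩ := exists_far x y (i := j + 1)
          (by omega) (by omega) hb hb1 hb2 (by omega) (by omega)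
        obtain ⟨⟨a, ha, ha'⟩, -⟩ := sc_far_mem z z' s t hst h1 h2 h3 h4
        exact sc_one_mem ha ha' fun r => far_zero _ _ _ _ r (h5 r)
      · have hcb : c < b := by
          by_contra h'
          have := hh_mono x (show b ≤ c by omega)
          omega
        have := hh_mono y (show c ≤ b by omega)
        have := hh_step y c (by omega)
        obtain ⟨z, z', s, t, hst, ⟨h1, h2, h3, h4⟩, h5⟩ := exists_far y x (i := j + 1)
          (by omega) (by omega) hc hc1 hc2 (by omega) (by omega)
        obtain ⟨-, ⟨a, ha, ha'⟩⟩ := sc_far_mem z z' s t hst h1 h2 h3 h4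
        refine sc_one_mem ha ha' fun r => ?_
        rcases h5 r with h6 | ⟨h6, h7⟩
        · exact ⟨gExp_between (by omega) (by omega), gExp_between (by omega) (by omega)⟩
        · exact ⟨gExp_between (by omega) (by omega), by rw [gExp_symm]; exact h7⟩
    have h := (relIdeal n k).mul_mem_left (sc (xpow (lev (vV x) (vV y) (k + j))) x x) hone
    rw [← sc_smul, mul_one] at h
    exact h

lemma eq_sum_sc {n k : ℕ} (a : B0 n k) : a = ∑ x, ∑ y, sc (a x y) x y := by
  let ev : V n k → V n k → B0 n k →+ R n := fun x y =>
    { toFun := fun a => a x y, map_zero' := rfl, map_add' := fun _ _ => rfl }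
  have hev : ∀ x y a, ev x y a = a x y := fun _ _ _ => rfl
  apply B0.ext
  intro x y
  show a x y = ev x y (∑ x, ∑ y, sc (a x y) x y)
  rw [map_sum, sum_eq_single x, map_sum, sum_eq_single y]
  · rw [hev, sc, if_pos ⟨rfl, rfl⟩]
  · intro z _ h; rw [hev, sc, if_neg (fun h' => h h'.2.symm)]
  · simp
  · intro z _ h; rw [map_sum]
    refine sum_eq_zero fun w _ => ?_
    rw [hev, sc, if_neg (fun h' => h h'.1.symm)]
  · simp

lemma mem_relIdeal {n k : ℕ} (a : B0 n k) :
    a ∈ relIdeal n k ↔ ∀ x y, a x y ∈ levIdeal k (vV x) (vV y) := by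
  constructor
  · intro h
    rw [← mem_levTwoSided]
    exact TwoSidedIdeal.span_le.2 (relB_subset n k) (TwoSidedIdeal.mem_asIdeal.1 h)
  · intro h
    rw [eq_sum_sc a]
    refine sum_mem fun x _ => sum_mem fun y _ => ?_
    refine Submodule.span_induction (p := fun q _ => sc q x y ∈ relIdeal n k) ?_ ?_ ?_ ?_ (h x y)
    · rintro _ ⟨j, hj, rfl⟩
      exact sc_lev_mem x y hj
    · rw [sc_zero]; exact zero_mem _
    · intro p q _ _ hp hq; rw [sc_add]; exact add_mem hp hq
    · intro p q _ hq; rw [smul_eq_mul, sc_smul]; exact (relIdeal n k).mul_mem_left _ hq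

/-! ### Maps out of the quotient rings -/

/-- An additive map that kills the kernel of a surjective ring homomorphism descends. -/
noncomputable def liftAdd {S Q P : Type} [Ring S] [Ring Q] [AddCommGroup P] (π : S →+* Q)
    (hπ : Function.Surjective π) (f : S →+ P) (hk : ∀ s, π s = 0 → f s = 0) : Q →+ P :=
  (π : S →+ Q).liftOfRightInverse (Function.surjInv hπ) (Function.rightInverse_surjInv hπ)
    ⟨f, fun s hs => hk s hs⟩

lemma liftAdd_apply {S Q P : Type} [Ring S] [Ring Q] [AddCommGroup P] (π : S →+* Q)
    (hπ : Function.Surjective π) (f : S →+ P) (hk : ∀ s, π s = 0 → f s = 0) (s : S) :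
    liftAdd π hπ f hk (π s) = f s :=
  (π : S →+ Q).liftOfRightInverse_comp_apply _ _ ⟨f, fun s hs => hk s hs⟩ s

/-- The same for maps that also preserve products. -/
noncomputable def liftMul {S Q P : Type} [Ring S] [Ring Q] [Ring P] (π : S →+* Q)
    (hπ : Function.Surjective π) (f : S →+ P) (hk : ∀ s, π s = 0 → f s = 0)
    (hm : ∀ s t, f (s * t) = f s * f t) : Q →ₙ+* P where
  __ := liftAdd π hπ f hk
  map_mul' := by
    intro x y
    obtain ⟨s, rfl⟩ := hπ x
    obtain ⟨t, rfl⟩ := hπ y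
    show liftAdd π hπ f hk _ = liftAdd π hπ f hk _ * liftAdd π hπ f hk _
    rw [← map_mul, liftAdd_apply, liftAdd_apply, liftAdd_apply, hm]

lemma liftMul_apply {S Q P : Type} [Ring S] [Ring Q] [Ring P] (π : S →+* Q)
    (hπ : Function.Surjective π) (f : S →+ P) (hk : ∀ s, π s = 0 → f s = 0)
    (hm : ∀ s t, f (s * t) = f s * f t) (s : S) : liftMul π hπ f hk hm (π s) = f s :=
  liftAdd_apply π hπ f hk s

/-! ### The algebra `B_l` and the homomorphism `Ξ` -/

lemma mkB_idem {n k : ℕ} (P : V n k → Prop) [DecidablePred P] :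
    IsIdempotentElem (mkB n k (idem P)) := by
  unfold IsIdempotentElem
  rw [← map_mul]
  congr 1
  apply B0.ext
  intro x y
  rw [idem_mul]
  simp only [idem]
  split_ifs <;> tauto

/-- Left I-states: those which do not contain `n`. -/
def IsLeft {n k : ℕ} (x : V n k) : Prop := Fin.last n ∉ x.1

instance {n k : ℕ} : DecidablePred (IsLeft (n := n) (k := k)) := fun x =>
  inferInstanceAs (Decidable (Fin.last n ∉ x.1))

/-- The idempotent `∑ I_x` over the left I-states. -/
noncomputable def eL (n k : ℕ) : B n k := mkB n k (idem IsLeft)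

lemma eL_idem (n k : ℕ) : IsIdempotentElem (eL n k) := mkB_idem _

/-- The algebra `B_l(n,k) = ⨁ I_x B(n,k) I_y`, over the left I-states `x` and `y`. -/
def Bl (n k : ℕ) : Type := (eL_idem n k).Corner

noncomputable instance (n k : ℕ) : Ring (Bl n k) := inferInstanceAs (Ring (eL_idem n k).Corner)

/-- The inclusion of `B_l(n,k)` in `B(n,k)`. -/
noncomputable def Bl.val {n k : ℕ} : Bl n k →ₙ+* B n k where
  toFun b := Subtype.val (p := fun r => r ∈ Subsemigroup.corner (eL n k)) b
  map_mul' _ _ := rfl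
  map_zero' := rfl
  map_add' _ _ := rfl

lemma Bl.val_injective {n k : ℕ} : Function.Injective (Bl.val (n := n) (k := k)) :=
  Subtype.val_injective

lemma Bl.val_one {n k : ℕ} : Bl.val (1 : Bl n k) = eL n k := rfl

lemma Bl.eL_mul {n k : ℕ} (b : Bl n k) : eL n k * Bl.val b = Bl.val b :=
  ((Subsemigroup.mem_corner_iff (eL_idem n k)).1 b.2).1

lemma Bl.mul_eL {n k : ℕ} (b : Bl n k) : Bl.val b * eL n k = Bl.val b :=
  ((Subsemigroup.mem_corner_iff (eL_idem n k)).1 b.2).2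

/-- An element of `B_l(n,k)` from an element of `B(n,k)` fixed by the idempotent on both sides. -/
noncomputable def Bl.mk {n k : ℕ} (b : B n k) (h1 : eL n k * b = b) (h2 : b * eL n k = b) : Bl n k :=
  Subtype.mk (p := fun r => r ∈ Subsemigroup.corner (eL n k)) b
    ((Subsemigroup.mem_corner_iff (eL_idem n k)).2 ⟨h1, h2⟩)

lemma Bl.val_mk {n k : ℕ} (b : B n k) (h1 : eL n k * b = b) (h2 : b * eL n k = b) :
    Bl.val (Bl.mk b h1 h2) = b := rfl

/-- The left I-state `x` with `μ = μ^x`: position `i` carries a `∧` if and only if `i - 1 ∈ x`. -/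
def st {n k : ℕ} (μ : D n k) : V n k := ⟨μ.1.map Fin.castSuccEmb, by rw [card_map, μ.2]⟩

lemma st_injective {n k : ℕ} : Function.Injective (st (n := n) (k := k)) := by
  intro μ ν h
  exact Subtype.ext (map_injective _ (congrArg Subtype.val h))

lemma st_left {n k : ℕ} (μ : D n k) : IsLeft (st μ) := by
  simp only [IsLeft, st, mem_map, Fin.castSuccEmb_apply, not_exists, not_and]
  intro i _ h
  exact absurd h (Fin.castSucc_lt_last i).ne

lemma mem_range_st {n k : ℕ} {x : V n k} (hx : IsLeft x) : x ∈ Set.range (st (n := n) (k := k)) := by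
  have h1 : (univ.filter fun i : Fin n => i.castSucc ∈ x.1).map Fin.castSuccEmb = x.1 := by
    ext r
    simp only [mem_map, mem_filter, mem_univ, true_and, Fin.castSuccEmb_apply]
    constructor
    · rintro ⟨i, hi, rfl⟩; exact hi
    · intro hr
      refine Fin.lastCases (motive := fun r => r ∈ x.1 → ∃ a, a.castSucc ∈ x.1 ∧ a.castSucc = r)
        (fun h => absurd h hx) (fun i hi => ⟨i, hi, rfl⟩) r hr
  refine ⟨⟨univ.filter fun i : Fin n => i.castSucc ∈ x.1, ?_⟩, Subtype.ext h1⟩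
  rw [← card_map Fin.castSuccEmb, h1, x.2]

lemma vV_st {n k : ℕ} (μ : D n k) : vV (st μ) = vD μ := by
  funext t
  simp only [vV, vD, st, filter_map, card_map]
  rfl

lemma T_ext {n k : ℕ} {φ ψ : T n k} (h : ∀ κ μ, comp φ κ μ = comp ψ κ μ) : φ = ψ := by
  refine LinearMap.pi_ext fun κ v => ?_
  funext μ
  exact LinearMap.congr_fun (h κ μ) v

/-- The element of `⨁ Hom(R_{b^κ}, R_{b^μ})` with the components `r κ μ • (1 ↦ x^c)`, where
`c_i = max(b_i^μ - b_i^κ, 0)`. -/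
noncomputable def ofCoeff {n k : ℕ} (r : D n k → D n k → R n) : T n k :=
  LinearMap.pi fun μ => ∑ κ, r κ μ • (mon κ μ ∘ₗ LinearMap.proj κ)

lemma comp_ofCoeff {n k : ℕ} (r : D n k → D n k → R n) (κ μ : D n k) :
    comp (ofCoeff r) κ μ = r κ μ • mon κ μ := by
  apply LinearMap.ext
  intro v
  simp only [comp, ofCoeff, LinearMap.comp_apply, LinearMap.proj_apply, LinearMap.pi_apply,
    LinearMap.sum_apply, LinearMap.smul_apply, LinearMap.single_apply]
  rw [sum_eq_single κ]
  · rw [Pi.single_eq_same]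
  · intro ν _ h; rw [Pi.single_eq_of_ne h, map_zero, smul_zero]
  · simp

/-- `Ξ` on representatives: the coefficient of `f_{x,y}` becomes the coefficient of
`1 ↦ x^c : R_{b^λ} → R_{b^μ}`, for `μ = μ^x` and `λ = μ^y`. -/
noncomputable def Xi0 {n k : ℕ} : B0 n k →+ T n k where
  toFun β := ofCoeff fun κ μ => β (st μ) (st κ)
  map_zero' := T_ext fun κ μ => by rw [comp_ofCoeff, comp_zero, B0.zero_apply, zero_smul]
  map_add' β γ := T_ext fun κ μ => by
    rw [comp_add, comp_ofCoeff, comp_ofCoeff, comp_ofCoeff, B0.add_apply, add_smul]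

lemma comp_Xi0 {n k : ℕ} (β : B0 n k) (κ μ : D n k) :
    comp (Xi0 β) κ μ = β (st μ) (st κ) • mon κ μ := comp_ofCoeff _ _ _

lemma Xi0_ker {n k : ℕ} (β : B0 n k) (h : mkB n k β = 0) : mkA n k (Xi0 β) = 0 := by
  rw [mkB_eq_zero, mem_relIdeal] at h
  rw [mkA_eq_zero]
  intro κ μ
  rw [comp_Xi0, mem_W]
  refine ⟨_, ?_, rfl⟩
  have := h (st μ) (st κ)
  rwa [levIdeal_symm, vV_st, vV_st] at this

lemma Xi0_mul {n k : ℕ} (β γ : B0 n k) (hγ : ∀ x y, ¬ IsLeft x → γ x y = 0) :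
    Xi0 (β * γ) = Xi0 β * Xi0 γ := by
  apply T_ext
  intro κ μ
  rw [comp_mul, comp_Xi0, B0.mul_apply, ← Fintype.sum_of_injective st st_injective
    (fun ν => xpow (gExp (vV (st μ)) (vV (st ν)) (vV (st κ))) * β (st μ) (st ν) * γ (st ν) (st κ))]
  · rw [sum_smul]
    refine sum_congr rfl fun ν _ => ?_
    rw [comp_Xi0, comp_Xi0, LinearMap.smul_comp, LinearMap.comp_smul, mon_comp, smul_smul,
      smul_smul, gExp_symm, vV_st, vV_st, vV_st]
    congr 1; ring
  · intro y hy
    rw [hγ y _ (fun h => hy (mem_range_st h)), mul_zero]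
  · intro ν; rfl

lemma Xi0_idem {n k : ℕ} : Xi0 (idem (IsLeft (n := n) (k := k))) = 1 := by
  apply T_ext
  intro κ μ
  rw [comp_Xi0]
  apply LinearMap.ext
  intro v
  simp only [idem, comp, LinearMap.comp_apply, LinearMap.smul_apply, LinearMap.proj_apply,
    Module.End.one_apply, LinearMap.single_apply, st_injective.eq_iff, st_left, and_true]
  split_ifs with h
  · subst h
    rw [mon_self, one_smul, Pi.single_eq_same]; rfl
  · rw [zero_smul, Pi.single_eq_of_ne h]

/-- `Ξ` as an additive map on `B(n,k)`, zero on `I_x B(n,k) I_y` unless `x` and `y` are left. -/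
noncomputable def XiB (n k : ℕ) : B n k →+ A n k :=
  liftAdd (mkB n k) (mkB_surjective n k) ((mkA n k : T n k →+ A n k).comp Xi0) Xi0_ker

lemma XiB_mk {n k : ℕ} (β : B0 n k) : XiB n k (mkB n k β) = mkA n k (Xi0 β) :=
  liftAdd_apply _ _ _ _ β

/-- The ring homomorphism `Ξ : B_l(n,k) → A_{n,k}`, `ℤ[U₁, …, Uₙ]`-linear with
`Ξ(f_{x,y}) = (R_{b^λ} → R_{b^μ}, 1 ↦ x^c)`, `c_i = max(b_i^μ - b_i^λ, 0)`, `μ = μ^x`, `λ = μ^y`. -/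
noncomputable def Xi (n k : ℕ) : Bl n k →+* A n k where
  toFun b := XiB n k (Bl.val b)
  map_one' := by
    show XiB n k (mkB n k (idem IsLeft)) = 1
    rw [XiB_mk, Xi0_idem, map_one]
  map_mul' b c := by
    obtain ⟨β, hβ⟩ := mkB_surjective n k (Bl.val b)
    obtain ⟨γ, hγ⟩ := mkB_surjective n k (Bl.val c)
    have hc : Bl.val c = mkB n k (idem IsLeft * γ) := by
      rw [map_mul, hγ]; exact (Bl.eL_mul c).symm
    rw [map_mul, hc, ← hβ, ← map_mul, XiB_mk, XiB_mk, XiB_mk, Xi0_mul, map_mul]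
    intro x y h
    rw [idem_mul, if_neg h]
  map_zero' := by rw [map_zero, map_zero]
  map_add' b c := by rw [map_add, map_add]

/-! ### The homomorphisms `Ψ` and `Ψ'` -/

lemma levIdeal_succ {n k : ℕ} (a c : Fin n → ℕ) : levIdeal (n := n) (k + 1) a c ≤ levIdeal k a c := by
  conv_lhs => unfold levIdeal
  rw [Ideal.span_le]
  rintro _ ⟨j, hj, rfl⟩
  refine levIdeal_mem a c (j := j + 1) (by omega) ?_
  rw [show k + (j + 1) = k + 1 + j by omega]

lemma gExp_mem {n k : ℕ} (a b c : Fin n → ℕ) (hk : k < n) (hb : ∀ t, k + 1 ≤ b t + t.val) :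
    xpow (gExp a b c) ∈ levIdeal (n := n) k a c := by
  refine levIdeal_mem a c (j := 0) (by omega) (xpow_dvd fun t => ?_)
  have := hb t
  simp only [lev, gExp, Nat.dist]
  split_ifs <;> omega

/-- The identity map between cyclic modules for equal `b`-sequences. -/
noncomputable def idMap {n k k' : ℕ} {κ : D n k} {ν : D n k'} (h : bSeq κ = bSeq ν) :
    RMod κ →ₗ[R n] RMod ν := Submodule.factor (by rw [h])

lemma idMap_mk {n k k' : ℕ} {κ : D n k} {ν : D n k'} (h : bSeq κ = bSeq ν) (p : R n) :
    idMap h (Submodule.Quotient.mk p) = Submodule.Quotient.mk p := rfl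

section Psi
variable {n k : ℕ} [NeZero n]

/-- `λ^(∧)`: replace the leftmost symbol `∨` by a `∧`. -/
def D.up (κ : D n k) (h : (0 : Fin n) ∉ κ.1) : D n (k + 1) :=
  ⟨insert 0 κ.1, by rw [card_insert_of_notMem h, κ.2]⟩

/-- `μ^(∨)`: replace the leftmost symbol `∧` by a `∨`. -/
def D.down (ν : D n (k + 1)) (h : (0 : Fin n) ∈ ν.1) : D n k :=
  ⟨ν.1.erase 0, by rw [card_erase_of_mem h, ν.2]; rfl⟩

lemma D.down_up (κ : D n k) (h : (0 : Fin n) ∉ κ.1) (h' : (0 : Fin n) ∈ (κ.up h).1) :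
    (κ.up h).down h' = κ := Subtype.ext (erase_insert h)

lemma D.up_down (ν : D n (k + 1)) (h : (0 : Fin n) ∈ ν.1) (h' : (0 : Fin n) ∉ (ν.down h).1) :
    (ν.down h).up h' = ν := Subtype.ext (insert_erase h)

lemma vD_up (κ : D n k) (h : (0 : Fin n) ∉ κ.1) : vD (κ.up h) = vD κ := by
  funext t
  simp only [vD, D.up, filter_insert]
  rw [if_neg (by simp)]

lemma bSeq_up (κ : D n k) (h : (0 : Fin n) ∉ κ.1) : bSeq (κ.up h) = bSeq κ := by
  funext t; rw [bSeq, bSeq, vD_up]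

lemma bSeq_down (ν : D n (k + 1)) (h : (0 : Fin n) ∈ ν.1) : bSeq (ν.down h) = bSeq ν := by
  have h' : (0 : Fin n) ∉ (ν.down h).1 := notMem_erase _ _
  rw [← bSeq_up _ h', D.up_down]

/-- The inclusion of `⨁ R_{b^κ}`, over `κ ∈ D_{n,k}` starting with `∨`, in
`⨁ R_{b^ν}`, `ν ∈ D_{n,k+1}`, extended by zero. -/
noncomputable def inc (n k : ℕ) [NeZero n] :
    (∀ κ : D n k, RMod κ) →ₗ[R n] ∀ ν : D n (k + 1), RMod ν :=
  LinearMap.pi fun ν => if h : (0 : Fin n) ∈ ν.1 then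
    idMap (bSeq_down ν h) ∘ₗ LinearMap.proj (ν.down h) else 0

/-- The projection of `⨁ R_{b^ν}`, `ν ∈ D_{n,k+1}`, to `⨁ R_{b^κ}`, over the `κ ∈ D_{n,k}` starting
with `∨`. -/
noncomputable def proj (n k : ℕ) [NeZero n] :
    (∀ ν : D n (k + 1), RMod ν) →ₗ[R n] ∀ κ : D n k, RMod κ :=
  LinearMap.pi fun κ => if h : (0 : Fin n) ∉ κ.1 then
    idMap (bSeq_up κ h) ∘ₗ LinearMap.proj (κ.up h) else 0

/-- `Ψ` on representatives: regard the components `R_{b^λ} → R_{b^μ}` with `λ` and `μ` starting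
with `∧` as maps `R_{b^κ} → R_{b^η}` for `κ = λ^(∨)`, `η = μ^(∨)`, and drop the others. -/
noncomputable def Psi0 (n k : ℕ) [NeZero n] : T n (k + 1) →+ T n k where
  toFun φ := proj n k ∘ₗ φ ∘ₗ inc n k
  map_zero' := by rw [LinearMap.zero_comp, LinearMap.comp_zero]
  map_add' φ ψ := by rw [LinearMap.add_comp, LinearMap.comp_add]

lemma comp_Psi0_of_not (φ : T n (k + 1)) (κ μ : D n k)
    (h : ¬ ((0 : Fin n) ∉ κ.1 ∧ (0 : Fin n) ∉ μ.1)) : comp (Psi0 n k φ) κ μ = 0 := by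
  apply LinearMap.ext
  intro v
  show proj n k (φ (inc n k (LinearMap.single (R n) (fun κ : D n k => RMod κ) κ v))) μ = 0
  by_cases hμ : (0 : Fin n) ∉ μ.1
  · have hκ : (0 : Fin n) ∈ κ.1 := by by_contra h'; exact h ⟨h', hμ⟩
    have : inc n k (LinearMap.single (R n) (fun κ : D n k => RMod κ) κ v) = 0 := by
      funext ν
      simp only [inc, LinearMap.pi_apply]
      split_ifs with h1
      · have : ν.down h1 ≠ κ := by
          intro h2; rw [← h2] at hκ; exact notMem_erase _ _ hκ
        rw [LinearMap.comp_apply, LinearMap.proj_apply, LinearMap.single_apply,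
          Pi.single_eq_of_ne this, map_zero]; rfl
      · rfl
    rw [this, map_zero, map_zero]; rfl
  · simp only [proj, LinearMap.pi_apply]
    rw [dif_neg hμ]; rfl

lemma inc_single (κ : D n k) (hκ : (0 : Fin n) ∉ κ.1) (v : RMod κ) :
    inc n k (LinearMap.single (R n) (fun κ : D n k => RMod κ) κ v) =
      LinearMap.single (R n) (fun ν : D n (k + 1) => RMod ν) (κ.up hκ)
        (idMap (bSeq_up κ hκ).symm v) := by
  funext ν
  simp only [inc, LinearMap.pi_apply, LinearMap.single_apply]
  by_cases h : ν = κ.up hκ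
  · subst h
    have h0 : (0 : Fin n) ∈ (κ.up hκ).1 := mem_insert_self _ _
    rw [dif_pos h0, Pi.single_eq_same, LinearMap.comp_apply, LinearMap.proj_apply]
    have key : ∀ (η : D n k) (e : η = κ) (h1 : bSeq η = bSeq (κ.up hκ)),
        idMap h1 (Pi.single (M := fun κ : D n k => RMod κ) κ v η) =
          idMap (bSeq_up κ hκ).symm v := by
      rintro η rfl h1
      rw [Pi.single_eq_same]
    exact key _ (D.down_up κ hκ h0) _
  · rw [Pi.single_eq_of_ne h]
    split_ifs with h1
    · have : ν.down h1 ≠ κ := by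
        intro h2
        apply h
        rw [← D.up_down ν h1 (notMem_erase _ _)]
        subst h2; rfl
      rw [LinearMap.comp_apply, LinearMap.proj_apply, Pi.single_eq_of_ne this, map_zero]
    · rfl

lemma comp_Psi0 (φ : T n (k + 1)) (κ μ : D n k) (hκ : (0 : Fin n) ∉ κ.1) (hμ : (0 : Fin n) ∉ μ.1)
    {r : R n} (hr : comp φ (κ.up hκ) (μ.up hμ) = r • mon (κ.up hκ) (μ.up hμ)) :
    comp (Psi0 n k φ) κ μ = r • mon κ μ := by
  apply hom_ext
  have h1 : ∀ v, comp (Psi0 n k φ) κ μ v =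
      idMap (bSeq_up μ hμ) (comp φ (κ.up hκ) (μ.up hμ) (idMap (bSeq_up κ hκ).symm v)) := by
    intro v
    show proj n k (φ (inc n k (LinearMap.single (R n) (fun κ : D n k => RMod κ) κ v))) μ = _
    rw [inc_single κ hκ]
    simp only [proj, LinearMap.pi_apply]
    rw [dif_pos hμ]; rfl
  rw [h1, idMap_mk, hr, LinearMap.smul_apply, LinearMap.smul_apply, mon_mk, mon_mk,
    ← Submodule.Quotient.mk_smul, ← Submodule.Quotient.mk_smul, idMap_mk, bSeq_up, bSeq_up]

lemma Psi0_ker (φ : T n (k + 1)) (h : mkA n (k + 1) φ = 0) : mkA n k (Psi0 n k φ) = 0 := by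
  rw [mkA_eq_zero] at h ⊢
  intro κ μ
  by_cases h' : (0 : Fin n) ∉ κ.1 ∧ (0 : Fin n) ∉ μ.1
  · obtain ⟨q, hq, hq'⟩ := (mem_W _).1 (h (κ.up h'.1) (μ.up h'.2))
    rw [comp_Psi0 φ κ μ h'.1 h'.2 hq', mem_W]
    rw [vD_up, vD_up] at hq
    exact ⟨q, levIdeal_succ _ _ hq, rfl⟩
  · rw [comp_Psi0_of_not φ κ μ h']; exact zero_mem _

lemma vD_ge (ν : D n (k + 1)) (h : (0 : Fin n) ∉ ν.1) (t : Fin n) : k + 1 ≤ vD ν t + t.val := by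
  have h1 := card_filter_add_card_filter_not (s := ν.1) (fun s => t < s)
  have h2 : (ν.1.filter fun s => ¬ t < s).card ≤ (Finset.Ioc 0 t).card := by
    apply card_le_card
    intro s hs
    simp only [mem_filter, not_lt, mem_Ioc] at hs ⊢
    exact ⟨Fin.pos_iff_ne_zero.2 (fun h' : s = 0 => h (by rw [← h']; exact hs.1)), hs.2⟩
  rw [Fin.card_Ioc] at h2
  rw [ν.2] at h1
  simp only [vD]
  simp only [Fin.val_zero, Nat.sub_zero] at h2
  omega

lemma card_lt_of_zero_notMem {m : ℕ} [NeZero m] (s : Finset (Fin m)) (h : (0 : Fin m) ∉ s) :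
    s.card < m := by
  have := card_lt_card ((ssubset_univ_iff (s := s)).2 (fun h' => h (h' ▸ mem_univ _)))
  rwa [card_univ, Fintype.card_fin] at this

lemma Psi0_mul (φ ψ : T n (k + 1)) :
    mkA n k (Psi0 n k (φ * ψ)) = mkA n k (Psi0 n k φ) * mkA n k (Psi0 n k ψ) := by
  rw [← map_mul, ← sub_eq_zero, ← map_sub, mkA_eq_zero]
  intro κ μ
  choose r hr using fun κ μ => hom_gen (comp φ κ μ)
  choose s hs using fun κ μ => hom_gen (comp ψ κ μ)
  rw [sub_eq_add_neg, comp_add, comp_neg, ← sub_eq_add_neg, comp_mul (Psi0 n k φ)]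
  by_cases h' : (0 : Fin n) ∉ κ.1 ∧ (0 : Fin n) ∉ μ.1
  · obtain ⟨hκ, hμ⟩ := h'
    have h1 : comp (φ * ψ) (κ.up hκ) (μ.up hμ) =
        (∑ ν, r ν (μ.up hμ) * s (κ.up hκ) ν *
          xpow (gExp (vD κ) (vD ν) (vD μ))) • mon (κ.up hκ) (μ.up hμ) := by
      rw [comp_mul, sum_smul]
      refine sum_congr rfl fun ν _ => ?_
      rw [hr, hs, LinearMap.smul_comp, LinearMap.comp_smul, mon_comp, smul_smul, smul_smul,
        vD_up, vD_up]
    rw [comp_Psi0 _ κ μ hκ hμ h1, sum_smul,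
      ← sum_filter_add_sum_filter_not univ (fun ν : D n (k + 1) => (0 : Fin n) ∈ ν.1),
      add_sub_right_comm]
    refine add_mem ?_ (sum_mem fun ν hν => ?_)
    · have h2 : ∑ ν, comp (Psi0 n k φ) ν μ ∘ₗ comp (Psi0 n k ψ) κ ν =
          ∑ ν ∈ univ.filter (fun ν : D n k => (0 : Fin n) ∉ ν.1),
            comp (Psi0 n k φ) ν μ ∘ₗ comp (Psi0 n k ψ) κ ν := by
        symm
        apply sum_subset (filter_subset _ _)
        intro ν _ hν
        rw [comp_Psi0_of_not φ ν μ (fun h => hν (mem_filter.2 ⟨mem_univ _, h.1⟩)),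
          LinearMap.zero_comp]
      rw [h2, sub_eq_zero.2]
      · exact zero_mem _
      · refine sum_bij' (fun ν hν => ν.down (mem_filter.1 hν).2)
          (fun ν hν => ν.up (mem_filter.1 hν).2) ?_ ?_ ?_ ?_ ?_
        · intro ν _; exact mem_filter.2 ⟨mem_univ _, notMem_erase _ _⟩
        · intro ν _; exact mem_filter.2 ⟨mem_univ _, mem_insert_self _ _⟩
        · intro ν hν; exact D.up_down ν _ (notMem_erase _ _)
        · intro ν hν; exact D.down_up ν _ (mem_insert_self _ _)
        · intro ν hν
          have hν0 := (mem_filter.1 hν).2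
          have hd : (0 : Fin n) ∉ (ν.down hν0).1 := notMem_erase _ _
          have e1 : comp (Psi0 n k φ) (ν.down hν0) μ = r ν (μ.up hμ) • mon (ν.down hν0) μ :=
            comp_Psi0 φ _ μ hd hμ (by rw [D.up_down]; exact hr _ _)
          have e2 : comp (Psi0 n k ψ) κ (ν.down hν0) = s (κ.up hκ) ν • mon κ (ν.down hν0) :=
            comp_Psi0 ψ κ _ hκ hd (by rw [D.up_down]; exact hs _ _)
          have e3 : vD ν = vD (ν.down hν0) := by rw [← vD_up _ hd, D.up_down]
          rw [e1, e2, LinearMap.smul_comp, LinearMap.comp_smul, mon_comp, smul_smul, smul_smul, e3]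
    · have hν0 := (mem_filter.1 hν).2
      rw [mem_W]
      refine ⟨_, Ideal.mul_mem_left _ _ (gExp_mem _ _ _ ?_ (vD_ge ν hν0)), rfl⟩
      have := card_lt_of_zero_notMem ν.1 hν0
      rw [ν.2] at this; omega
  · rw [comp_Psi0_of_not _ κ μ h', sum_eq_zero, sub_zero]
    · exact zero_mem _
    · intro ν _
      rcases not_and_or.1 h' with h1 | h1
      · rw [comp_Psi0_of_not ψ κ ν (fun h => h1 h.1), LinearMap.comp_zero]
      · rw [comp_Psi0_of_not φ ν μ (fun h => h1 h.2), LinearMap.zero_comp]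

/-- The map `A_{n,k+1} → e^∨ A_{n,k} e^∨`, `a ↦ Ψ(e^∧ a e^∧)`, where `Ψ` is induced by the
identities `Hom(R_{b^λ}, R_{b^μ}) = Hom(R_{b^κ}, R_{b^η})`, `κ = λ^(∨)`, `η = μ^(∨)`. -/
noncomputable def Psi (n k : ℕ) [NeZero n] : A n (k + 1) →ₙ+* A n k :=
  liftMul (mkA n (k + 1)) (mkA_surjective n (k + 1))
    ((mkA n k : T n k →+ A n k).comp (Psi0 n k)) Psi0_ker Psi0_mul

lemma Psi_mk (φ : T n (k + 1)) : Psi n k (mkA n (k + 1) φ) = mkA n k (Psi0 n k φ) :=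
  liftMul_apply _ _ _ _ _ φ

end Psi

/-- `x ∪ {0}`. -/
def V.up {n k : ℕ} (x : V n k) (h : (0 : Fin (n + 1)) ∉ x.1) : V n (k + 1) :=
  ⟨insert 0 x.1, by rw [card_insert_of_notMem h, x.2]⟩

/-- `x ∖ {0}`. -/
def V.down {n k : ℕ} (x : V n (k + 1)) (h : (0 : Fin (n + 1)) ∈ x.1) : V n k :=
  ⟨x.1.erase 0, by rw [card_erase_of_mem h, x.2]; rfl⟩

lemma V.down_up {n k : ℕ} (x : V n k) (h : (0 : Fin (n + 1)) ∉ x.1)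
    (h' : (0 : Fin (n + 1)) ∈ (x.up h).1) : (x.up h).down h' = x := Subtype.ext (erase_insert h)

lemma V.up_down {n k : ℕ} (x : V n (k + 1)) (h : (0 : Fin (n + 1)) ∈ x.1)
    (h' : (0 : Fin (n + 1)) ∉ (x.down h).1) : (x.down h).up h' = x := Subtype.ext (insert_erase h)

lemma vV_up {n k : ℕ} (x : V n k) (h : (0 : Fin (n + 1)) ∉ x.1) : vV (x.up h) = vV x := by
  funext t
  simp only [vV, V.up, filter_insert]
  rw [if_neg (by simp)]

lemma vV_ge {n k : ℕ} (x : V n (k + 1)) (h : (0 : Fin (n + 1)) ∉ x.1) (t : Fin n) :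
    k + 1 ≤ vV x t + t.val := by
  have h1 := card_filter_add_card_filter_not (s := x.1) (fun s => t.val < s.val)
  have h2 : (x.1.filter fun s => ¬ t.val < s.val).card ≤ (Finset.Ioc 0 t.castSucc).card := by
    apply card_le_card
    intro s hs
    simp only [mem_filter, not_lt, mem_Ioc] at hs ⊢
    exact ⟨Fin.pos_iff_ne_zero.2 (fun h' : s = 0 => h (by rw [← h']; exact hs.1)), hs.2⟩
  rw [Fin.card_Ioc] at h2
  rw [x.2] at h1
  simp only [vV]
  simp only [Fin.val_zero, Nat.sub_zero, Fin.val_castSucc] at h2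
  omega

/-- `Ψ'` on representatives: `f_{x,y} ↦ f_{x ∖ 0, y ∖ 0}` if `0 ∈ x ∩ y`, and the other `f_{x,y}`
are dropped. -/
noncomputable def psiFun (n k : ℕ) (β : B0 n (k + 1)) : B0 n k := fun x y =>
  if h : (0 : Fin (n + 1)) ∉ x.1 ∧ (0 : Fin (n + 1)) ∉ y.1 then β (x.up h.1) (y.up h.2) else 0

lemma psiFun_pos {n k : ℕ} (β : B0 n (k + 1)) (x y : V n k) (hx : (0 : Fin (n + 1)) ∉ x.1)
    (hy : (0 : Fin (n + 1)) ∉ y.1) : psiFun n k β x y = β (x.up hx) (y.up hy) :=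
  dif_pos ⟨hx, hy⟩

lemma psiFun_neg {n k : ℕ} (β : B0 n (k + 1)) (x y : V n k)
    (h : ¬ ((0 : Fin (n + 1)) ∉ x.1 ∧ (0 : Fin (n + 1)) ∉ y.1)) : psiFun n k β x y = 0 :=
  dif_neg h

/-- `psiFun` as an additive map. -/
noncomputable def Psi0' (n k : ℕ) : B0 n (k + 1) →+ B0 n k where
  toFun := psiFun n k
  map_zero' := B0.ext fun x y => by
    by_cases h : (0 : Fin (n + 1)) ∉ x.1 ∧ (0 : Fin (n + 1)) ∉ y.1
    · rw [psiFun_pos _ x y h.1 h.2]; rfl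
    · rw [psiFun_neg _ x y h]; rfl
  map_add' β γ := B0.ext fun x y => by
    rw [B0.add_apply]
    by_cases h : (0 : Fin (n + 1)) ∉ x.1 ∧ (0 : Fin (n + 1)) ∉ y.1
    · rw [psiFun_pos _ x y h.1 h.2, psiFun_pos _ x y h.1 h.2, psiFun_pos _ x y h.1 h.2,
        B0.add_apply]
    · rw [psiFun_neg _ x y h, psiFun_neg _ x y h, psiFun_neg _ x y h, add_zero]

lemma Psi0'_pos {n k : ℕ} (β : B0 n (k + 1)) (x y : V n k) (hx : (0 : Fin (n + 1)) ∉ x.1)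
    (hy : (0 : Fin (n + 1)) ∉ y.1) : Psi0' n k β x y = β (x.up hx) (y.up hy) :=
  psiFun_pos β x y hx hy

lemma Psi0'_neg {n k : ℕ} (β : B0 n (k + 1)) (x y : V n k)
    (h : ¬ ((0 : Fin (n + 1)) ∉ x.1 ∧ (0 : Fin (n + 1)) ∉ y.1)) : Psi0' n k β x y = 0 :=
  psiFun_neg β x y h

lemma Psi0'_ker {n k : ℕ} (β : B0 n (k + 1)) (h : mkB n (k + 1) β = 0) :
    mkB n k (Psi0' n k β) = 0 := by
  rw [mkB_eq_zero, mem_relIdeal] at h ⊢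
  intro x y
  by_cases h' : (0 : Fin (n + 1)) ∉ x.1 ∧ (0 : Fin (n + 1)) ∉ y.1
  · rw [Psi0'_pos β x y h'.1 h'.2]
    have := h (x.up h'.1) (y.up h'.2)
    rw [vV_up, vV_up] at this
    exact levIdeal_succ _ _ this
  · rw [Psi0'_neg β x y h']; exact zero_mem _

lemma B0.sub_apply {n k : ℕ} (a b : B0 n k) (x y : V n k) : (a - b) x y = a x y - b x y := by
  rw [sub_eq_add_neg, B0.add_apply, B0.neg_apply, ← sub_eq_add_neg]

lemma Psi0'_mul {n k : ℕ} (β γ : B0 n (k + 1)) :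
    mkB n k (Psi0' n k (β * γ)) = mkB n k (Psi0' n k β) * mkB n k (Psi0' n k γ) := by
  rw [← map_mul, ← sub_eq_zero, ← map_sub, mkB_eq_zero, mem_relIdeal]
  intro x z
  rw [B0.sub_apply, B0.mul_apply (Psi0' n k β)]
  by_cases h' : (0 : Fin (n + 1)) ∉ x.1 ∧ (0 : Fin (n + 1)) ∉ z.1
  · obtain ⟨hx, hz⟩ := h'
    rw [Psi0'_pos _ x z hx hz, B0.mul_apply,
      ← sum_filter_add_sum_filter_not univ (fun y : V n (k + 1) => (0 : Fin (n + 1)) ∈ y.1),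
      add_sub_right_comm]
    refine add_mem ?_ (sum_mem fun y hy => ?_)
    · have h2 : ∑ y, xpow (gExp (vV x) (vV y) (vV z)) * Psi0' n k β x y * Psi0' n k γ y z =
          ∑ y ∈ univ.filter (fun y : V n k => (0 : Fin (n + 1)) ∉ y.1),
            xpow (gExp (vV x) (vV y) (vV z)) * Psi0' n k β x y * Psi0' n k γ y z := by
        symm
        apply sum_subset (filter_subset _ _)
        intro y _ hy
        rw [Psi0'_neg γ y z (fun h => hy (mem_filter.2 ⟨mem_univ _, h.1⟩)), mul_zero]
      rw [h2, sub_eq_zero.2]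
      · exact zero_mem _
      · refine sum_bij' (fun y hy => y.down (mem_filter.1 hy).2)
          (fun y hy => y.up (mem_filter.1 hy).2) ?_ ?_ ?_ ?_ ?_
        · intro y _; exact mem_filter.2 ⟨mem_univ _, notMem_erase _ _⟩
        · intro y _; exact mem_filter.2 ⟨mem_univ _, mem_insert_self _ _⟩
        · intro y hy; exact V.up_down y _ (notMem_erase _ _)
        · intro y hy; exact V.down_up y _ (mem_insert_self _ _)
        · intro y hy
          have hy0 := (mem_filter.1 hy).2
          have hd : (0 : Fin (n + 1)) ∉ (y.down hy0).1 := notMem_erase _ _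
          have e3 : vV y = vV (y.down hy0) := by rw [← vV_up _ hd, V.up_down]
          rw [Psi0'_pos β x _ hx hd, Psi0'_pos γ _ z hd hz, V.up_down, vV_up, vV_up, e3]
    · have hy0 := (mem_filter.1 hy).2
      refine Ideal.mul_mem_right _ _ (Ideal.mul_mem_right _ _ ?_)
      rw [vV_up, vV_up]
      refine gExp_mem _ _ _ ?_ (vV_ge y hy0)
      have := card_lt_of_zero_notMem y.1 hy0
      rw [y.2] at this; omega
  · rw [Psi0'_neg _ x z h', sum_eq_zero, sub_zero]
    · exact zero_mem _
    · intro y _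
      rcases not_and_or.1 h' with h1 | h1
      · rw [Psi0'_neg β x y (fun h => h1 h.1), mul_zero, zero_mul]
      · rw [Psi0'_neg γ y z (fun h => h1 h.2), mul_zero]

/-- `Ψ'` on all of `B(n,k+1)`. -/
noncomputable def PsiB (n k : ℕ) : B n (k + 1) →ₙ+* B n k :=
  liftMul (mkB n (k + 1)) (mkB_surjective n (k + 1))
    ((mkB n k : B0 n k →+ B n k).comp (Psi0' n k)) Psi0'_ker Psi0'_mul

lemma PsiB_mk {n k : ℕ} (β : B0 n (k + 1)) :
    PsiB n k (mkB n (k + 1) β) = mkB n k (Psi0' n k β) :=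
  liftMul_apply _ _ _ _ _ β

lemma idem_mul_idem {n k : ℕ} (P Q : V n k → Prop) [DecidablePred P] [DecidablePred Q]
    (h : ∀ x, Q x → P x) : (idem P * idem Q : B0 n k) = idem Q ∧ (idem Q * idem P : B0 n k) = idem Q := by
  constructor <;> apply B0.ext <;> intro x y
  · rw [idem_mul]; simp only [idem]; split_ifs <;> tauto
  · rw [mul_idem]; simp only [idem]
    by_cases h2 : x = y ∧ Q x
    · obtain ⟨rfl, h3⟩ := h2
      rw [if_pos (h _ h3)]
    · rw [if_neg h2, ite_self]

/-- The left I-states which do not contain `0`. -/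
def IsLeftVee {n k : ℕ} (x : V n k) : Prop := Fin.last n ∉ x.1 ∧ (0 : Fin (n + 1)) ∉ x.1

instance {n k : ℕ} : DecidablePred (IsLeftVee (n := n) (k := k)) := fun x =>
  inferInstanceAs (Decidable (Fin.last n ∉ x.1 ∧ (0 : Fin (n + 1)) ∉ x.1))

/-- The idempotent `e_k^∨ = ∑ I_x ∈ B_l(n,k)`, over the left I-states `x` which do not contain
`0`. -/
noncomputable def eVeeBl (n k : ℕ) : Bl n k :=
  Bl.mk (mkB n k (idem IsLeftVee))
    (by rw [eL, ← map_mul, (idem_mul_idem _ _ (fun _ h => h.1)).1])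
    (by rw [eL, ← map_mul, (idem_mul_idem _ _ (fun _ h => h.1)).2])

lemma eVeeBl_idem (n k : ℕ) : IsIdempotentElem (eVeeBl n k) :=
  Bl.val_injective (by rw [map_mul]; exact mkB_idem IsLeftVee)

lemma PsiB_eL {n k : ℕ} [NeZero n] : PsiB n k (eL n (k + 1)) = Bl.val (eVeeBl n k) := by
  show PsiB n k (mkB n (k + 1) (idem IsLeft)) = mkB n k (idem IsLeftVee)
  rw [PsiB_mk]
  congr 1
  apply B0.ext
  intro x y
  by_cases h' : (0 : Fin (n + 1)) ∉ x.1 ∧ (0 : Fin (n + 1)) ∉ y.1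
  · rw [Psi0'_pos _ x y h'.1 h'.2]
    have h1 : x.up h'.1 = y.up h'.2 ↔ x = y := by
      constructor
      · intro h
        have h2 := erase_insert h'.1
        rw [show insert 0 x.1 = insert 0 y.1 from congrArg Subtype.val h, erase_insert h'.2] at h2
        exact Subtype.ext h2.symm
      · rintro rfl; rfl
    have h2 : Fin.last n ≠ 0 := by
      intro h; exact NeZero.ne n (by simpa [Fin.ext_iff] using h)
    have h3 : IsLeft (x.up h'.1) ↔ IsLeftVee x := by
      simp only [IsLeft, IsLeftVee, V.up, mem_insert, h2, false_or, h'.1, not_false_iff, and_true]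
    simp only [idem, h1, h3]
  · rw [Psi0'_neg _ x y h']
    symm
    refine if_neg ?_
    rintro ⟨rfl, -, h⟩
    exact h' ⟨h, h⟩

/-- The map `B_l(n,k+1) → e^∨ B_l(n,k) e^∨`, `b ↦ Ψ'(e^∧ b e^∧)`, where `Ψ'` is
`ℤ[U₁, …, Uₙ]`-linear with `f_{x,y} ↦ f_{x ∖ 0, y ∖ 0}`. -/
noncomputable def Psi' (n k : ℕ) [NeZero n] : Bl n (k + 1) →ₙ+* Bl n k where
  toFun b := Bl.mk (PsiB n k (Bl.val b))
    (by
      rw [← Bl.eL_mul b, map_mul, PsiB_eL, ← mul_assoc, Bl.eL_mul])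
    (by
      rw [← Bl.mul_eL b, map_mul, PsiB_eL, mul_assoc, Bl.mul_eL])
  map_mul' b c := Bl.val_injective (by
    show PsiB n k (Bl.val (b * c)) = PsiB n k (Bl.val b) * PsiB n k (Bl.val c)
    rw [map_mul, map_mul])
  map_zero' := Bl.val_injective (by
    show PsiB n k (Bl.val 0) = Bl.val 0
    rw [map_zero, map_zero, map_zero])
  map_add' b c := Bl.val_injective (by
    show PsiB n k (Bl.val (b + c)) = PsiB n k (Bl.val b) + PsiB n k (Bl.val c)
    rw [map_add, map_add])

lemma Psi'_one (n k : ℕ) [NeZero n] : Psi' n k 1 = eVeeBl n k :=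
  Bl.val_injective (by rw [← PsiB_eL]; rfl)

/-! ### The idempotent `e^∨` of Sartori's algebra -/

/-- The projection of `⨁ R_{b^κ}` to the sum of the `R_{b^κ}` with `κ` starting with `∨`. -/
noncomputable def veeProj (n k : ℕ) [NeZero n] : T n k :=
  LinearMap.pi fun κ => if (0 : Fin n) ∉ κ.1 then LinearMap.proj κ else 0

/-- The idempotent `e_k^∨ = ∑ 1_κ ∈ A_{n,k}`, over the `κ` whose leftmost symbol is `∨`. -/
noncomputable def eVee (n k : ℕ) [NeZero n] : A n k := mkA n k (veeProj n k)

lemma veeProj_apply {n k : ℕ} [NeZero n] (v : ∀ κ : D n k, RMod κ) (κ : D n k) :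
    veeProj n k v κ = if (0 : Fin n) ∉ κ.1 then v κ else 0 := by
  simp only [veeProj, LinearMap.pi_apply]
  split_ifs <;> rfl

lemma Psi0_one (n k : ℕ) [NeZero n] : Psi0 n k 1 = veeProj n k := by
  refine LinearMap.ext fun v => funext fun κ => ?_
  rw [veeProj_apply]
  show proj n k (inc n k v) κ = _
  simp only [proj, LinearMap.pi_apply]
  by_cases h : (0 : Fin n) ∉ κ.1
  · rw [dif_pos h, if_pos h, LinearMap.comp_apply, LinearMap.proj_apply]
    simp only [inc, LinearMap.pi_apply]
    have h0 : (0 : Fin n) ∈ (κ.up h).1 := mem_insert_self _ _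
    rw [dif_pos h0, LinearMap.comp_apply, LinearMap.proj_apply]
    have key : ∀ (η : D n k) (e : η = κ) (h1 : bSeq η = bSeq (κ.up h)),
        idMap (bSeq_up κ h) (idMap h1 (v η)) = v κ := by
      rintro η rfl h1
      obtain ⟨p, hp⟩ := Submodule.Quotient.mk_surjective _ (v η)
      rw [← hp, idMap_mk, idMap_mk]
    exact key _ (D.down_up κ h h0) _
  · rw [dif_neg h, if_neg h]; rfl

lemma eVee_idem (n k : ℕ) [NeZero n] : IsIdempotentElem (eVee n k) := by
  unfold IsIdempotentElem eVee
  rw [← map_mul]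
  congr 1
  refine LinearMap.ext fun v => funext fun κ => ?_
  rw [Module.End.mul_apply, veeProj_apply, veeProj_apply]
  split_ifs <;> rfl

lemma Psi_one (n k : ℕ) [NeZero n] : Psi n k 1 = eVee n k := by
  rw [← map_one (mkA n (k + 1)), Psi_mk, Psi0_one]; rfl

/-! ### Left ideals generated by an idempotent, as bimodules -/

/-- The left ideal `S e`. -/
abbrev LeftIdeal {S : Type} [Ring S] (e : S) : Type := ↥(Ideal.span {e})

lemma LeftIdeal.mul_e {S : Type} [Ring S] {e : S} (he : IsIdempotentElem e) (p : LeftIdeal e) :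
    (p : S) * e = p := by
  obtain ⟨c, hc⟩ := Ideal.mem_span_singleton'.1 p.2
  rw [← hc, mul_assoc, he]

/-- The right action `p · c = p Ψ(c)` on a left ideal `S e`, for `Ψ : C → e S e` with
`Ψ(1) = e`. -/
@[reducible] def rightModule {S C : Type} [Ring S] [Ring C] {e : S} (he : IsIdempotentElem e)
    (Ψ : C →ₙ+* S) (h : Ψ 1 = e) : Module Cᵐᵒᵖ (LeftIdeal e) where
  smul c p := ⟨p * Ψ c.unop, by
    rw [← mul_one c.unop, map_mul, h, ← mul_assoc]
    exact Ideal.mul_mem_left _ _ (Ideal.subset_span rfl)⟩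
  one_smul p := Subtype.ext (by
    show (p : S) * Ψ 1 = p
    rw [h, LeftIdeal.mul_e he])
  mul_smul c d p := Subtype.ext (by
    show (p : S) * Ψ (d.unop * c.unop) = p * Ψ d.unop * Ψ c.unop
    rw [map_mul, mul_assoc])
  smul_zero c := Subtype.ext (by
    show (0 : S) * Ψ c.unop = 0
    rw [zero_mul])
  smul_add c p q := Subtype.ext (by
    show ((p : S) + q) * Ψ c.unop = p * Ψ c.unop + q * Ψ c.unop
    rw [add_mul])
  add_smul c d p := Subtype.ext (by
    show (p : S) * Ψ (c.unop + d.unop) = p * Ψ c.unop + p * Ψ d.unop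
    rw [map_add, mul_add])
  zero_smul p := Subtype.ext (by
    show (p : S) * Ψ 0 = 0
    rw [map_zero, mul_zero])

/-- Sartori's bimodule `F_k^S = A_{n,k} e_k^∨`. -/
def FS (n k : ℕ) [NeZero n] : Type := LeftIdeal (eVee n k)

section
variable (n k : ℕ) [NeZero n]

noncomputable instance : AddCommGroup (FS n k) :=
  inferInstanceAs (AddCommGroup (LeftIdeal (eVee n k)))

noncomputable instance : Module (A n k) (FS n k) :=
  inferInstanceAs (Module (A n k) (LeftIdeal (eVee n k)))

/-- The right action of `A_{n,k+1}`: `p · a = p Ψ(e^∧ a e^∧)`. -/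
noncomputable instance : Module (A n (k + 1))ᵐᵒᵖ (FS n k) :=
  rightModule (eVee_idem n k) (Psi n k) (Psi_one n k)

instance : SMulCommClass (A n k) (A n (k + 1))ᵐᵒᵖ (FS n k) where
  smul_comm a c p := Subtype.ext (by
    show a * ((Subtype.val p : A n k) * Psi n k c.unop) = a * (Subtype.val p) * Psi n k c.unop
    rw [mul_assoc])

/-- The right action of `B_l(n,k+1)` obtained by inflation along `Ξ`; it makes `F_k^S` the bimodule
`(F_k^S)_infl`. -/
noncomputable instance : Module (Bl n (k + 1))ᵐᵒᵖ (FS n k) :=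
  Module.compHom (FS n k) (RingHom.op (Xi n (k + 1)))

instance : SMulCommClass (A n k) (Bl n (k + 1))ᵐᵒᵖ (FS n k) where
  smul_comm a c p := smul_comm a (RingHom.op (Xi n (k + 1)) c) p

/-- The Ozsváth–Szabó bimodule `F_k^{OSz} = B_l(n,k) e_k^∨`. -/
def FOSz : Type := LeftIdeal (eVeeBl n k)

noncomputable instance : AddCommGroup (FOSz n k) :=
  inferInstanceAs (AddCommGroup (LeftIdeal (eVeeBl n k)))

noncomputable instance : Module (Bl n k) (FOSz n k) :=
  inferInstanceAs (Module (Bl n k) (LeftIdeal (eVeeBl n k)))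

/-- The right action of `B_l(n,k+1)`: `p · b = p Ψ'(e^∧ b e^∧)`. -/
noncomputable instance : Module (Bl n (k + 1))ᵐᵒᵖ (FOSz n k) :=
  rightModule (eVeeBl_idem n k) (Psi' n k) (Psi'_one n k)

instance : SMulCommClass (Bl n k) (Bl n (k + 1))ᵐᵒᵖ (FOSz n k) where
  smul_comm a c p := Subtype.ext (by
    show a * ((Subtype.val p : Bl n k) * Psi' n k c.unop) = a * (Subtype.val p) * Psi' n k c.unop
    rw [mul_assoc])

end

/-- `A_{n,k}` as a right module over `B_l(n,k)` through `Ξ`. -/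
noncomputable instance (n k : ℕ) : Module (Bl n k)ᵐᵒᵖ (A n k) :=
  Module.compHom (A n k) (RingHom.op (Xi n k))

instance (n k : ℕ) : SMulCommClass (A n k) (Bl n k)ᵐᵒᵖ (A n k) where
  smul_comm a c p := smul_comm a (RingHom.op (Xi n k) c) p

/-! ### Tensor products over noncommutative rings -/

section tensor
universe u v w
open TensorProduct MulOpposite

/-- The submodule generated by the relations `(m · c) ⊗ x = m ⊗ (c · x)`. -/
def btRel (S C : Type) [Ring S] [Ring C] (M : Type v) (N : Type u) [AddCommGroup M] [Module S M]
    [Module Cᵐᵒᵖ M] [AddCommGroup N] [Module C N] : Submodule S (M ⊗[ℤ] N) :=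
  Submodule.span S {t | ∃ (c : C) (m : M) (x : N), t = (op c • m) ⊗ₜ[ℤ] x - m ⊗ₜ[ℤ] (c • x)}

/-- The tensor product `M ⊗_C N` of an `(S, C)`-bimodule `M` and a left `C`-module `N`. -/
def BTensor (S C : Type) [Ring S] [Ring C] (M : Type v) (N : Type u) [AddCommGroup M]
    [Module S M] [Module Cᵐᵒᵖ M] [AddCommGroup N] [Module C N] : Type (max v u) :=
  (M ⊗[ℤ] N) ⧸ btRel S C M N

namespace BTensor
variable (S C : Type) [Ring S] [Ring C] (M : Type v) [AddCommGroup M] [Module S M] [Module Cᵐᵒᵖ M]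
  {N : Type u} [AddCommGroup N] [Module C N] {N' : Type w} [AddCommGroup N'] [Module C N']

noncomputable instance : AddCommGroup (BTensor S C M N) :=
  inferInstanceAs (AddCommGroup ((M ⊗[ℤ] N) ⧸ btRel S C M N))

/-- `s · (m ⊗ x) = (s · m) ⊗ x`. -/
noncomputable instance : Module S (BTensor S C M N) :=
  inferInstanceAs (Module S ((M ⊗[ℤ] N) ⧸ btRel S C M N))

/-- The element `m ⊗ x`. -/
def tmul {M : Type v} [AddCommGroup M] [Module S M] [Module Cᵐᵒᵖ M] (m : M) (x : N) :
    BTensor S C M N := Submodule.Quotient.mk (m ⊗ₜ[ℤ] x)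

lemma hom_ext {P : Type*} [AddCommGroup P] [Module S P] {f g : BTensor S C M N →ₗ[S] P}
    (h : ∀ m x, f (tmul S C m x) = g (tmul S C m x)) : f = g := by
  refine LinearMap.ext fun t => ?_
  obtain ⟨z, rfl⟩ := Submodule.Quotient.mk_surjective (btRel S C M N) t
  induction z using TensorProduct.induction_on with
  | zero => exact (map_zero f).trans (map_zero g).symm
  | tmul m x => exact h m x
  | add a b ha hb =>
    exact (map_add f _ _).trans ((congrArg₂ (· + ·) ha hb).trans (map_add g _ _).symm)

/-- The map `M ⊗_C N → M ⊗_C N'` induced by a map `N → N'` of `C`-modules. -/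
noncomputable def map (f : N →ₗ[C] N') : BTensor S C M N →ₗ[S] BTensor S C M N' :=
  Submodule.mapQ (btRel S C M N) (btRel S C M N')
    (AlgebraTensorModule.map (LinearMap.id : M →ₗ[S] M) f.toAddMonoidHom.toIntLinearMap) (by
      conv_lhs => rw [btRel]
      rw [Submodule.span_le]
      rintro _ ⟨c, m, x, rfl⟩
      refine Submodule.subset_span ⟨c, m, f x, ?_⟩
      rw [map_sub, AlgebraTensorModule.map_tmul, AlgebraTensorModule.map_tmul, ← map_smul f]
      rfl)

lemma map_tmul (f : N →ₗ[C] N') (m : M) (x : N) :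
    map S C M f (tmul S C m x) = tmul S C m (f x) := rfl

lemma map_id : map S C M (LinearMap.id : N →ₗ[C] N) = LinearMap.id := hom_ext S C M fun _ _ => rfl

lemma map_comp {N'' : Type*} [AddCommGroup N''] [Module C N''] (g : N' →ₗ[C] N'')
    (f : N →ₗ[C] N') : map S C M (g ∘ₗ f) = map S C M g ∘ₗ map S C M f :=
  hom_ext S C M fun _ _ => rfl

lemma tmul_add (m : M) (x y : N) : tmul S C m (x + y) = tmul S C m x + tmul S C m y :=
  congrArg (Submodule.Quotient.mk (p := btRel S C M N)) (TensorProduct.tmul_add m x y)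

lemma tmul_zero (m : M) : tmul S C m (0 : N) = 0 :=
  congrArg (Submodule.Quotient.mk (p := btRel S C M N)) (TensorProduct.tmul_zero _ m)

section right
variable {E : Type} [Ring E] [Module Eᵐᵒᵖ N] [SMulCommClass C Eᵐᵒᵖ N]

/-- Right multiplication by an element of `E` on a `(C, E)`-bimodule, as a `C`-linear map. -/
def rightMul (c : Eᵐᵒᵖ) : N →ₗ[C] N where
  toFun x := c • x
  map_add' := smul_add c
  map_smul' a x := (smul_comm a c x).symm

/-- The right action `(m ⊗ x) · c = m ⊗ (x · c)` on `M ⊗_C N` for a `(C, E)`-bimodule `N`. -/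
noncomputable instance : Module Eᵐᵒᵖ (BTensor S C M N) where
  smul c t := map S C M (rightMul C c) t
  one_smul t := LinearMap.congr_fun (f := map S C M (rightMul C (1 : Eᵐᵒᵖ))) (g := LinearMap.id)
    (hom_ext S C M fun m x => by
      rw [map_tmul]; exact congrArg _ (one_smul _ x)) t
  mul_smul c d t := LinearMap.congr_fun (f := map S C M (rightMul C (c * d)))
    (g := map S C M (rightMul C c) ∘ₗ map S C M (rightMul C d))
    (hom_ext S C M fun m x => congrArg (tmul S C m) (mul_smul c d x)) t
  smul_zero c := map_zero (map S C M (rightMul C c))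
  smul_add c := map_add (map S C M (rightMul C c))
  add_smul c d t := LinearMap.congr_fun (f := map S C M (rightMul C (c + d)))
    (g := map S C M (rightMul C c) + map S C M (rightMul C d))
    (hom_ext S C M fun m x => by
      rw [LinearMap.add_apply, map_tmul, map_tmul, map_tmul, ← tmul_add]
      exact congrArg _ (add_smul c d x)) t
  zero_smul t := LinearMap.congr_fun (f := map S C M (rightMul C (0 : Eᵐᵒᵖ))) (g := 0)
    (hom_ext S C M fun m x => by
      rw [map_tmul, LinearMap.zero_apply, ← tmul_zero S C M m]
      exact congrArg _ (zero_smul _ x)) t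

lemma op_smul_tmul (c : Eᵐᵒᵖ) (m : M) (x : N) : c • tmul S C m x = tmul S C m (c • x) := rfl

instance : SMulCommClass S Eᵐᵒᵖ (BTensor S C M N) where
  smul_comm s c t := (map_smul (map S C M (rightMul C c)) s t).symm

end right

/-- The grading of `M ⊗_C N` determined by gradings of `M` and `N`: degree `d` is spanned by the
`m ⊗ x` with `deg m + deg x = d`. -/
noncomputable def gr {M : Type v} [AddCommGroup M] [Module S M] [Module Cᵐᵒᵖ M] (𝓜 : ℤ → AddSubgroup M)
    (𝓝 : ℤ → AddSubgroup N) (d : ℤ) : AddSubgroup (BTensor S C M N) :=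
  AddSubgroup.closure {t | ∃ i j : ℤ, i + j = d ∧ ∃ m ∈ 𝓜 i, ∃ x ∈ 𝓝 j, t = tmul S C m x}

end BTensor

/-- The functor `M ⊗_C -` from left `C`-modules to left `S`-modules. -/
noncomputable def tensorFunctor (S C : Type) [Ring S] [Ring C] (M : Type) [AddCommGroup M]
    [Module S M] [Module Cᵐᵒᵖ M] : ModuleCat.{u} C ⥤ ModuleCat.{u} S where
  obj N := ModuleCat.of S (BTensor S C M N)
  map f := ModuleCat.ofHom (BTensor.map S C M f.hom)
  map_id N := by
    ext t
    exact LinearMap.congr_fun (BTensor.map_id S C M) t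
  map_comp f g := by
    ext t
    exact LinearMap.congr_fun (BTensor.map_comp S C M g.hom f.hom) t

end tensor

/-! ### Gradings -/

/-- The grading of `B(n,k)`: `deg f_{x,y} = ∑ |v_i^x - v_i^y|` and `deg U_i = 2`. -/
noncomputable def grB (n k : ℕ) (d : ℤ) : AddSubgroup (B n k) :=
  AddSubgroup.map (mkB n k : B0 n k →+ B n k)
    { carrier := {a | ∀ x y, ∀ m ∈ (a x y).support,
        2 * (m.degree : ℤ) + ∑ t, |(vV x t : ℤ) - vV y t| = d}
      zero_mem' := by
        intro x y m hm
        rw [B0.zero_apply, support_zero] at hm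
        exact absurd hm (notMem_empty m)
      add_mem' := by
        intro a b ha hb x y m hm
        rw [B0.add_apply] at hm
        rcases Finset.mem_union.1 (support_add hm) with h | h
        · exact ha x y m h
        · exact hb x y m h
      neg_mem' := by
        intro a ha x y m hm
        rw [B0.neg_apply, support_neg] at hm
        exact ha x y m hm }

/-- The grading of `B_l(n,k)`. -/
noncomputable def grBl (n k : ℕ) (d : ℤ) : AddSubgroup (Bl n k) :=
  AddSubgroup.comap (Bl.val : Bl n k →ₙ+* B n k).toAddMonoidHom (grB n k d)

/-- The grading of `F_k^{OSz} = B_l(n,k) e_k^∨`. -/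
noncomputable def grFOSz (n k : ℕ) (d : ℤ) : AddSubgroup (FOSz n k) :=
  AddSubgroup.comap (Submodule.subtype (Ideal.span {eVeeBl n k})).toAddMonoidHom (grBl n k d)

/-- The grading of `A_{n,k}`: the generator of `R_{b^κ}` is placed in degree `- ∑ b_i^κ` and
`deg x_i = 2`, so a map `R_{b^κ} → R_{b^μ}`, `1 ↦ p` is homogeneous of degree
`2 deg p + ∑ b_i^κ - ∑ b_i^μ`. -/
noncomputable def grA (n k : ℕ) (d : ℤ) : AddSubgroup (A n k) :=
  AddSubgroup.map (mkA n k : T n k →+ A n k)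
    { carrier := {φ | ∀ κ μ, ∃ p : R n, comp φ κ μ (Submodule.Quotient.mk 1) =
        Submodule.Quotient.mk p ∧ ∀ m ∈ p.support,
          2 * (m.degree : ℤ) + ∑ t, (bSeq κ t : ℤ) - ∑ t, (bSeq μ t : ℤ) = d}
      zero_mem' := by
        intro κ μ
        refine ⟨0, by rw [comp_zero]; rfl, fun m hm => ?_⟩
        rw [support_zero] at hm
        exact absurd hm (notMem_empty m)
      add_mem' := by
        intro a b ha hb κ μ
        obtain ⟨p, hp, hp'⟩ := ha κ μ
        obtain ⟨q, hq, hq'⟩ := hb κ μ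
        refine ⟨p + q, by rw [comp_add, LinearMap.add_apply, hp, hq]; rfl, fun m hm => ?_⟩
        rcases Finset.mem_union.1 (support_add hm) with h | h
        · exact hp' m h
        · exact hq' m h
      neg_mem' := by
        intro a ha κ μ
        obtain ⟨p, hp, hp'⟩ := ha κ μ
        refine ⟨-p, by rw [comp_neg, LinearMap.neg_apply, hp]; rfl, fun m hm => ?_⟩
        rw [support_neg] at hm
        exact hp' m hm }

/-- The grading of `F_k^S = A_{n,k} e_k^∨`. -/
noncomputable def grFS (n k : ℕ) [NeZero n] (d : ℤ) : AddSubgroup (FS n k) :=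
  AddSubgroup.comap (Submodule.subtype (Ideal.span {eVee n k})).toAddMonoidHom (grA n k d)

/-! ### The bimodule `_pr(F_k^{OSz})` and the functors -/

universe u

/-- The `(A_{n,k}, B_l(n,k+1))`-bimodule `_pr(F_k^{OSz}) = A_{n,k} ⊗_{B_l(n,k)} F_k^{OSz}`. -/
abbrev PrFOSz (n k : ℕ) [NeZero n] : Type := BTensor (A n k) (Bl n k) (A n k) (FOSz n k)

/-- The grading of `_pr(F_k^{OSz})`. -/
noncomputable def grPrFOSz (n k : ℕ) [NeZero n] (d : ℤ) : AddSubgroup (PrFOSz n k) :=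
  BTensor.gr (A n k) (Bl n k) (grA n k) (grFOSz n k) d

/-- The projection functor `A_{n,k} ⊗_{B_l(n,k)} -`. -/
noncomputable abbrev prFunctor (n k : ℕ) : ModuleCat.{u} (Bl n k) ⥤ ModuleCat.{u} (A n k) :=
  tensorFunctor (A n k) (Bl n k) (A n k)

/-- Sartori's functor `F_k^S ⊗ -`. -/
noncomputable abbrev sFunctor (n k : ℕ) [NeZero n] :
    ModuleCat.{u} (A n (k + 1)) ⥤ ModuleCat.{u} (A n k) :=
  tensorFunctor (A n k) (A n (k + 1)) (FS n k)

/-- The Ozsváth–Szabó functor `F_k^{OSz} ⊗ -`. -/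
noncomputable abbrev oszFunctor (n k : ℕ) [NeZero n] :
    ModuleCat.{u} (Bl n (k + 1)) ⥤ ModuleCat.{u} (Bl n k) :=
  tensorFunctor (Bl n k) (Bl n (k + 1)) (FOSz n k)

section
variable (n k : ℕ) [NeZero n] {M : Type u} [AddCommGroup M] [Module (Bl n (k + 1)) M]

/-- The grading of `F_k^S ⊗ (A_{n,k+1} ⊗ M)`, for a graded `B_l(n,k+1)`-module `M`. -/
noncomputable def grSPr (𝓜 : ℤ → AddSubgroup M) (d : ℤ) :
    AddSubgroup (BTensor (A n k) (A n (k + 1)) (FS n k)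
      (BTensor (A n (k + 1)) (Bl n (k + 1)) (A n (k + 1)) M)) :=
  BTensor.gr (A n k) (A n (k + 1)) (grFS n k)
    (BTensor.gr (A n (k + 1)) (Bl n (k + 1)) (grA n (k + 1)) 𝓜) d

/-- The grading of `A_{n,k} ⊗ (F_k^{OSz} ⊗ M)`, for a graded `B_l(n,k+1)`-module `M`. -/
noncomputable def grPrOSz (𝓜 : ℤ → AddSubgroup M) (d : ℤ) :
    AddSubgroup (BTensor (A n k) (Bl n k) (A n k)
      (BTensor (Bl n k) (Bl n (k + 1)) (FOSz n k) M)) :=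
  BTensor.gr (A n k) (Bl n k) (grA n k)
    (BTensor.gr (Bl n k) (Bl n (k + 1)) (grFOSz n k) 𝓜) d

end

end definitions

end OSzSartori

open CategoryTheory OSzSartori

universe u

namespace OSzSartori

section
open MvPolynomial Finset

/-! ### Compatibility of `Ξ` with the idempotents and with `Ψ`, `Ψ'` -/

/-! Everything rests on one commutative square: `Ξ ∘ Ψ' = Ψ ∘ Ξ`. It is visible on coefficients. By
`hom_gen` every map `R_{b^λ} → R_{b^μ}` is an `R`-multiple of the standard monomial map `mon`, so an
element of Sartori's algebra is represented, like an element of `B₀`, by a matrix of polynomials,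
and `Ξ` copies the entry at the pair of states `(st μ, st λ)`. Both `Ψ` and `Ψ'` pick out the
entries whose two labels have a leading `∧` (contain `0`) and remove that symbol from the labels.
The removal changes neither the `b`-sequences nor the weights `v`, so the monomial maps stay the
same. This gives `Xi0_Psi0'` on representatives and `Xi_Psi'` on the quotients. That the three maps
descend to the quotients comes from the definitions, where `mem_W` and `mem_relIdeal` describe the
relations of both algebras by the same ideals `levIdeal`. Evaluating the square at `1` gives
`Xi_eVeeBl`: `Ξ` sends `e^∨` to `e^∨`.

For the bimodules, write `A = A_{n,k}`, `B = B_l(n,k)` and `e = e_k^∨`. Then `A ⊗_B B e ≅ A Ξ(e) = A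
e^∨`, by `a ⊗ p ↦ a Ξ(p)` with inverse `q ↦ q ⊗ e`. The right actions agree because `a Ξ(p Ψ'(b)) =
a Ξ(p) Ψ(Ξ(b))`.

For the functors, the reason is the chain `F^S ⊗ (A_{n,k+1} ⊗ M) ≅ (F^S)_infl ⊗ M ≅ (A ⊗ F^{OSz}) ⊗
M ≅ A ⊗ (F^{OSz} ⊗ M)`. Instead of composing associativity isomorphisms, the composite and its
inverse are written down: `p ⊗ (a ⊗ m) ↦ p Ψ(a) ⊗ (e ⊗ m)` and `a ⊗ (p ⊗ m) ↦ a Ξ(p) ⊗ (1 ⊗ m)`.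
Their balancing conditions reduce to `Xi_Psi'` again, and neither formula involves the module
structure of `M`, so naturality is immediate.

For the gradings, products add degrees, `1` and `e` have degree `0`, and `Ξ` and `Ψ` preserve degree
(`grA_mul`, `one_mem_grA`, `eVeeBl_mem_grBl`, `Xi_mem_grA`, `Psi_mem_grA`). The essential point is
`|a - b| = 2 max(a - b, 0) + b - a`, used in `HomogHom.smul_mon`: it identifies the degree of
`f_{x,y}` with that of the monomial map. Each isomorphism and its inverse therefore preserve degree
on tensors of homogeneous elements, and these generate the graded pieces. -/

lemma st_up {n k : ℕ} [NeZero n] (κ : D n k) (h : (0 : Fin n) ∉ κ.1)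
    (h' : (0 : Fin (n + 1)) ∉ (st κ).1) : (st κ).up h' = st (κ.up h) := by
  refine Subtype.ext ?_
  show insert 0 (κ.1.map Fin.castSuccEmb) = (insert 0 κ.1).map Fin.castSuccEmb
  rw [map_insert]
  rfl

lemma zero_mem_st {n k : ℕ} [NeZero n] (κ : D n k) :
    (0 : Fin (n + 1)) ∈ (st κ).1 ↔ (0 : Fin n) ∈ κ.1 :=
  mem_map' Fin.castSuccEmb (a := (0 : Fin n))

lemma Xi_eq {n k : ℕ} (b : Bl n k) : Xi n k b = XiB n k (Bl.val b) := rfl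

/-- `Ξ ∘ Ψ' = Ψ ∘ Ξ` on representatives. -/
lemma Xi0_Psi0' {n k : ℕ} [NeZero n] (β : B0 n (k + 1)) :
    Xi0 (Psi0' n k β) = Psi0 n k (Xi0 β) := by
  apply T_ext
  intro κ μ
  rw [comp_Xi0]
  by_cases h : (0 : Fin n) ∉ κ.1 ∧ (0 : Fin n) ∉ μ.1
  · have hκ := mt (zero_mem_st κ).1 h.1
    have hμ := mt (zero_mem_st μ).1 h.2
    -- The arguments appear in the order `hμ`, `hκ` because `Ξ` reverses labels: the component `κ →
    -- μ` carries the coefficient of `f_{st μ, st κ}`.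
    rw [comp_Psi0 _ κ μ h.1 h.2 (comp_Xi0 _ _ _), Psi0'_pos β _ _ hμ hκ, st_up _ h.1, st_up _ h.2]
  · rw [comp_Psi0_of_not _ κ μ h, Psi0'_neg, zero_smul]
    rw [zero_mem_st, zero_mem_st]
    tauto

lemma Xi_Psi' {n k : ℕ} [NeZero n] (b : Bl n (k + 1)) :
    Xi n k (Psi' n k b) = Psi n k (Xi n (k + 1) b) := by
  obtain ⟨β, hβ⟩ := mkB_surjective n (k + 1) (Bl.val b)
  rw [Xi_eq, Xi_eq]
  -- All three maps of the corner rings are restrictions of maps defined on the whole of `B`, so any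
  -- representative `β` of `b` can be used, whether or not it is supported on left states.
  show XiB n k (PsiB n k (Bl.val b)) = _
  rw [← hβ, PsiB_mk, XiB_mk, XiB_mk, Psi_mk, Xi0_Psi0']

/-- Both idempotents are the values at `1` of `Ψ'` and `Ψ`, so the commutative square does the work
and no matrix has to be compared. -/
lemma Xi_eVeeBl (n k : ℕ) [NeZero n] : Xi n k (eVeeBl n k) = eVee n k := by
  rw [← Psi'_one, Xi_Psi', map_one, Psi_one]

/-! ### Homogeneous elements -/

/-- `p` has only monomials of degree `d`, where the variables have degree `2`. -/
def Homog {n : ℕ} (p : R n) (d : ℤ) : Prop := ∀ m ∈ p.support, 2 * (m.degree : ℤ) = d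

lemma Homog.zero {n : ℕ} (d : ℤ) : Homog (0 : R n) d := by
  intro m hm
  rw [support_zero] at hm
  exact absurd hm (notMem_empty m)

lemma Homog.one {n : ℕ} : Homog (1 : R n) 0 := by
  intro m hm
  rw [support_one, Finset.mem_singleton] at hm
  simp [hm]

lemma Homog.add {n : ℕ} {p q : R n} {d : ℤ} (hp : Homog p d) (hq : Homog q d) :
    Homog (p + q) d := by
  intro m hm
  rcases Finset.mem_union.1 (support_add hm) with h | h
  · exact hp m h
  · exact hq m h

lemma Homog.sum {n : ℕ} {ι : Type*} (s : Finset ι) {p : ι → R n} {d : ℤ}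
    (hp : ∀ i ∈ s, Homog (p i) d) : Homog (∑ i ∈ s, p i) d :=
  Finset.sum_induction p (fun q => Homog q d) (fun _ _ => Homog.add) (Homog.zero d) hp

lemma Homog.mul {n : ℕ} {p q : R n} {d e : ℤ} (hp : Homog p d) (hq : Homog q e) :
    Homog (p * q) (d + e) := by
  intro m hm
  -- A monomial of the product is a sum of exponents from the two supports, and the degree of an
  -- exponent is additive.
  obtain ⟨a, ha, b, hb, rfl⟩ := Finset.mem_add.1 (support_mul p q hm)
  rw [← hp a ha, ← hq b hb, map_add]
  push_cast
  ring

lemma Homog.X {n : ℕ} (t : Fin n) : Homog (X t : R n) 2 := by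
  intro m hm
  rw [support_X, Finset.mem_singleton] at hm
  simp [hm]

lemma Homog.pow {n : ℕ} {p : R n} {d : ℤ} (hp : Homog p d) (c : ℕ) : Homog (p ^ c) (c * d) := by
  induction c with
  | zero => simpa using Homog.one
  | succ c ih =>
    rw [pow_succ]
    convert ih.mul hp using 1
    push_cast
    ring

lemma Homog.prod {n : ℕ} {ι : Type*} (s : Finset ι) {p : ι → R n} {d : ι → ℤ}
    (hp : ∀ i ∈ s, Homog (p i) (d i)) : Homog (∏ i ∈ s, p i) (∑ i ∈ s, d i) := by
  classical
  induction s using Finset.induction_on with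
  | empty => simpa using Homog.one
  | insert a s ha ih =>
    rw [prod_insert ha, sum_insert ha]
    exact (hp a (mem_insert_self a s)).mul (ih fun i hi => hp i (mem_insert_of_mem hi))

lemma Homog.xpow {n : ℕ} (c : Fin n → ℕ) : Homog (xpow c : R n) (∑ t, (c t : ℤ) * 2) :=
  Homog.prod _ fun t _ => (Homog.X t).pow (c t)

/-! ### Homogeneous maps of cyclic modules, and the gradings in terms of them. -/

/-- A map `R_{b^κ} → R_{b^μ}` is homogeneous of degree `d`. -/
def HomogHom {n k : ℕ} {κ μ : D n k} (φ : RMod κ →ₗ[R n] RMod μ) (d : ℤ) : Prop :=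
  ∃ p : R n, φ (Submodule.Quotient.mk 1) = Submodule.Quotient.mk p ∧
    Homog p (d - ∑ t, (bSeq κ t : ℤ) + ∑ t, (bSeq μ t : ℤ))

/-- This unfolds the grading and moves the shift by the `b`-sequences to the other side of the
equation, so that the rules for `Homog` apply to the polynomial alone. -/
lemma mem_grA {n k : ℕ} {d : ℤ} {a : A n k} :
    a ∈ grA n k d ↔ ∃ φ : T n k, (∀ κ μ, HomogHom (comp φ κ μ) d) ∧ mkA n k φ = a := by
  refine exists_congr fun φ => and_congr_left fun _ => forall₂_congr fun κ μ =>
    exists_congr fun p => and_congr_right fun _ => forall₂_congr fun m _ => ?_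
  constructor <;> intro h <;> linarith

lemma mem_grB {n k : ℕ} {d : ℤ} {b : B n k} :
    b ∈ grB n k d ↔ ∃ β : B0 n k,
      (∀ x y, Homog (β x y) (d - ∑ t, |(vV x t : ℤ) - vV y t|)) ∧ mkB n k β = b := by
  refine exists_congr fun β => and_congr_left fun _ => forall₂_congr fun x y =>
    forall₂_congr fun m _ => ?_
  constructor <;> intro h <;> linarith

lemma HomogHom.zero {n k : ℕ} {κ μ : D n k} (d : ℤ) :
    HomogHom (0 : RMod κ →ₗ[R n] RMod μ) d := ⟨0, rfl, Homog.zero _⟩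

lemma HomogHom.sum {n k : ℕ} {κ μ : D n k} {ι : Type*} (s : Finset ι)
    {φ : ι → RMod κ →ₗ[R n] RMod μ} {d : ℤ} (h : ∀ i, HomogHom (φ i) d) :
    HomogHom (∑ i ∈ s, φ i) d := by
  choose p hp hp' using h
  -- The polynomials chosen for the summands are added; the quotient map by `bIdeal` is additive, so
  -- their sum represents the image of `1`.
  refine ⟨∑ i ∈ s, p i, ?_, Homog.sum _ fun i _ => hp' i⟩
  rw [LinearMap.sum_apply, sum_congr rfl fun i _ => hp i]
  exact (map_sum (bIdeal (bSeq μ)).mkQ p s).symm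

lemma HomogHom.comp {n k : ℕ} {κ ν μ : D n k} {φ : RMod ν →ₗ[R n] RMod μ}
    {ψ : RMod κ →ₗ[R n] RMod ν} {d e : ℤ} (hφ : HomogHom φ d) (hψ : HomogHom ψ e) :
    HomogHom (φ ∘ₗ ψ) (d + e) := by
  obtain ⟨p, hp, hp'⟩ := hφ
  obtain ⟨q, hq, hq'⟩ := hψ
  -- If `ψ(1) = q` and `φ(1) = p`, then `φ(ψ(1)) = q φ(1) = q p` by linearity. In the degree count
  -- the shift by `∑ b^ν` of the middle module cancels.
  refine ⟨q * p, ?_, ?_⟩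
  · have h : (Submodule.Quotient.mk q : RMod ν) = q • Submodule.Quotient.mk 1 := by
      rw [← Submodule.Quotient.mk_smul, smul_eq_mul, mul_one]
    rw [LinearMap.comp_apply, hq, h, map_smul, hp]
    rfl
  · convert hq'.mul hp' using 1
    ring

/-- This is where the two gradings meet: the Ozsváth–Szabó degree of an arrow is a sum of absolute
differences, while Sartori's degree is twice the exponent sum of the monomial plus a shift. A
coefficient of complementary degree therefore gives a map of degree `d`. -/
lemma HomogHom.smul_mon {n k : ℕ} {κ μ : D n k} {p : R n} {d : ℤ}
    (hp : Homog p (d - ∑ t, |(vD μ t : ℤ) - vD κ t|)) : HomogHom (p • mon κ μ) d := by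
  refine ⟨p * OSzSartori.xpow (fun t => bSeq μ t - bSeq κ t), ?_, ?_⟩
  · rw [LinearMap.smul_apply, mon_mk, mul_one]
    rfl
  · convert hp.mul (Homog.xpow _) using 1
    -- Termwise this is `|a - b| = 2 max(a - b, 0) + b - a`; the truncated subtraction in `ℕ` is the
    -- maximum, and the `+ 1` in `bSeq` drops out of differences.
    have h : ∑ t, |(vD μ t : ℤ) - vD κ t| =
        ∑ t, (((bSeq μ t - bSeq κ t : ℕ) : ℤ) * 2 + bSeq κ t - bSeq μ t) := by
      refine sum_congr rfl fun t _ => ?_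
      simp only [bSeq]
      rcases abs_cases ((vD μ t : ℤ) - vD κ t) with h | h <;> omega
    rw [h, sum_sub_distrib, sum_add_distrib]
    ring

/-! ### Degrees under multiplication, `Ξ` and `Ψ`. -/

lemma grA_mul {n k : ℕ} {d e : ℤ} {a b : A n k} (ha : a ∈ grA n k d) (hb : b ∈ grA n k e) :
    a * b ∈ grA n k (d + e) := by
  obtain ⟨φ, hφ, rfl⟩ := mem_grA.1 ha
  obtain ⟨ψ, hψ, rfl⟩ := mem_grA.1 hb
  refine mem_grA.2 ⟨φ * ψ, fun κ μ => ?_, map_mul _ _ _⟩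
  rw [comp_mul]
  exact HomogHom.sum _ fun ν => (hφ ν μ).comp (hψ κ ν)

lemma Xi_mem_grA {n k : ℕ} {d : ℤ} {b : Bl n k} (hb : b ∈ grBl n k d) :
    Xi n k b ∈ grA n k d := by
  obtain ⟨β, hβ, h⟩ := mem_grB.1 (show Bl.val b ∈ grB n k d from hb)
  refine mem_grA.2 ⟨Xi0 β, fun κ μ => ?_, by rw [← XiB_mk, h, Xi_eq]⟩
  rw [comp_Xi0]
  -- Every component of `Xi0 β` is an entry of `β` times `mon`, and the degree of the entry is
  -- complementary to that of the arrow, as `HomogHom.smul_mon` requires.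
  apply HomogHom.smul_mon
  rw [← vV_st, ← vV_st]
  exact hβ _ _

/-- The representative has entries `0` and `1` and is diagonal, and `f_{x,x}` has degree `0`. This
places both the unit of `B_l` and the generator `e^∨` in degree `0`. -/
lemma mkB_idem_mem_grB {n k : ℕ} (P : V n k → Prop) [DecidablePred P] :
    mkB n k (idem P) ∈ grB n k 0 := by
  refine mem_grB.2 ⟨idem P, fun x y => ?_, rfl⟩
  simp only [idem]
  split_ifs with h
  · obtain ⟨rfl, -⟩ := h
    simpa using Homog.one
  · exact Homog.zero _

lemma eVeeBl_mem_grBl (n k : ℕ) : eVeeBl n k ∈ grBl n k 0 := mkB_idem_mem_grB IsLeftVee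

lemma one_mem_grA (n k : ℕ) : (1 : A n k) ∈ grA n k 0 := by
  -- The unit is the image under `Ξ` of the idempotent of left states, so its degree is already
  -- known.
  rw [← map_one (Xi n k)]
  exact Xi_mem_grA (mkB_idem_mem_grB IsLeft)

/-- `Ψ` relabels components without changing the modules `R_b`. A component keeps its polynomial,
and the shift by the `b`-sequences stays the same as well. -/
lemma Psi_mem_grA {n k : ℕ} [NeZero n] {d : ℤ} {a : A n (k + 1)} (ha : a ∈ grA n (k + 1) d) :
    Psi n k a ∈ grA n k d := by
  obtain ⟨φ, hφ, rfl⟩ := mem_grA.1 ha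
  refine mem_grA.2 ⟨Psi0 n k φ, fun κ μ => ?_, (Psi_mk φ).symm⟩
  by_cases h : (0 : Fin n) ∉ κ.1 ∧ (0 : Fin n) ∉ μ.1
  · obtain ⟨p, hp, hp'⟩ := hφ (κ.up h.1) (μ.up h.2)
    -- The multiple `r` of `mon` serves only to make `comp_Psi0` applicable and need not be
    -- homogeneous; the homogeneous witness is still `p`.
    obtain ⟨r, hr⟩ := hom_gen (comp φ (κ.up h.1) (μ.up h.2))
    refine ⟨p, ?_, by rwa [bSeq_up, bSeq_up] at hp'⟩
    rw [hr, LinearMap.smul_apply, mon_mk, ← Submodule.Quotient.mk_smul] at hp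
    -- The equality `hp` lives in the module of `μ.up`. The identity map transports it to the module
    -- of `μ`, which is the quotient by the same ideal.
    have hp2 := congrArg (idMap (bSeq_up μ h.2)) hp
    rw [idMap_mk, idMap_mk, bSeq_up, bSeq_up] at hp2
    rw [comp_Psi0 φ κ μ h.1 h.2 hr, LinearMap.smul_apply, mon_mk, ← Submodule.Quotient.mk_smul]
    exact hp2
  · rw [comp_Psi0_of_not φ κ μ h]
    exact HomogHom.zero d

end

/-! ### Maps out of tensor products -/

namespace BTensor
open TensorProduct MulOpposite
variable {S C : Type} [Ring S] [Ring C] {M : Type*} [AddCommGroup M] [Module S M] [Module Cᵐᵒᵖ M]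
  {N : Type*} [AddCommGroup N] [Module C N] {P : Type*} [AddCommGroup P] [Module S P]

variable {Q : Type*} [AddCommGroup Q]

/-- Additive extensionality is needed besides the linear one: in an iterated tensor product the maps
in the inner variable are only additive, since source and target are modules over different rings.
-/
lemma addHom_ext {f g : BTensor S C M N →+ Q}
    (h : ∀ m x, f (tmul S C m x) = g (tmul S C m x)) : f = g := by
  refine AddMonoidHom.ext fun t => ?_
  obtain ⟨z, rfl⟩ := Submodule.Quotient.mk_surjective (btRel S C M N) t
  induction z using TensorProduct.induction_on with
  | zero => exact (map_zero f).trans (map_zero g).symm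
  | tmul m x => exact h m x
  | add a b ha hb =>
    exact (map_add f _ _).trans ((congrArg₂ (· + ·) ha hb).trans (map_add g _ _).symm)

section lift
variable [SMulCommClass S Cᵐᵒᵖ M]

/-- The additive map out of `M ⊗[ℤ] N` given by a biadditive map. -/
def liftInt (f : M →+ N →+ Q) : M ⊗[ℤ] N →+ Q :=
  TensorProduct.liftAddHom f fun r m x => by
    rw [map_zsmul, map_zsmul]
    rfl

lemma liftInt_tmul (f : M →+ N →+ Q) (m : M) (x : N) : liftInt f (m ⊗ₜ x) = f m x := rfl

lemma liftInt_eq_zero (f : M →+ N →+ Q)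
    (hf : ∀ (c : C) (m : M) (x : N), f (op c • m) x = f m (c • x)) {t : M ⊗[ℤ] N}
    (ht : t ∈ btRel S C M N) : liftInt f t = 0 := by
  -- The relations span an `S`-submodule, whereas the map is only additive. Quantifying over all
  -- scalars `s` makes the claim stable under the scalar step of the span induction.
  suffices h : ∀ s : S, liftInt f (s • t) = 0 by simpa using h 1
  refine Submodule.span_induction (p := fun t _ => ∀ s : S, liftInt f (s • t) = 0)
    ?_ ?_ ?_ ?_ ht
  · rintro _ ⟨c, m, x, rfl⟩ s
    -- The scalar enters the first factor and commutes with the right action, so `s` times a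
    -- relation for `m` is the relation for `s • m`, which `hf` kills.
    rw [smul_sub, TensorProduct.smul_tmul', TensorProduct.smul_tmul', map_sub, liftInt_tmul,
      liftInt_tmul, smul_comm, hf, sub_self]
  · intro s
    rw [smul_zero, map_zero]
  · intro a b _ _ ha hb s
    rw [smul_add, map_add, ha, hb, add_zero]
  · intro r a _ ha s
    rw [smul_smul, ha]

/-- The additive map out of `M ⊗_C N` given by a balanced biadditive map. -/
def addLift (f : M →+ N →+ Q)
    (hf : ∀ (c : C) (m : M) (x : N), f (op c • m) x = f m (c • x)) : BTensor S C M N →+ Q :=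
  QuotientAddGroup.lift (btRel S C M N).toAddSubgroup (liftInt f) fun _ ht =>
    liftInt_eq_zero f hf ht

/-- The map out of `M ⊗_C N` given by a balanced biadditive map that is `S`-linear in the first
variable. -/
def lift (f : M →+ N →+ P)
    (hf : ∀ (c : C) (m : M) (x : N), f (op c • m) x = f m (c • x))
    (hs : ∀ (s : S) (m : M) (x : N), f (s • m) x = s • f m x) : BTensor S C M N →ₗ[S] P where
  __ := addLift f hf
  -- Linearity is an equality of two additive maps, "act by `s`, then map" and "map, then act by
  -- `s`", and so it can be checked on pure tensors.
  map_smul' s t := DFunLike.congr_fun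
    (f := (addLift f hf).comp (DistribSMul.toAddMonoidHom (BTensor S C M N) s))
    (g := (DistribSMul.toAddMonoidHom P s).comp (addLift f hf)) (addHom_ext fun m x => hs s m x) t

end lift

/-! ### Rules for pure tensors and membership in graded pieces. -/

lemma add_tmul (m m' : M) (x : N) : tmul S C (m + m') x = tmul S C m x + tmul S C m' x :=
  congrArg (Submodule.Quotient.mk (p := btRel S C M N)) (TensorProduct.add_tmul m m' x)

lemma smul_tmul (s : S) (m : M) (x : N) : s • tmul S C m x = tmul S C (s • m) x := rfl

lemma op_smul_tmul' (c : C) (m : M) (x : N) : tmul S C (op c • m) x = tmul S C m (c • x) :=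
  (Submodule.Quotient.eq _).2 (Submodule.subset_span ⟨c, m, x, rfl⟩)

lemma tmul_mem_gr {𝓜 : ℤ → AddSubgroup M} {𝓝 : ℤ → AddSubgroup N} {i j : ℤ} {m : M} {x : N}
    (hm : m ∈ 𝓜 i) (hx : x ∈ 𝓝 j) : tmul S C m x ∈ gr S C 𝓜 𝓝 (i + j) :=
  AddSubgroup.subset_closure ⟨i, j, rfl, m, hm, x, hx, rfl⟩

/-- A graded piece is the subgroup generated by tensors of homogeneous elements, so it suffices to
test the preimage of `H` on these. Allowing any additive map lets the argument be applied a second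
time to the inner factor of an iterated tensor product. -/
lemma map_mem_of_mem_gr {𝓜 : ℤ → AddSubgroup M}
    {𝓝 : ℤ → AddSubgroup N} {d : ℤ} {t : BTensor S C M N} (ht : t ∈ gr S C 𝓜 𝓝 d)
    (f : BTensor S C M N →+ Q) (H : AddSubgroup Q)
    (h : ∀ i j, i + j = d → ∀ m ∈ 𝓜 i, ∀ x ∈ 𝓝 j, f (tmul S C m x) ∈ H) : f t ∈ H := by
  have : gr S C 𝓜 𝓝 d ≤ H.comap f := by
    refine (AddSubgroup.closure_le _).2 ?_
    rintro _ ⟨i, j, hij, m, hm, x, hx, rfl⟩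
    exact h i j hij m hm x hx
  exact this ht

end BTensor
/-! ### The bimodules `F_k^S` and `F_k^{OSz}` -/

section
open MulOpposite BTensor
variable {n k : ℕ}

/-- The inclusion of `F_k^{OSz}` in `B_l(n,k)`. -/
noncomputable def FOSz.val : FOSz n k →ₗ[Bl n k] Bl n k :=
  Submodule.subtype (Ideal.span {eVeeBl n k})

lemma FOSz.val_injective : Function.Injective (FOSz.val (n := n) (k := k)) :=
  Subtype.val_injective

lemma FOSz.val_mul_eVeeBl (p : FOSz n k) : FOSz.val p * eVeeBl n k = FOSz.val p :=
  LeftIdeal.mul_e (eVeeBl_idem n k) p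

variable [NeZero n]

/-- The inclusion of `F_k^S` in `A_{n,k}`. -/
noncomputable def FS.val : FS n k →ₗ[A n k] A n k := Submodule.subtype (Ideal.span {eVee n k})

lemma FS.val_injective : Function.Injective (FS.val (n := n) (k := k)) := Subtype.val_injective

lemma FS.val_mul_eVee (p : FS n k) : FS.val p * eVee n k = FS.val p :=
  LeftIdeal.mul_e (eVee_idem n k) p

lemma FS.val_op_smul (a : A n (k + 1)) (p : FS n k) :
    FS.val (op a • p) = FS.val p * Psi n k a := rfl

lemma FS.val_op_smul_Bl (b : Bl n (k + 1)) (p : FS n k) :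
    FS.val (op b • p) = FS.val p * Psi n k (Xi n (k + 1) b) := rfl

lemma FOSz.val_op_smul (b : Bl n (k + 1)) (p : FOSz n k) :
    FOSz.val (op b • p) = FOSz.val p * Psi' n k b := rfl

lemma A.op_smul_Bl {n k : ℕ} (b : Bl n k) (a : A n k) : op b • a = a * Xi n k b := rfl

/-- The map `a ↦ a e_k^∨`. -/
noncomputable def FS.mk : A n k →ₗ[A n k] FS n k :=
  LinearMap.toSpanSingleton (A n k) (FS n k) ⟨eVee n k, Ideal.subset_span rfl⟩

lemma FS.val_mk (a : A n k) : FS.val (FS.mk a) = a * eVee n k := rfl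

lemma FS.mk_val (p : FS n k) : FS.mk (FS.val p) = p := FS.val_injective (FS.val_mul_eVee p)

/-- The generator `e_k^∨` of `F_k^{OSz}`. -/
noncomputable def FOSz.gen (n k : ℕ) [NeZero n] : FOSz n k := ⟨eVeeBl n k, Ideal.subset_span rfl⟩

lemma FOSz.val_gen : FOSz.val (FOSz.gen n k) = eVeeBl n k := rfl

/-- An element of the left ideal of an idempotent is fixed by it on the right. So `F_k^{OSz}` is
cyclic on `e^∨`, which allows a tensor `a ⊗ p` to be rewritten as `a Ξ(p) ⊗ e^∨`. -/
lemma FOSz.smul_gen (p : FOSz n k) : FOSz.val p • FOSz.gen n k = p :=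
  FOSz.val_injective (FOSz.val_mul_eVeeBl p)

lemma FOSz.gen_mem : FOSz.gen n k ∈ grFOSz n k 0 := eVeeBl_mem_grBl n k

lemma mem_grFS {d : ℤ} {p : FS n k} : p ∈ grFS n k d ↔ FS.val p ∈ grA n k d := Iff.rfl

/-- `Ψ` is multiplicative and `Ψ(1) = e^∨`, so its values absorb this idempotent. -/
lemma Psi_mul_eVee (a : A n (k + 1)) : Psi n k a * eVee n k = Psi n k a := by
  rw [← Psi_one, ← map_mul, mul_one]

lemma eVeeBl_mul_Psi' (b : Bl n (k + 1)) : eVeeBl n k * Psi' n k b = Psi' n k b := by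
  rw [← Psi'_one, ← map_mul, one_mul]

/-- Both sides have underlying element `Ψ'(b)`. On the generator the right action of `B_l(n,k+1)`
can thus be exchanged for a left action of `B_l(n,k)`, which is how scalars travel through the
iterated tensor product. -/
lemma FOSz.op_smul_gen (b : Bl n (k + 1)) :
    op b • FOSz.gen n k = Psi' n k b • FOSz.gen n k := by
  apply FOSz.val_injective
  rw [FOSz.val_op_smul, map_smul, FOSz.val_gen, smul_eq_mul, eVeeBl_mul_Psi', ← Psi'_one,
    ← map_mul, mul_one]

lemma Xi_val_mul_eVee (p : FOSz n k) : Xi n k (FOSz.val p) * eVee n k = Xi n k (FOSz.val p) := by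
  rw [← Xi_eVeeBl, ← map_mul, FOSz.val_mul_eVeeBl]

/-! ### The isomorphism of bimodules -/

/-- `a ⊗ p ↦ a Ξ(p)`. -/
noncomputable def prToFS (n k : ℕ) [NeZero n] : PrFOSz n k →ₗ[A n k] FS n k :=
  lift
    -- Since `Ξ(p)` already lies in `A e^∨`, the right multiplication by `e^∨` inside `FS.mk`
    -- changes nothing; it only provides a linear way to land in `F_k^S`.
    (AddMonoidHom.mk' (fun a => AddMonoidHom.mk' (fun p => FS.mk (a * Xi n k (FOSz.val p)))
      fun p q => by rw [map_add, map_add, mul_add, map_add])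
      fun a b => AddMonoidHom.ext fun p => by
        show FS.mk ((a + b) * _) = FS.mk (a * _) + FS.mk (b * _)
        rw [add_mul, map_add])
    (fun c a p => by
      show FS.mk (op c • a * _) = FS.mk (a * Xi n k (FOSz.val (c • p)))
      rw [A.op_smul_Bl, map_smul FOSz.val, smul_eq_mul, map_mul (Xi n k), mul_assoc])
    (fun s a p => by
      show FS.mk (s * a * _) = s • FS.mk (a * _)
      rw [mul_assoc, ← smul_eq_mul s, map_smul])

lemma val_prToFS_tmul (a : A n k) (p : FOSz n k) :
    FS.val (prToFS n k (tmul _ _ a p)) = a * Xi n k (FOSz.val p) := by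
  show FS.val (FS.mk _) = _
  rw [FS.val_mk, mul_assoc, Xi_val_mul_eVee]

/-- `q ↦ q ⊗ e_k^∨`. -/
noncomputable def fsToPr (n k : ℕ) [NeZero n] : FS n k →ₗ[A n k] PrFOSz n k where
  toFun q := tmul _ _ (FS.val q) (FOSz.gen n k)
  map_add' p q := by rw [map_add, add_tmul]
  map_smul' a q := by rw [map_smul]; rfl

/-- The isomorphism `_pr(F_k^{OSz}) ≅ (F_k^S)_infl`. -/
noncomputable def prEquivFS (n k : ℕ) [NeZero n] : PrFOSz n k ≃ₗ[A n k] FS n k :=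
  LinearEquiv.ofLinearMap (prToFS n k) (fsToPr n k)
    -- `q ↦ q ⊗ e^∨ ↦ q Ξ(e^∨) = q e^∨ = q`.
    (LinearMap.ext fun q => FS.val_injective (by
      show FS.val (prToFS n k (tmul _ _ (FS.val q) (FOSz.gen n k))) = FS.val q
      rw [val_prToFS_tmul, FOSz.val_gen, Xi_eVeeBl, FS.val_mul_eVee]))
    -- `a ⊗ p ↦ a Ξ(p) ⊗ e^∨ = a ⊗ p e^∨ = a ⊗ p`.
    (BTensor.hom_ext _ _ _ fun a p => by
      show tmul _ _ (FS.val (prToFS n k (tmul _ _ a p))) (FOSz.gen n k) = tmul _ _ a p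
      rw [val_prToFS_tmul, ← A.op_smul_Bl, op_smul_tmul', FOSz.smul_gen])

/-! ### Right action and degrees under the bimodule isomorphism. -/

lemma prToFS_op_smul (b : Bl n (k + 1)) (t : PrFOSz n k) :
    prToFS n k (op b • t) = op b • prToFS n k t := by
  -- The right action on the tensor product is by definition induced by right multiplication on the
  -- second factor, so the claim is an equality of two `A_{n,k}`-linear maps. On pure tensors it is
  -- `Ξ ∘ Ψ' = Ψ ∘ Ξ`.
  have h : (prToFS n k) ∘ₗ BTensor.map _ _ _ (rightMul (Bl n k) (op b)) =
      (rightMul (A n k) (op b)) ∘ₗ prToFS n k :=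
    BTensor.hom_ext _ _ _ fun a p => FS.val_injective (by
      show FS.val (prToFS n k (tmul _ _ a (op b • p))) = FS.val (op b • prToFS n k (tmul _ _ a p))
      rw [FS.val_op_smul_Bl, val_prToFS_tmul, val_prToFS_tmul, FOSz.val_op_smul, map_mul, Xi_Psi',
        mul_assoc])
  exact LinearMap.congr_fun h t

lemma prToFS_mem_grFS {d : ℤ} {t : PrFOSz n k} (ht : t ∈ grPrFOSz n k d) :
    prToFS n k t ∈ grFS n k d := by
  refine map_mem_of_mem_gr ht (prToFS n k).toAddMonoidHom _ ?_
  rintro i j rfl a ha p hp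
  show FS.val (prToFS n k (tmul _ _ a p)) ∈ grA n k (i + j)
  rw [val_prToFS_tmul]
  exact grA_mul ha (Xi_mem_grA hp)

lemma fsToPr_mem_gr {d : ℤ} {q : FS n k} (hq : q ∈ grFS n k d) :
    fsToPr n k q ∈ grPrFOSz n k d := by
  -- The second tensor factor is the generator `e^∨` of degree `0`, so tensoring with it does not
  -- shift the degree.
  have := tmul_mem_gr (S := A n k) (C := Bl n k) (mem_grFS.1 hq)
    (FOSz.gen_mem (n := n) (k := k))
  rwa [add_zero] at this

/-! ### The isomorphism of functors -/

variable {M : Type u} [AddCommGroup M] [Module (Bl n (k + 1)) M]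

variable (n k M) in
/-- `F_k^S ⊗ (A_{n,k+1} ⊗ M)`. -/
abbrev SPr : Type u :=
  BTensor (A n k) (A n (k + 1)) (FS n k) (BTensor (A n (k + 1)) (Bl n (k + 1)) (A n (k + 1)) M)

variable (n k M) in
/-- `A_{n,k} ⊗ (F_k^{OSz} ⊗ M)`. -/
abbrev PrOSz : Type u :=
  BTensor (A n k) (Bl n k) (A n k) (BTensor (Bl n k) (Bl n (k + 1)) (FOSz n k) M)

/-- `a ⊗ m ↦ p Ψ(a) ⊗ (e_k^∨ ⊗ m)`. -/
noncomputable def sToOSzAux (p : FS n k) :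
    BTensor (A n (k + 1)) (Bl n (k + 1)) (A n (k + 1)) M →+ PrOSz n k M :=
  addLift
    (AddMonoidHom.mk' (fun a => AddMonoidHom.mk'
        (fun m => tmul _ _ (FS.val p * Psi n k a) (tmul _ _ (FOSz.gen n k) m))
        fun m m' => by rw [BTensor.tmul_add, BTensor.tmul_add])
      fun a b => AddMonoidHom.ext fun m => by
        show tmul _ _ (_ * Psi n k (a + b)) _ = tmul _ _ _ _ + tmul _ _ _ _
        rw [map_add, mul_add, add_tmul])
    -- Balancing over `B_l(n,k+1)`: `Ψ(a Ξ(c)) = Ψ(a) Ξ(Ψ'(c))`, the factor `Ψ'(c)` crosses the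
    -- outer tensor sign, `Ψ'(c) e^∨ = e^∨ · c`, and then `c` crosses the inner one.
    (fun c a m => by
      show tmul _ _ (FS.val p * Psi n k (a * Xi n (k + 1) c)) _ =
        tmul _ _ (FS.val p * Psi n k a) (tmul _ _ (FOSz.gen n k) (c • m))
      rw [map_mul, ← Xi_Psi', ← mul_assoc, ← A.op_smul_Bl, op_smul_tmul',
        ← op_smul_tmul' c (FOSz.gen n k), FOSz.op_smul_gen, BTensor.smul_tmul])

lemma sToOSzAux_tmul (p : FS n k) (a : A n (k + 1)) (m : M) :
    sToOSzAux p (tmul _ _ a m) =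
      (tmul _ _ (FS.val p * Psi n k a) (tmul _ _ (FOSz.gen n k) m) : PrOSz n k M) := rfl

variable (n k M) in
/-- `p ⊗ (a ⊗ m) ↦ p Ψ(a) ⊗ (e_k^∨ ⊗ m)`. -/
noncomputable def sToOSz : SPr n k M →ₗ[A n k] PrOSz n k M :=
  lift
    (AddMonoidHom.mk' sToOSzAux fun p q => addHom_ext fun a m => by
      rw [AddMonoidHom.add_apply, sToOSzAux_tmul, sToOSzAux_tmul, sToOSzAux_tmul, map_add,
        add_mul, add_tmul])
    -- Balancing over `A_{n,k+1}` is the multiplicativity of `Ψ`: `p Ψ(c) Ψ(a) = p Ψ(c a)`.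
    (fun c p x => DFunLike.congr_fun (f := sToOSzAux (op c • p))
      (g := (sToOSzAux p).comp (DistribSMul.toAddMonoidHom _ c)) (addHom_ext fun a m => by
        show sToOSzAux _ _ = sToOSzAux p (tmul _ _ (c * a) m)
        rw [sToOSzAux_tmul, sToOSzAux_tmul, FS.val_op_smul, map_mul, mul_assoc]) x)
    (fun s p x => DFunLike.congr_fun (f := sToOSzAux (s • p))
      (g := (DistribSMul.toAddMonoidHom _ s).comp (sToOSzAux p)) (addHom_ext fun a m => by
        show sToOSzAux _ _ = s • sToOSzAux p (tmul _ _ a m)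
        rw [sToOSzAux_tmul, sToOSzAux_tmul, map_smul, smul_eq_mul, BTensor.smul_tmul, smul_eq_mul,
          mul_assoc]) x)

lemma sToOSz_tmul (p : FS n k) (a : A n (k + 1)) (m : M) :
    sToOSz n k M (tmul _ _ p (tmul _ _ a m)) =
      tmul _ _ (FS.val p * Psi n k a) (tmul _ _ (FOSz.gen n k) m) := rfl

/-- `p ⊗ m ↦ a Ξ(p) ⊗ (1 ⊗ m)`. -/
noncomputable def oszToSAux (a : A n k) :
    BTensor (Bl n k) (Bl n (k + 1)) (FOSz n k) M →+ SPr n k M :=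
  addLift
    (AddMonoidHom.mk' (fun p => AddMonoidHom.mk'
        (fun m => tmul _ _ (FS.mk (a * Xi n k (FOSz.val p))) (tmul _ _ 1 m))
        fun m m' => by rw [BTensor.tmul_add, BTensor.tmul_add])
      fun p q => AddMonoidHom.ext fun m => by
        show tmul _ _ (FS.mk (_ * Xi n k (FOSz.val (p + q)))) _ = tmul _ _ _ _ + tmul _ _ _ _
        rw [map_add, map_add, mul_add, map_add, add_tmul])
    (fun c p m => by
      show tmul _ _ (FS.mk (a * Xi n k (FOSz.val p * Psi' n k c))) _ =
        tmul _ _ _ (tmul _ _ 1 (c • m))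
      -- Since `1 ⊗ c m = Ξ(c) ⊗ m = Ξ(c) (1 ⊗ m)`, the scalar can be moved on to the factor
      -- `F_k^S`, where it acts through `Ψ`.
      have h : tmul (A n (k + 1)) (Bl n (k + 1)) (1 : A n (k + 1)) (c • m) =
          Xi n (k + 1) c • tmul _ _ 1 m := by
        rw [← op_smul_tmul', A.op_smul_Bl, one_mul, BTensor.smul_tmul, smul_eq_mul, mul_one]
      rw [h, ← op_smul_tmul']
      congr 1
      apply FS.val_injective
      -- Both sides become `a Ξ(p) Ψ(Ξ(c))`: the idempotent is absorbed by `Ψ(Ξ(c))` on one side and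
      -- by `Ξ(p)` on the other.
      rw [FS.val_op_smul, FS.val_mk, FS.val_mk, map_mul, Xi_Psi', mul_assoc, mul_assoc, mul_assoc,
        Psi_mul_eVee, mul_assoc, ← mul_assoc _ (eVee n k), Xi_val_mul_eVee])

lemma oszToSAux_tmul (a : A n k) (p : FOSz n k) (m : M) :
    oszToSAux a (tmul _ _ p m) =
      (tmul _ _ (FS.mk (a * Xi n k (FOSz.val p))) (tmul _ _ 1 m) : SPr n k M) := rfl

variable (n k M) in
/-- `a ⊗ (p ⊗ m) ↦ a Ξ(p) ⊗ (1 ⊗ m)`. -/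
noncomputable def oszToS : PrOSz n k M →ₗ[A n k] SPr n k M :=
  lift
    (AddMonoidHom.mk' oszToSAux fun a b => addHom_ext fun p m => by
      rw [AddMonoidHom.add_apply, oszToSAux_tmul, oszToSAux_tmul, oszToSAux_tmul, add_mul,
        map_add, add_tmul])
    (fun c a x => DFunLike.congr_fun (f := oszToSAux (op c • a))
      (g := (oszToSAux a).comp (DistribSMul.toAddMonoidHom _ c)) (addHom_ext fun p m => by
        show oszToSAux _ _ = oszToSAux a (tmul _ _ (c • p) m)
        rw [oszToSAux_tmul, oszToSAux_tmul, A.op_smul_Bl, map_smul FOSz.val, smul_eq_mul, map_mul (Xi n k),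
          mul_assoc]) x)
    (fun s a x => DFunLike.congr_fun (f := oszToSAux (s • a))
      (g := (DistribSMul.toAddMonoidHom _ s).comp (oszToSAux a)) (addHom_ext fun p m => by
        show oszToSAux _ _ = s • oszToSAux a (tmul _ _ p m)
        rw [oszToSAux_tmul, oszToSAux_tmul, BTensor.smul_tmul, ← map_smul, smul_eq_mul,
          smul_eq_mul, mul_assoc]) x)

lemma oszToS_tmul (a : A n k) (p : FOSz n k) (m : M) :
    oszToS n k M (tmul _ _ a (tmul _ _ p m)) =
      tmul _ _ (FS.mk (a * Xi n k (FOSz.val p))) (tmul _ _ 1 m) := rfl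

lemma oszToS_sToOSz (t : SPr n k M) : oszToS n k M (sToOSz n k M t) = t := by
  refine LinearMap.congr_fun (f := oszToS n k M ∘ₗ sToOSz n k M) (g := LinearMap.id)
    (BTensor.hom_ext _ _ _ fun p x => ?_) t
  -- The outer extensionality leaves an arbitrary element `x` of the inner tensor product. Both
  -- sides are additive in `x`, so it may be taken to be a pure tensor too.
  refine DFunLike.congr_fun
    (f := (oszToS n k M).toAddMonoidHom.comp (sToOSzAux p))
    (g := AddMonoidHom.mk' (fun x => (tmul _ _ p x : SPr n k M)) (BTensor.tmul_add _ _ _ p))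
    (addHom_ext fun a m => ?_) x
  show oszToS n k M (sToOSz n k M (tmul _ _ p (tmul _ _ a m))) = tmul _ _ p (tmul _ _ a m)
  -- `p ⊗ (a ⊗ m)` returns as `p Ψ(a) ⊗ (1 ⊗ m)`, that is `p · a ⊗ (1 ⊗ m)`, and `a` moves across
  -- the outer tensor sign.
  rw [sToOSz_tmul, oszToS_tmul, FOSz.val_gen, Xi_eVeeBl, mul_assoc, Psi_mul_eVee,
    ← FS.val_op_smul, FS.mk_val, op_smul_tmul', BTensor.smul_tmul, smul_eq_mul, mul_one]

lemma sToOSz_oszToS (t : PrOSz n k M) : sToOSz n k M (oszToS n k M t) = t := by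
  refine LinearMap.congr_fun (f := sToOSz n k M ∘ₗ oszToS n k M) (g := LinearMap.id)
    (BTensor.hom_ext _ _ _ fun a x => ?_) t
  refine DFunLike.congr_fun
    (f := (sToOSz n k M).toAddMonoidHom.comp (oszToSAux a))
    (g := AddMonoidHom.mk' (fun x => (tmul _ _ a x : PrOSz n k M)) (BTensor.tmul_add _ _ _ a))
    (addHom_ext fun p m => ?_) x
  show sToOSz n k M (oszToS n k M (tmul _ _ a (tmul _ _ p m))) = tmul _ _ a (tmul _ _ p m)
  -- Here `Ψ(1)` is `e^∨` and not `1`; it is absorbed by `Ξ(p)`, and the remaining `a Ξ(p) ⊗ (e^∨ ⊗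
  -- m)` equals `a ⊗ (p ⊗ m)` because `p e^∨ = p`.
  rw [oszToS_tmul, sToOSz_tmul, FS.val_mk, Psi_one, mul_assoc, mul_assoc, eVee_idem n k,
    Xi_val_mul_eVee, ← A.op_smul_Bl, op_smul_tmul', BTensor.smul_tmul, FOSz.smul_gen]

variable (n k M) in
/-- `F_k^S ⊗ (A_{n,k+1} ⊗ M) ≅ A_{n,k} ⊗ (F_k^{OSz} ⊗ M)`. -/
noncomputable def sEquivOSz : SPr n k M ≃ₗ[A n k] PrOSz n k M :=
  LinearEquiv.ofLinearMap (sToOSz n k M) (oszToS n k M) (LinearMap.ext sToOSz_oszToS)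
    (LinearMap.ext oszToS_sToOSz)

lemma sToOSz_mem_gr {𝓜 : ℤ → AddSubgroup M} {d : ℤ} {t : SPr n k M} (ht : t ∈ grSPr n k 𝓜 d) :
    sToOSz n k M t ∈ grPrOSz n k 𝓜 d := by
  refine map_mem_of_mem_gr ht (sToOSz n k M).toAddMonoidHom _ ?_
  rintro i j rfl p hp x hx
  -- Second reduction to generators, now for the inner factor: `x` becomes `a ⊗ m` with `a` and `m`
  -- homogeneous, and the three degrees are regrouped by associativity.
  refine map_mem_of_mem_gr hx (sToOSzAux p) _ ?_
  rintro i' j' rfl a ha m hm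
  rw [sToOSzAux_tmul, ← add_assoc]
  refine tmul_mem_gr (grA_mul hp (Psi_mem_grA ha)) ?_
  have := tmul_mem_gr (S := Bl n k) (C := Bl n (k + 1)) (FOSz.gen_mem (n := n) (k := k)) hm
  rwa [zero_add] at this

lemma oszToS_mem_gr {𝓜 : ℤ → AddSubgroup M} {d : ℤ} {t : PrOSz n k M}
    (ht : t ∈ grPrOSz n k 𝓜 d) : oszToS n k M t ∈ grSPr n k 𝓜 d := by
  refine map_mem_of_mem_gr ht (oszToS n k M).toAddMonoidHom _ ?_
  rintro i j rfl a ha x hx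
  refine map_mem_of_mem_gr hx (oszToSAux a) _ ?_
  rintro i' j' rfl p hp m hm
  rw [oszToSAux_tmul, ← add_assoc]
  -- The degree of `a Ξ(p)` is the sum of those of `a` and `p`, and `1 ⊗ m` has the degree of `m`
  -- because `1` has degree `0`.
  refine tmul_mem_gr ?_ ?_
  · rw [mem_grFS, FS.val_mk, mul_assoc, Xi_val_mul_eVee]
    exact grA_mul ha (Xi_mem_grA hp)
  · have := tmul_mem_gr (S := A n (k + 1)) (C := Bl n (k + 1)) (one_mem_grA n (k + 1)) hm
    rwa [zero_add] at this

variable (n k) in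
/-- The natural isomorphism `F_k^S ∘ pr ≅ pr ∘ F_k^{OSz}`. -/
noncomputable def sPrIsoPrOSz :
    prFunctor.{u} n (k + 1) ⋙ sFunctor.{u} n k ≅ oszFunctor.{u} n k ⋙ prFunctor.{u} n k :=
  NatIso.ofComponents (fun M => (sEquivOSz n k M).toModuleIso) fun {M N} f => by
    refine ModuleCat.hom_ext ?_
    -- Both composites send `p ⊗ (a ⊗ m)` to `p Ψ(a) ⊗ (e^∨ ⊗ f m)`, so once reduced to pure tensors
    -- in both variables the square commutes by definition.
    refine BTensor.hom_ext _ _ _ fun p x => ?_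
    exact DFunLike.congr_fun
      (f := (sToOSzAux p).comp (BTensor.map (A n (k + 1)) (Bl n (k + 1)) _ f.hom).toAddMonoidHom)
      (g := (BTensor.map (A n k) (Bl n k) (A n k)
        (BTensor.map (Bl n k) (Bl n (k + 1)) (FOSz n k) f.hom)).toAddMonoidHom.comp (sToOSzAux p))
      (addHom_ext fun a m => rfl) x

end
end OSzSartori

/-- Let `n ≥ 1`. The `(A_{n,k}, B_l(n,k+1))`-bimodules `_pr(F_k^{OSz})` and `(F_k^S)_infl` are
isomorphic as graded bimodules, and the functors `F_k^S ∘ pr` and `pr ∘ F_k^{OSz}` are naturally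
isomorphic, compatibly with the gradings. -/
theorem mainTheorem10 (n k : ℕ) [NeZero n] :
    (∃ θ : PrFOSz n k ≃ₗ[A n k] FS n k,
      (∀ (b : Bl n (k + 1)) (t : PrFOSz n k), θ (MulOpposite.op b • t) = MulOpposite.op b • θ t) ∧
      ∀ (d : ℤ) (t : PrFOSz n k), t ∈ grPrFOSz n k d ↔ θ t ∈ grFS n k d) ∧
    ∃ η : prFunctor.{u} n (k + 1) ⋙ sFunctor.{u} n k ≅ oszFunctor.{u} n k ⋙ prFunctor.{u} n k,
      ∀ (M : ModuleCat.{u} (Bl n (k + 1))) (𝓜 : ℤ → AddSubgroup M) (d : ℤ)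
        (t : ((prFunctor.{u} n (k + 1) ⋙ sFunctor.{u} n k).obj M)),
        t ∈ grSPr n k 𝓜 d ↔ (η.hom.app M).hom t ∈ grPrOSz n k 𝓜 d := by
  refine ⟨⟨prEquivFS n k, prToFS_op_smul, fun d t => ⟨prToFS_mem_grFS, fun h => ?_⟩⟩,
    ⟨sPrIsoPrOSz n k, fun M 𝓜 d t => ⟨sToOSz_mem_gr, fun h => ?_⟩⟩⟩
  -- For the converse implication the inverse map, which also preserves degree, is applied to `θ t`.
  · have := fsToPr_mem_gr h
    rwa [show fsToPr n k (prEquivFS n k t) = t from (prEquivFS n k).symm_apply_apply t] at this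
  -- The same argument with the inverse `oszToS`.
  · have := oszToS_mem_gr h
    rwa [show oszToS n k M (((sPrIsoPrOSz n k).hom.app M).hom t) = t from
      oszToS_sToOSz (n := n) (k := k) (M := M) t] at this
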